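/- **Problem.** Consider $\min f(x)$ s.t. $c(x)=0$, with $f:\mathbb R^n\to\mathbb R$, $c:\mathbb R^n\to\mathbb R^m$, $m\le n$, and $J=\nabla c^T$. Let $\mathcal X\subseteq\mathbb R^n$ be open and convex. On $\mathcal X$: $f$ is $C^1$ and bounded below, $\nabla f$ is bounded and $L$-Lipschitz ($L>0$), $c$ is $C^1$ and bounded, each $\nabla c_i$ is bounded and $\gamma_i$-Lipschitz ($\Gamma=\sum_i\gamma_i$), and the singular values of $J$ are bounded away from zero. Put $\phi(x,\tau)=\tau f(x)+\|c(x)\|_1$ and $\Delta l(x,\tau,g,d)=-\tau g^Td+\|c(x)\|_1-\|c(x)+J(x)d\|_1$. **Algorithm (SS-SQP).** Parameters: $\bar\tau_{-1}>0$, $\alpha_{\max}\in(0,1]$, $\alpha_0\in(0,\alpha_{\max}]$, $\gamma,\theta,\sigma,\epsilon_\tau\in(0,1)$; input: $x_0\in\mathbb R^n$, $\epsilon_f\ge0$. For $x$, symmetric $H$ and $g$, let $(d,y)$ solve $Hd+J(x)^Ty=-g$, $J(x)d=-c(x)$, and let $D=g^Td+\max\{d^THd,0\}$, $\tau^{\rm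 trial}=\infty$ if $D\le0$ and $\tau^{\rm trial}=(1-\sigma)\|c(x)\|_1/D$ otherwise. The update of $\tau$ with $(x,H,g)$ is $\tau$ if $\tau\le\tau^{\rm trial}$, and $\min\{(1-\epsilon_\tau)\tau,\tau^{\rm trial}\}$ otherwise. In iteration $k$, a matrix $H_k$ is chosen independently of $\bar g_k$ given the past, a gradient estimate $\bar g_k$ is drawn, $(\bar d_k,\bar y_k)$ is the solution for $(x_k,H_k,\bar g_k)$, $\bar\tau_k$ is the update of $\bar\tau_{k-1}$ with $(x_k,H_k,\bar g_k)$, and $x_k^+=x_k+\alpha_k\bar d_k$. With function estimates $\bar f_k,\bar f_k^+$ at $x_k,x_k^+$, if $$\bar\tau_k\bar f_k^++\|c(x_k^+)\|_1\le\bar\tau_k\bar f_k+\|c(x_k)\|_1-\alpha_k\theta\,\Delta l(x_k,\bar\tau_k,\bar g_k,\bar d_k)+2\bar\tau_k\epsilon_f,$$ then $x_{k+1}=x_k^+$, $\alpha_{k+1}=\min\{\alpha_{\max},\gamma^{-1}\alpha_k\}$; otherwise $x_{k+1}=x_k$, $\alpha_{k+1}=\gamma\alpha_k$. **Oracles.**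 Zeroth order, with $\nu,b\ge0$: the error $e(x)=|\bar f(x;\Xi^0)-f(x)|$ satisfies $\mathbb E[e(x)]\le\epsilon_f$ and $\mathbb E[e^{\lambda(e(x)-\mathbb E e(x))}]\le e^{\lambda^2\nu^2/2}$ for $\lambda\in[0,1/b]$, $x\in\mathcal X$. First order, with $\epsilon_g,\kappa_{\rm FO}\ge0$, $\delta\in[0,\frac12)$: given the past, with probability at least $1-\delta$, $\|\bar g_k-\nabla f(x_k)\|\le\max\{\epsilon_g,\kappa_{\rm FO}\alpha_k\sqrt{\Delta l(x_k,\bar\tau_k,\bar g_k,\bar d_k)}\}$. The estimates $\bar g_k,\bar f_k$ are drawn given the past, and $\bar f_k^+$ given the past and $\bar g_k$. Let $e_k,e_k^+$ be the errors at $x_k,x_k^+$. Either (a) $e_k,e_k^+\le\epsilon_f$ for all $k$, and then $p=1-\delta$; or (b) the sums $e_k+e_k^+$ are independent over $k$, and then $p=1-\delta-\exp(-\min\{\frac{u^2}{2\nu^2},\frac u{2b}\})$ with $u=\inf_{x\in\mathcal X}(\epsilon_f-\mathbb E[e(x)])$. Assume $p>\frac12$. **Assumptions on the run.** In every realization and for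 all $k$: $x_k,x_k^+\in\mathcal X$; $H_k$ is symmetric, $\|H_k\|\le\kappa_H$, and $u^TH_ku\ge\zeta\|u\|^2$ for $u\in\ker J(x_k)$; $\bar\tau_k\ge\bar\tau_{\min}$. Here $\kappa_H,\zeta,\bar\tau_{\min}>0$ are constants. Let $(d_k,y_k)$ be the solution for $(x_k,H_k,\nabla f(x_k))$ and $\tau_k$ the update of $\bar\tau_k$ with $(x_k,H_k,\nabla f(x_k))$. Let $f_{\inf}$ and $\phi_{\min}$ be lower bounds on $\mathcal X$ of $f$ and of $\phi(\cdot,\bar\tau_{\min})$. **Constants.** Given $\kappa_y,\kappa_l,\tau_{\min}>0$ put $q=1+\kappa_H/\zeta$, $q'=1+3\kappa_H/\zeta$, $\omega_2=\frac{\max\{\kappa_H,\kappa_y\}+1}{\kappa_l}$, $$\eta_1=\tfrac{(1-\theta)(1+\epsilon_\tau)\bar\tau_{-1}q}{\sqrt{\kappa_l\tau_{\min}}},\quad \eta_2=\sqrt{(1-\theta)^2\bar\tau_{-1}q^2\Big(\tfrac{(1+\epsilon_\tau)^2\bar\tau_{-1}}{\kappa_l\tau_{\min}}+\epsilon_\tau\Big)+4\bar\tau_{-1}\Big(\tfrac{1+\epsilon_\tau\omega_2}{\kappa_l}+\tfrac{(1-\theta)^2(1+\epsilon_\tau)}{\zeta}\Big)},$$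 $$\eta_3=\tfrac{(1-\theta)\bar\tau_{-1}(\bar\tau_{-1}q'+(1-\sigma)\tau_{\min}q)}{(1-\sigma)\tau_{\min}\sqrt{\kappa_l\tau_{\min}}},\quad \eta_4=\sqrt{\tfrac{(1-\theta)^2\bar\tau_{-1}^2(\bar\tau_{-1}q'+(1-\sigma)\tau_{\min}q)^2}{(1-\sigma)^2\tau_{\min}^3\kappa_l}+\tfrac{4\bar\tau_{-1}}{\kappa_l}+4(1-\theta)^2\Big(\tfrac{\bar\tau_{-1}^2q}{(1-\sigma)\tau_{\min}\zeta}+\tfrac{\bar\tau_{-1}}{\zeta}\Big)};$$ for $0<\eta<2(1-\theta)\min\{\frac1{\eta_1+\eta_2},\frac1{\eta_3+\eta_4}\}$ put $$\omega_3=\tfrac{q\kappa_{\rm FO}\sqrt{\bar\tau_{-1}}\alpha_{\max}}{\sqrt{\kappa_l}}+\tfrac{\bar\tau_{-1}\kappa_{\rm FO}^2\alpha_{\max}^2}{\zeta},$$ $$\omega_4=\max\Big\{\epsilon_\tau\Big(\tfrac{\max\{\kappa_H,\kappa_y\}}{\kappa_l}+\tfrac{\sqrt{\bar\tau_{-1}}q\kappa_{\rm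 FO}\alpha_{\max}}{\sqrt{\kappa_l}}+\omega_3\Big),\ \tfrac{\bar\tau_{-1}}{(1-\sigma)\tau_{\min}}\Big(\tfrac{q'\kappa_{\rm FO}\sqrt{\bar\tau_{-1}}\alpha_{\max}}{\sqrt{\kappa_l}}+q\tfrac{\bar\tau_{-1}\kappa_{\rm FO}^2\alpha_{\max}^2}{\zeta}\Big)\Big\},$$ $$\omega_5=(1+\epsilon_\tau)\bar\tau_{-1}\Big(\tfrac\eta\zeta+\tfrac q{\sqrt{\kappa_l\tau_{\min}}}\Big)+\tfrac{\epsilon_\tau\bar\tau_{-1}q^2\eta}4,\quad \omega_6=\tfrac{\bar\tau_{-1}^2}{(1-\sigma)\tau_{\min}}\Big(\tfrac{q\eta}\zeta+\tfrac{q'}{\sqrt{\kappa_l\tau_{\min}}}\Big)+\bar\tau_{-1}\Big(\tfrac\eta\zeta+\tfrac q{\sqrt{\kappa_l\tau_{\min}}}\Big),$$ $$M=1-\theta-\eta\sqrt{\tfrac{\bar\tau_{-1}}{\kappa_l}}\max\Big\{\sqrt{\tfrac{1+\epsilon_\tau\omega_2}{1-\eta\omega_5}},\tfrac1{\sqrt{1-\eta\omega_6}}\Big\},\quad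 K=\sqrt{\tfrac{\bar\tau_{-1}}{\kappa_l}}\kappa_{\rm FO}+\tfrac L{2\kappa_l}+\tfrac\Gamma{2\bar\tau_{\min}\kappa_l},$$ $$\omega_7=\sqrt{\tfrac{4\bar\tau_{-1}}{(p-\frac12)\theta}\max\Big\{\tfrac{1+\epsilon_\tau\omega_2}{1-\eta\omega_5},\tfrac1{1-\eta\omega_6},1+\omega_3+\omega_4\Big\}},\quad \omega_8=\sqrt{\max\Big\{\tfrac K{1-\theta},\tfrac{\bar\tau_{\min}L+\Gamma}{2\bar\tau_{\min}\kappa_lM}\Big\}},$$ $$\omega_p=\min\Big\{\tfrac{1-\eta\omega_5}{1+\epsilon_\tau\omega_2},1-\eta\omega_6,\tfrac1{1+\omega_3+\omega_4}\Big\},\quad \tilde\alpha=\min\Big\{\tfrac{1-\theta}K,\tfrac{2\bar\tau_{\min}\kappa_lM}{\bar\tau_{\min}L+\Gamma}\Big\},\quad \varepsilon_{\Delta l}=\tfrac{\sqrt{\kappa_l\tau_{\min}}}{\max\{\kappa_H,1\}}\,\varepsilon.$$ **Claim.** There are thresholds $\kappa_y^0,\kappa_l^0,\tau_{\min}^0>0$,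 depending only on the problem ($f,c,\mathcal X,L,\gamma_i$), the parameters of the algorithm and $\kappa_H,\zeta,\bar\tau_{\min}$ (not on $x_0$, the oracles, the noise levels or $\varepsilon$), such that for all $\kappa_y\ge\kappa_y^0$, $0<\kappa_l\le\kappa_l^0$, $0<\tau_{\min}\le\tau_{\min}^0$ the following holds for every run. 1. For all realizations and all $k$: $\|y_k\|\le\kappa_y$, $\tau_k\ge\tau_{\min}$, $\Delta l(x_k,\bar\tau_k,\bar g_k,\bar d_k)\ge\kappa_l\bar\tau_k(\|\bar d_k\|^2+\|c(x_k)\|)$ and $\Delta l(x_k,\tau_k,\nabla f(x_k),d_k)\ge\kappa_l\tau_k(\|d_k\|^2+\|c(x_k)\|)$. 2. Let $\eta$ be as above, $\varepsilon>\max\{\frac{\epsilon_g}\eta,\sqrt{\epsilon_f}\,\omega_7\omega_8\}\frac{\max\{\kappa_H,1\}}{\sqrt{\kappa_l\tau_{\min}}}$, and $T=\min\{k:\sqrt{\Delta l(x_k,\tau_k,\nabla f(x_k),d_k)}\le\varepsilon_{\Delta l}\}$. Whenever $T=k<\infty$, $\max\{\|\nabla f(x_k)+J(x_k)^Ty_k\|,\sqrt{\|c(x_k)\|}\}\le\varepsilon$.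 For all $s\ge0$, $\hat p\in\big(\frac12+\frac{4\bar\tau_{-1}\epsilon_f+s}{\tilde\alpha\theta\omega_p\varepsilon_{\Delta l}^2},\,p\big)$ and integers $t\ge\hat R\,\big/\big(\hat p-\frac12-\frac{4\bar\tau_{-1}\epsilon_f+s}{\tilde\alpha\theta\omega_p\varepsilon_{\Delta l}^2}\big)$, $$\mathbb P[T\le t]\ \ge\ 1-e^{-\frac{(p-\hat p)^2}{2p^2}t}-e^{-\min\left\{\frac{s^2t}{2(2\bar\tau_{-1}\nu)^2},\frac{st}{2(2\bar\tau_{-1}b)}\right\}},$$ where $$\hat R=\tfrac{\phi(x_0,\bar\tau_{-1})-\phi_{\min}-(\bar\tau_{-1}-\bar\tau_{\min})f_{\inf}}{\tilde\alpha\theta\omega_p\varepsilon_{\Delta l}^2}+\max\Big\{\tfrac{\ln\tilde\alpha-\ln\alpha_0}{2\ln\gamma},0\Big\}=\tfrac{\max\{\kappa_H^2,1\}}{\kappa_l\tau_{\min}}\cdot\tfrac{\phi(x_0,\bar\tau_{-1})-\phi_{\min}-(\bar\tau_{-1}-\bar\tau_{\min})f_{\inf}}{\tilde\alpha\theta\omega_p\varepsilon^2}+\max\Big\{\tfrac{\ln\tilde\alpha-\ln\alpha_0}{2\ln\gamma},0\Big\}.$$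 (In the exponents a positive number divided by zero is $+\infty$, and $0/0=0$.) -/

import Mathlib

open MeasureTheory ProbabilityTheory
open scoped ENNReal

noncomputable section

namespace SSSQP

/-- Euclidean space `ℝⁿ` with the `ℓ₂`-norm. -/
abbrev Vec (n : ℕ) : Type := EuclideanSpace ℝ (Fin n)

/-- The `ℓ₁`-norm. -/
def l1 {m : ℕ} (v : Vec m) : ℝ := ∑ i, |v i|

/-- `exp (-a)` for an extended nonnegative real `a`, with `exp (-∞) = 0`. -/
def expNeg (a : ℝ≥0∞) : ℝ := if a = ⊤ then 0 else Real.exp (-a.toReal)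

/-! ### The optimization problem -/

/-- The problem `min f(x)` subject to `c(x) = 0`, with a set `dom` that is to contain all iterates
and trial iterates. -/
structure Problem (n m : ℕ) where
  f : Vec n → ℝ
  c : Vec n → Vec m
  dom : Set (Vec n)

/-- The Jacobian `J(x) = ∇c(x)ᵀ`. -/
def Problem.jac {n m : ℕ} (P : Problem n m) (x : Vec n) : Vec n →L[ℝ] Vec m := fderiv ℝ P.c x

/-- The transposed Jacobian `J(x)ᵀ = ∇c(x)`. -/
def Problem.jacT {n m : ℕ} (P : Problem n m) (x : Vec n) : Vec m →L[ℝ] Vec n :=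
  ContinuousLinearMap.adjoint (P.jac x)

/-- The standing assumptions on the objective, the constraints and the set `dom`. -/
structure Problem.Regular {n m : ℕ} (P : Problem n m) (L : ℝ) (lip : Fin m → ℝ) : Prop where
  dim_le : m ≤ n
  isOpen_dom : IsOpen P.dom
  convex_dom : Convex ℝ P.dom
  contDiff_f : ContDiffOn ℝ 1 P.f P.dom
  f_bddBelow : BddBelow (P.f '' P.dom)
  /-- `L` is any positive Lipschitz constant of the gradient of `f`. -/
  L_pos : 0 < L
  grad_f_lipschitz : ∀ x ∈ P.dom, ∀ y ∈ P.dom, ‖gradient P.f x - gradient P.f y‖ ≤ L * ‖x - y‖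
  grad_f_bounded : ∃ κ : ℝ, ∀ x ∈ P.dom, ‖gradient P.f x‖ ≤ κ
  contDiff_c : ContDiffOn ℝ 1 P.c P.dom
  c_bounded : ∃ κ : ℝ, ∀ x ∈ P.dom, ‖P.c x‖ ≤ κ
  lip_nonneg : ∀ i, 0 ≤ lip i
  grad_c_lipschitz : ∀ i, ∀ x ∈ P.dom, ∀ y ∈ P.dom,
    ‖gradient (fun z => P.c z i) x - gradient (fun z => P.c z i) y‖ ≤ lip i * ‖x - y‖
  grad_c_bounded : ∀ i, ∃ κ : ℝ, ∀ x ∈ P.dom, ‖gradient (fun z => P.c z i) x‖ ≤ κ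
  /-- The `m` singular values of the `m × n` matrix `J(x)` are bounded away from zero. -/
  singularValues_lower : ∃ κ : ℝ, 0 < κ ∧ ∀ x ∈ P.dom, ∀ y : Vec m, κ * ‖y‖ ≤ ‖P.jacT x y‖

/-- The merit function `φ(x, τ) = τ f(x) + ‖c(x)‖₁`. -/
def Problem.merit {n m : ℕ} (P : Problem n m) (x : Vec n) (τ : ℝ) : ℝ := τ * P.f x + l1 (P.c x)

/-- The model `l(x, τ, g, d)` of the merit function. -/
def Problem.model {n m : ℕ} (P : Problem n m) (x : Vec n) (τ : ℝ) (g d : Vec n) : ℝ :=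
  τ * (P.f x + inner ℝ g d) + l1 (P.c x + P.jac x d)

/-- The model reduction `Δl(x, τ, g, d) = l(x, τ, g, 0) - l(x, τ, g, d)`. -/
def Problem.modelRed {n m : ℕ} (P : Problem n m) (x : Vec n) (τ : ℝ) (g d : Vec n) : ℝ :=
  P.model x τ g 0 - P.model x τ g d

/-! ### The SQP system and the merit parameter -/

/-- The block operator `[[H, Jᵀ], [J, 0]]`. -/
def Problem.kkt {n m : ℕ} (P : Problem n m) (x : Vec n) (H : Vec n →L[ℝ] Vec n) :
    (Vec n × Vec m) →L[ℝ] (Vec n × Vec m) :=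
  (H.comp (ContinuousLinearMap.fst ℝ (Vec n) (Vec m)) +
      (P.jacT x).comp (ContinuousLinearMap.snd ℝ (Vec n) (Vec m))).prod
    ((P.jac x).comp (ContinuousLinearMap.fst ℝ (Vec n) (Vec m)))

/-- The solution `(d, y)` of `[[H, Jᵀ], [J, 0]] (d, y) = -(g, c)`; the system is nonsingular under
the assumptions on `J` and `H`. -/
def Problem.sqp {n m : ℕ} (P : Problem n m) (x : Vec n) (H : Vec n →L[ℝ] Vec n) (g : Vec n) :
    Vec n × Vec m :=
  -(P.kkt x H).inverse (g, P.c x)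

/-- The primal search direction. -/
def Problem.dir {n m : ℕ} (P : Problem n m) (x : Vec n) (H : Vec n →L[ℝ] Vec n) (g : Vec n) :
    Vec n :=
  (P.sqp x H g).1

/-- The dual variable. -/
def Problem.mult {n m : ℕ} (P : Problem n m) (x : Vec n) (H : Vec n →L[ℝ] Vec n) (g : Vec n) :
    Vec m :=
  (P.sqp x H g).2

/-- What is assumed of the matrix `H` that is used at the point `x`. -/
def Problem.HAdmissible {n m : ℕ} (P : Problem n m) (κH ζ : ℝ) (x : Vec n)
    (H : Vec n →L[ℝ] Vec n) : Prop :=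
  IsSelfAdjoint H ∧ ‖H‖ ≤ κH ∧ ∀ u : Vec n, P.jac x u = 0 → ζ * ‖u‖ ^ 2 ≤ inner ℝ u (H u)

/-- The denominator `gᵀd + max {dᵀHd, 0}` in the trial merit parameter. -/
def Problem.tauDenom {n m : ℕ} (P : Problem n m) (x : Vec n) (H : Vec n →L[ℝ] Vec n)
    (g : Vec n) : ℝ :=
  inner ℝ g (P.dir x H g) + max (inner ℝ (P.dir x H g) (H (P.dir x H g))) 0

/-- The constant parameters of the algorithm; `τinit` is the initial merit parameter. -/
structure Params where
  τinit : ℝ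
  αmax : ℝ
  α0 : ℝ
  γ : ℝ
  θ : ℝ
  σ : ℝ
  ετ : ℝ

/-- The ranges of the algorithmic parameters. -/
structure Params.Valid (par : Params) : Prop where
  τinit_pos : 0 < par.τinit
  αmax_mem : par.αmax ∈ Set.Ioc (0 : ℝ) 1
  α0_mem : par.α0 ∈ Set.Ioc 0 par.αmax
  γ_mem : par.γ ∈ Set.Ioo (0 : ℝ) 1
  θ_mem : par.θ ∈ Set.Ioo (0 : ℝ) 1
  σ_mem : par.σ ∈ Set.Ioo (0 : ℝ) 1
  ετ_mem : par.ετ ∈ Set.Ioo (0 : ℝ) 1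

open Classical in
/-- The merit parameter update. The trial value is `(1 - σ) ‖c‖₁ / tauDenom`, and `∞` if
`tauDenom ≤ 0`; the old value `τ` is kept if it is at most the trial value, and otherwise it is
replaced by `min {(1 - ετ) τ, trial value}`. -/
def Problem.tauUpdate {n m : ℕ} (P : Problem n m) (par : Params) (x : Vec n)
    (H : Vec n →L[ℝ] Vec n) (g : Vec n) (τ : ℝ) : ℝ :=
  if P.tauDenom x H g ≤ 0 ∨ τ ≤ (1 - par.σ) * l1 (P.c x) / P.tauDenom x H g then τ
  else min ((1 - par.ετ) * τ) ((1 - par.σ) * l1 (P.c x) / P.tauDenom x H g)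

/-! ### The oracles -/

/-- A zeroth-order oracle: at `x` it draws `ξ` with law `law x` and returns `est x ξ`. -/
structure ZerothOracle (n : ℕ) (Ω₀ : Type*) [MeasurableSpace Ω₀] where
  law : Kernel (Vec n) Ω₀
  markov : IsMarkovKernel law
  est : Vec n → Ω₀ → ℝ
  measurable_est : Measurable (Function.uncurry est)

/-- The error `e(x; ξ) = |f̄(x; ξ) - f(x)|`. -/
def ZerothOracle.err {n m : ℕ} {Ω₀ : Type*} [MeasurableSpace Ω₀] (O : ZerothOracle n Ω₀)
    (P : Problem n m) (x : Vec n) (ξ : Ω₀) : ℝ :=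
  |O.est x ξ - P.f x|

/-- The condition of the zeroth-order oracle at `x`: the error has mean at most `εf` and is
one-sided sub-exponential with parameters `(ν, b)`, that is, the moment bound holds for
`λ ∈ [0, 1 / b]` (for all `λ ≥ 0` if `b = 0`). -/
def ZerothOracle.ValidAt {n m : ℕ} {Ω₀ : Type*} [MeasurableSpace Ω₀] (O : ZerothOracle n Ω₀)
    (P : Problem n m) (εf ν b : ℝ) (x : Vec n) : Prop :=
  Integrable (O.err P x) (O.law x) ∧ ∫ ξ, O.err P x ξ ∂(O.law x) ≤ εf ∧
    ∀ r : ℝ, 0 ≤ r → r * b ≤ 1 →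
      ∫⁻ ξ, ENNReal.ofReal
          (Real.exp (r * (O.err P x ξ - ∫ ξ', O.err P x ξ' ∂(O.law x)))) ∂(O.law x)
        ≤ ENNReal.ofReal (Real.exp (r ^ 2 * ν ^ 2 / 2))

/-- A query `(x, α, τ, H)` to the first-order oracle: the point, the step size, the previous merit
parameter and the matrix of the SQP system. -/
abbrev Query (n : ℕ) : Type := Vec n × ℝ × ℝ × (Vec n →L[ℝ] Vec n)

/-- A first-order oracle: at a query `q` with point `x` it draws `ξ` with law `law q` and returns
`est x ξ`. -/
structure FirstOracle (n : ℕ) (Ω₁ : Type*) [MeasurableSpace Ω₁] where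
  law : Kernel (Query n) Ω₁
  markov : IsMarkovKernel law
  est : Vec n → Ω₁ → Vec n
  measurable_est : Measurable (Function.uncurry est)

/-- The condition of the first-order oracle at a query `(x, α, τ, H)`: with probability at least
`1 - δ` the error `‖ḡ - ∇f(x)‖` is at most `max {εg, κFO α √Δl(x, τ̄, ḡ, d̄)}`. -/
def FirstOracle.ValidAt {n m : ℕ} {Ω₁ : Type*} [MeasurableSpace Ω₁] (O : FirstOracle n Ω₁)
    (P : Problem n m) (par : Params) (εg κFO δ : ℝ) (q : Query n) : Prop :=
  1 - δ ≤ (O.law q).real {ξ | ‖O.est q.1 ξ - gradient P.f q.1‖ ≤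
    max εg (κFO * q.2.1 * Real.sqrt (P.modelRed q.1
      (P.tauUpdate par q.1 q.2.2.2 (O.est q.1 ξ) q.2.2.1) (O.est q.1 ξ)
      (P.dir q.1 q.2.2.2 (O.est q.1 ξ))))}

/-! ### The algorithm -/

/-- A run-specific input: the starting point, the noise level `εf` and the oracles. -/
structure Input (n : ℕ) (Ω₀ Ω₁ : Type*) [MeasurableSpace Ω₀] [MeasurableSpace Ω₁] where
  x0 : Vec n
  εf : ℝ
  zeroth : ZerothOracle n Ω₀
  first : FirstOracle n Ω₁

/-- The state at the start of iteration `k`: `x = x_k`, `α = α_k`, `τ = τ̄_{k-1}`. -/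
structure State (n : ℕ) where
  x : Vec n
  α : ℝ
  τ : ℝ

/-- What is chosen or drawn in one iteration: the matrix `H_k`, the randomness `ξ_k^1` of the
gradient estimate, and the randomness `ξ_k^0`, `ξ_k^+` of the two function estimates. -/
structure Sample (n : ℕ) (Ω₀ Ω₁ : Type*) where
  H : Vec n →L[ℝ] Vec n
  ξ1 : Ω₁
  ξ0 : Ω₀
  ξp : Ω₀

section Algorithm

variable {n m : ℕ} {Ω₀ Ω₁ : Type*} [MeasurableSpace Ω₀] [MeasurableSpace Ω₁]

/-- The gradient estimate `ḡ_k`. -/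
def gbar (I : Input n Ω₀ Ω₁) (s : State n) (w : Sample n Ω₀ Ω₁) : Vec n := I.first.est s.x w.ξ1

/-- The search direction `d̄_k`. -/
def dbar (P : Problem n m) (I : Input n Ω₀ Ω₁) (s : State n) (w : Sample n Ω₀ Ω₁) : Vec n :=
  P.dir s.x w.H (gbar I s w)

/-- The merit parameter `τ̄_k`. -/
def taubar (P : Problem n m) (par : Params) (I : Input n Ω₀ Ω₁) (s : State n)
    (w : Sample n Ω₀ Ω₁) : ℝ :=
  P.tauUpdate par s.x w.H (gbar I s w) s.τ

/-- The trial iterate `x_k^+ = x_k + α_k d̄_k`. -/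
def trial (P : Problem n m) (I : Input n Ω₀ Ω₁) (s : State n) (w : Sample n Ω₀ Ω₁) : Vec n :=
  s.x + s.α • dbar P I s w

/-- The estimate `φ̄(x, τ; ξ) = τ f̄(x; ξ) + ‖c(x)‖₁` of the merit function. -/
def meritBar (P : Problem n m) (I : Input n Ω₀ Ω₁) (x : Vec n) (τ : ℝ) (ξ : Ω₀) : ℝ :=
  τ * I.zeroth.est x ξ + l1 (P.c x)

/-- The modified sufficient decrease condition. -/
def Accept (P : Problem n m) (par : Params) (I : Input n Ω₀ Ω₁) (s : State n)
    (w : Sample n Ω₀ Ω₁) : Prop :=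
  meritBar P I (trial P I s w) (taubar P par I s w) w.ξp ≤
    meritBar P I s.x (taubar P par I s w) w.ξ0
      - s.α * par.θ * P.modelRed s.x (taubar P par I s w) (gbar I s w) (dbar P I s w)
      + 2 * taubar P par I s w * I.εf

open Classical in
/-- One iteration of the algorithm. -/
def step (P : Problem n m) (par : Params) (I : Input n Ω₀ Ω₁) (s : State n)
    (w : Sample n Ω₀ Ω₁) : State n :=
  if Accept P par I s w then ⟨trial P I s w, min par.αmax (par.γ⁻¹ * s.α), taubar P par I s w⟩
  else ⟨s.x, par.γ * s.α, taubar P par I s w⟩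

/-- The state at the start of iteration `k`, for the samples `w 0, w 1, …`. -/
def state (P : Problem n m) (par : Params) (I : Input n Ω₀ Ω₁) (w : ℕ → Sample n Ω₀ Ω₁) :
    ℕ → State n
  | 0 => ⟨I.x0, par.α0, par.τinit⟩
  | k + 1 => step P par I (state P par I w k) (w k)

/-- The query that iteration `k` makes to the first-order oracle. -/
def query (P : Problem n m) (par : Params) (I : Input n Ω₀ Ω₁) (w : ℕ → Sample n Ω₀ Ω₁) (k : ℕ) :
    Query n :=
  ((state P par I w k).x, (state P par I w k).α, (state P par I w k).τ, (w k).H)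

/-- The iterate `x_k`. -/
def xk (P : Problem n m) (par : Params) (I : Input n Ω₀ Ω₁) (w : ℕ → Sample n Ω₀ Ω₁) (k : ℕ) :
    Vec n :=
  (state P par I w k).x

/-- The trial iterate `x_k^+`. -/
def xpk (P : Problem n m) (par : Params) (I : Input n Ω₀ Ω₁) (w : ℕ → Sample n Ω₀ Ω₁) (k : ℕ) :
    Vec n :=
  trial P I (state P par I w k) (w k)

/-- The gradient estimate `ḡ_k` along a run. -/
def gbark (P : Problem n m) (par : Params) (I : Input n Ω₀ Ω₁) (w : ℕ → Sample n Ω₀ Ω₁) (k : ℕ) :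
    Vec n :=
  gbar I (state P par I w k) (w k)

/-- The search direction `d̄_k` along a run. -/
def dbark (P : Problem n m) (par : Params) (I : Input n Ω₀ Ω₁) (w : ℕ → Sample n Ω₀ Ω₁) (k : ℕ) :
    Vec n :=
  dbar P I (state P par I w k) (w k)

/-- The merit parameter `τ̄_k` along a run. -/
def taubark (P : Problem n m) (par : Params) (I : Input n Ω₀ Ω₁) (w : ℕ → Sample n Ω₀ Ω₁)
    (k : ℕ) : ℝ :=
  taubar P par I (state P par I w k) (w k)

/-- The error `e_k` of the function estimate at `x_k`. -/
def ek (P : Problem n m) (par : Params) (I : Input n Ω₀ Ω₁) (w : ℕ → Sample n Ω₀ Ω₁) (k : ℕ) : ℝ :=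
  I.zeroth.err P (xk P par I w k) (w k).ξ0

/-- The error `e_k^+` of the function estimate at `x_k^+`. -/
def epk (P : Problem n m) (par : Params) (I : Input n Ω₀ Ω₁) (w : ℕ → Sample n Ω₀ Ω₁) (k : ℕ) : ℝ :=
  I.zeroth.err P (xpk P par I w k) (w k).ξp

/-- The true gradient `∇f_k`. -/
def gk (P : Problem n m) (par : Params) (I : Input n Ω₀ Ω₁) (w : ℕ → Sample n Ω₀ Ω₁) (k : ℕ) :
    Vec n :=
  gradient P.f (xk P par I w k)

/-- The deterministic direction `d_k`, computed with the true gradient. -/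
def dk (P : Problem n m) (par : Params) (I : Input n Ω₀ Ω₁) (w : ℕ → Sample n Ω₀ Ω₁) (k : ℕ) :
    Vec n :=
  P.dir (xk P par I w k) (w k).H (gk P par I w k)

/-- The deterministic dual variable `y_k`, computed with the true gradient. -/
def yk (P : Problem n m) (par : Params) (I : Input n Ω₀ Ω₁) (w : ℕ → Sample n Ω₀ Ω₁) (k : ℕ) :
    Vec m :=
  P.mult (xk P par I w k) (w k).H (gk P par I w k)

/-- The deterministic merit parameter `τ_k`: the update rule with the true gradient, applied to
`τ̄_k`. -/
def tauk (P : Problem n m) (par : Params) (I : Input n Ω₀ Ω₁) (w : ℕ → Sample n Ω₀ Ω₁) (k : ℕ) :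
    ℝ :=
  P.tauUpdate par (xk P par I w k) (w k).H (gk P par I w k) (taubark P par I w k)

/-- The deterministic model reduction `Δl(x_k, τ_k, ∇f_k, d_k)`. -/
def redk (P : Problem n m) (par : Params) (I : Input n Ω₀ Ω₁) (w : ℕ → Sample n Ω₀ Ω₁) (k : ℕ) :
    ℝ :=
  P.modelRed (xk P par I w k) (tauk P par I w k) (gk P par I w k) (dk P par I w k)

/-- The stochastic model reduction `Δl(x_k, τ̄_k, ḡ_k, d̄_k)`. -/
def redbark (P : Problem n m) (par : Params) (I : Input n Ω₀ Ω₁) (w : ℕ → Sample n Ω₀ Ω₁)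
    (k : ℕ) : ℝ :=
  P.modelRed (xk P par I w k) (taubark P par I w k) (gbark P par I w k) (dbark P par I w k)

/-- The stopping time `T = min {k : √Δl(x_k, τ_k, ∇f_k, d_k) ≤ e}`, which is `∞` if there is no
such `k`. -/
def stopTime (P : Problem n m) (par : Params) (I : Input n Ω₀ Ω₁) (w : ℕ → Sample n Ω₀ Ω₁)
    (e : ℝ) : ℕ∞ :=
  ⨅ (k : ℕ) (_ : Real.sqrt (redk P par I w k) ≤ e), (k : ℕ∞)

/-- The stochastic process generated by the algorithm. The σ-algebra `ℱ k` is what is known when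
iteration `k` starts and `H_k` has been chosen. Given `ℱ k`, the gradient is drawn from the
first-order oracle at the current query and `ξ_k^0` from the zeroth-order oracle at `x_k`;
given `ℱ k` and `ξ_k^1`, the sample `ξ_k^+` is drawn from the zeroth-order oracle at `x_k^+`. -/
structure IsRun {Ω : Type*} [mΩ : MeasurableSpace Ω] (μ : Measure Ω) (ℱ : Filtration ℕ mΩ)
    (P : Problem n m) (par : Params) (I : Input n Ω₀ Ω₁) (W : Ω → ℕ → Sample n Ω₀ Ω₁) : Prop where
  measurable_H : ∀ k, Measurable[ℱ k] (fun ω => (W ω k).H)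
  measurable_ξ1 : ∀ k, Measurable[ℱ (k + 1)] (fun ω => (W ω k).ξ1)
  measurable_ξ0 : ∀ k, Measurable[ℱ (k + 1)] (fun ω => (W ω k).ξ0)
  measurable_ξp : ∀ k, Measurable[ℱ (k + 1)] (fun ω => (W ω k).ξp)
  law_ξ1 : ∀ k, ∀ S : Set Ω₁, MeasurableSet S →
    μ⟦(fun ω => (W ω k).ξ1) ⁻¹' S | ℱ k⟧ =ᵐ[μ]
      fun ω => (I.first.law (query P par I (W ω) k)).real S
  law_ξ0 : ∀ k, ∀ S : Set Ω₀, MeasurableSet S →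
    μ⟦(fun ω => (W ω k).ξ0) ⁻¹' S | ℱ k⟧ =ᵐ[μ]
      fun ω => (I.zeroth.law (xk P par I (W ω) k)).real S
  law_ξp : ∀ k, ∀ S : Set Ω₀, MeasurableSet S →
    μ⟦(fun ω => (W ω k).ξp) ⁻¹' S |
        ℱ k ⊔ MeasurableSpace.comap (fun ω => (W ω k).ξ1) inferInstance⟧ =ᵐ[μ]
      fun ω => (I.zeroth.law (xpk P par I (W ω) k)).real S

/-- `u = inf {εf - 𝔼 e(x) : x ∈ dom}`. -/
def noiseGap (P : Problem n m) (I : Input n Ω₀ Ω₁) : ℝ :=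
  sInf ((fun x => I.εf - ∫ ξ, I.zeroth.err P x ξ ∂(I.zeroth.law x)) '' P.dom)

/-- The errors are deterministically bounded by `εf`. -/
def BoundedNoise {Ω : Type*} (P : Problem n m) (par : Params) (I : Input n Ω₀ Ω₁)
    (W : Ω → ℕ → Sample n Ω₀ Ω₁) : Prop :=
  ∀ ω k, ek P par I (W ω) k ≤ I.εf ∧ epk P par I (W ω) k ≤ I.εf

/-- The sums `e_k + e_k^+` are independent over the iterations. -/
def IndepNoise {Ω : Type*} [MeasurableSpace Ω] (μ : Measure Ω) (P : Problem n m) (par : Params)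
    (I : Input n Ω₀ Ω₁) (W : Ω → ℕ → Sample n Ω₀ Ω₁) : Prop :=
  iIndepFun (fun (k : ℕ) (ω : Ω) => ek P par I (W ω) k + epk P par I (W ω) k) μ

end Algorithm

/-- `min {v² / (2 ν²), v / (2 b)}` for nonnegative `v, ν, b`, where a quotient with positive
numerator and denominator zero is `∞`. -/
def bernsteinRate (v ν b : ℝ) : ℝ≥0∞ :=
  min (ENNReal.ofReal (v ^ 2) / ENNReal.ofReal (2 * ν ^ 2))
    (ENNReal.ofReal v / ENNReal.ofReal (2 * b))

/-! ### The constants of the complexity bound -/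

/-- The constants that enter the bound; `τbmin` is the lower bound for `τ̄_k`. -/
structure Constants extends Params where
  L : ℝ
  Γ : ℝ
  κH : ℝ
  ζ : ℝ
  κy : ℝ
  κl : ℝ
  τmin : ℝ
  τbmin : ℝ
  κFO : ℝ
  η : ℝ
  p : ℝ

namespace Constants

variable (C : Constants)

/-- `1 + κ_H / ζ`. -/
def q1 : ℝ := 1 + C.κH / C.ζ

/-- `1 + 3 κ_H / ζ`. -/
def q3 : ℝ := 1 + 3 * C.κH / C.ζ

def ω2 : ℝ := (max C.κH C.κy + 1) / C.κl

def η1 : ℝ := (1 - C.θ) * (1 + C.ετ) * C.τinit * C.q1 / √(C.κl * C.τmin)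

def η2 : ℝ :=
  √((1 - C.θ) ^ 2 * C.τinit * C.q1 ^ 2 * ((1 + C.ετ) ^ 2 * C.τinit / (C.κl * C.τmin) + C.ετ)
    + 4 * C.τinit * ((1 + C.ετ * C.ω2) / C.κl + (1 - C.θ) ^ 2 * (1 + C.ετ) / C.ζ))

def η3 : ℝ :=
  (1 - C.θ) * C.τinit * (C.τinit * C.q3 + (1 - C.σ) * C.τmin * C.q1)
    / ((1 - C.σ) * C.τmin * √(C.κl * C.τmin))

def η4 : ℝ :=
  √((1 - C.θ) ^ 2 * C.τinit ^ 2 * (C.τinit * C.q3 + (1 - C.σ) * C.τmin * C.q1) ^ 2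
      / ((1 - C.σ) ^ 2 * C.τmin ^ 3 * C.κl)
    + 4 * C.τinit / C.κl
    + 4 * (1 - C.θ) ^ 2 * (C.τinit ^ 2 * C.q1 / ((1 - C.σ) * C.τmin * C.ζ) + C.τinit / C.ζ))

def ω3 : ℝ :=
  C.q1 * C.κFO * √C.τinit * C.αmax / √C.κl + C.τinit * C.κFO ^ 2 * C.αmax ^ 2 / C.ζ

def ω4 : ℝ :=
  max
    (C.ετ * (max C.κH C.κy / C.κl + √C.τinit * C.q1 * C.κFO * C.αmax / √C.κl + C.ω3))
    (C.τinit / ((1 - C.σ) * C.τmin) *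
      (C.q3 * C.κFO * √C.τinit * C.αmax / √C.κl
        + C.q1 * (C.τinit * C.κFO ^ 2 * C.αmax ^ 2 / C.ζ)))

def ω5 : ℝ :=
  (1 + C.ετ) * C.τinit * (C.η / C.ζ + C.q1 / √(C.κl * C.τmin))
    + C.ετ * C.τinit * C.q1 ^ 2 * C.η / 4

def ω6 : ℝ :=
  C.τinit ^ 2 * (C.q1 * (C.η / C.ζ) + C.q3 / √(C.κl * C.τmin)) / ((1 - C.σ) * C.τmin)
    + C.τinit * (C.η / C.ζ + C.q1 / √(C.κl * C.τmin))

def ω7 : ℝ :=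
  √(4 * C.τinit / ((C.p - 1 / 2) * C.θ) *
    max (max ((1 + C.ετ * C.ω2) / (1 - C.η * C.ω5)) (1 / (1 - C.η * C.ω6))) (1 + C.ω3 + C.ω4))

/-- `1 - θ - η √(τ̄₋₁ / κ_l) max {√((1 + ε_τ ω₂) / (1 - η ω₅)), 1 / √(1 - η ω₆)}`. -/
def margin : ℝ :=
  1 - C.θ - C.η * √(C.τinit / C.κl) *
    max (√((1 + C.ετ * C.ω2) / (1 - C.η * C.ω5))) (1 / √(1 - C.η * C.ω6))

/-- `√(τ̄₋₁ / κ_l) κ_FO + L / (2 κ_l) + Γ / (2 τ̄_min κ_l)`. -/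
def curv : ℝ :=
  √(C.τinit / C.κl) * C.κFO + C.L / (2 * C.κl) + C.Γ / (2 * C.τbmin * C.κl)

def ω8 : ℝ :=
  √(max (C.curv / (1 - C.θ)) ((C.τbmin * C.L + C.Γ) / (2 * C.τbmin * C.κl * C.margin)))

def ωp : ℝ :=
  min (min ((1 - C.η * C.ω5) / (1 + C.ετ * C.ω2)) (1 - C.η * C.ω6)) (1 / (1 + C.ω3 + C.ω4))

/-- The step size threshold `α̃`. -/
def αtilde : ℝ :=
  min ((1 - C.θ) / C.curv) (2 * C.τbmin * C.κl * C.margin / (C.τbmin * C.L + C.Γ))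

/-- The admissible values of `η`. -/
def ηAdmissible : Prop :=
  0 < C.η ∧ C.η < 2 * (1 - C.θ) * min (1 / (C.η1 + C.η2)) (1 / (C.η3 + C.η4))

/-- The factor `max {κ_H, 1} / √(κ_l τ_min)` between `ε` and `ε_Δl`. -/
def scale : ℝ := max C.κH 1 / √(C.κl * C.τmin)

/-- The accuracy `ε_Δl` for the model reduction that belongs to the accuracy `ε`. -/
def εΔ (ε : ℝ) : ℝ := ε / C.scale

/-- The accuracy `ε` is above the level that the noise permits. -/
def Accuracy (εg εf ε : ℝ) : Prop := max (εg / C.η) (√εf * C.ω7 * C.ω8) * C.scale < ε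

/-- `h(α̃) = α̃ θ ω_p ε_Δl²`. -/
def progress (ε : ℝ) : ℝ := C.αtilde * C.θ * C.ωp * C.εΔ ε ^ 2

/-- `R̂`, where `gap = φ(x₀, τ̄₋₁) - φ_min - (τ̄₋₁ - τ̄_min) f_inf`. -/
def Rhat (gap ε : ℝ) : ℝ :=
  gap / C.progress ε + max ((Real.log C.αtilde - Real.log C.α0) / (2 * Real.log C.γ)) 0

end Constants

end SSSQP

end

/-!
The argument splits into a deterministic analysis of one realization and two tail bounds.

Decompose a direction into its normal part, which solves `J v = -c`, and a tangential part in
`ker J`, on which `H` is coercive. Since the singular values of `J` are bounded below, this gives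
uniform bounds for directions and multipliers, and hence thresholds for `κ_y`, `κ_l` and `τ_min`
that depend on the problem, the parameters and the bounds for `H` and the merit parameter only
(`exists_thresholds`). For an arbitrary gradient estimate the model reduction dominates `‖d‖² + ‖c‖` as soon as the merit parameter respects its trial value.

If the gradient estimate of an iteration is accurate, then its error is small relative to one of the
two model reductions, and they are comparable: `ω_p Δl ≤ Δ̄l` (`GoodRun.favourable_compare`). Before
the stopping time an iteration that is moreover not spoiled by noise is accepted once its step size
is at most about `α̃` (`GoodRun.accept_of_favourable`), and if it is accepted with a step of at least
`α̃`, then it decreases the merit function by `progress ε` up to the noise. Step sizes move on the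
grid of powers of `γ`, but `α̃` need not lie on the orbit of `α₀`. This is absorbed by slack in the
thresholds: `κ_l` is taken below `γ²` times the constant that the model reduction really satisfies,
so steps below `α̃ / γ` are accepted as well, and below a multiple of `γ α₀`, so that `α̃ ≤ γ α₀`.
With `level` as the number of factors `γ` between `α̃` and the current step, each favourable
iteration makes progress or lowers `|level|`; this is the counting bound `two_mul_count_le`. Together
with the nonnegativity of the potential it shows that the stopping time is at most `t` whenever more
than `p̂ t` of the first `t` iterations are favourable and their noise adds up to at most
`(2 ε_f + s / τ̄₋₁) t` (`GoodRun.exists_sqrt_redk_le`).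

Both conditions fail with small probability. The laws of the samples given the past are those of the
oracles, so conditional probabilities and exponential moments of one iteration can be computed with
the state frozen (`lintegral_mul_of_condLaw`). Products of conditionally bounded factors then yield
the Chernoff bounds `measure_count_le` and `measure_sum_gt_le`. The conditional
exponential moment of `e_k + e_k⁺` is bounded by convexity, whatever the dependence between the two
errors (`IsRun.lintegral_exp_noise_le`).
-/

namespace SSSQP

/-! ### The SQP system -/

lemma l1_nonneg {m : ℕ} (v : Vec m) : 0 ≤ l1 v := Finset.sum_nonneg fun _ _ => abs_nonneg _

lemma norm_le_l1 {m : ℕ} (v : Vec m) : ‖v‖ ≤ l1 v := by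
  refine abs_le_of_sq_le_sq' ?_ (l1_nonneg v) |>.2
  rw [EuclideanSpace.norm_sq_eq]
  simp only [Real.norm_eq_abs]
  exact Finset.sum_sq_le_sq_sum_of_nonneg fun _ _ => abs_nonneg _

lemma abs_inner_map_le {n : ℕ} {H : Vec n →L[ℝ] Vec n} {κH : ℝ} (hH : ‖H‖ ≤ κH) (u v : Vec n) :
    |inner ℝ u (H v)| ≤ κH * ‖u‖ * ‖v‖ := by
  calc |inner ℝ u (H v)| ≤ ‖u‖ * ‖H v‖ := abs_real_inner_le_norm _ _
    _ ≤ ‖u‖ * (κH * ‖v‖) := by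
        gcongr
        exact (H.le_opNorm v).trans (by gcongr)
    _ = _ := by ring

section System

variable {n m : ℕ} {P : Problem n m} {x g : Vec n} {H : Vec n →L[ℝ] Vec n} {κJ κH ζ : ℝ}

lemma inner_jacT (y : Vec m) (u : Vec n) : inner ℝ (P.jacT x y) u = inner ℝ y (P.jac x u) :=
  ContinuousLinearMap.adjoint_inner_left _ _ _

lemma kkt_apply (z : Vec n × Vec m) :
    P.kkt x H z = (H z.1 + P.jacT x z.2, P.jac x z.1) := rfl

lemma Problem.HAdmissible.inner_symm (hH : P.HAdmissible κH ζ x H) (u v : Vec n) :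
    inner ℝ (H u) v = inner ℝ u (H v) := by
  have h := ContinuousLinearMap.adjoint_inner_left H v u
  rwa [← ContinuousLinearMap.star_eq_adjoint, hH.1.star_eq] at h

/-- The block operator of the SQP system is invertible: it is injective, because `H` is positive
definite on the kernel of the Jacobian and the transposed Jacobian is injective. -/
lemma kkt_isInvertible (hκJ : 0 < κJ) (hJ : ∀ y, κJ * ‖y‖ ≤ ‖P.jacT x y‖) (hζ : 0 < ζ)
    (hH : P.HAdmissible κH ζ x H) : (P.kkt x H).IsInvertible := by
  have hinj : Function.Injective (P.kkt x H).toLinearMap := by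
    rw [← LinearMap.ker_eq_bot, LinearMap.ker_eq_bot']
    rintro ⟨d, y⟩ hz
    have hz' : P.kkt x H (d, y) = 0 := hz
    rw [kkt_apply] at hz'
    obtain ⟨h1, h2⟩ := Prod.mk_eq_zero.1 hz'
    simp only at h1 h2
    have h3 : inner ℝ d (H d) = 0 := by
      have : inner ℝ (H d + P.jacT x y) d = 0 := by rw [h1, inner_zero_left]
      rw [inner_add_left, inner_jacT, h2, inner_zero_right, add_zero] at this
      rwa [real_inner_comm]
    have h4 := hH.2.2 d h2
    have hd : d = 0 := by
      have h5 : ‖d‖ ^ 2 ≤ 0 := by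
        by_contra! hc
        nlinarith [mul_pos hζ hc]
      have : ‖d‖ = 0 := by nlinarith [norm_nonneg d]
      exact norm_eq_zero.1 this
    have hy : y = 0 := by
      rw [hd, map_zero, zero_add] at h1
      have h6 := hJ y
      rw [h1, norm_zero] at h6
      have : ‖y‖ ≤ 0 := by
        by_contra! hc
        nlinarith [mul_pos hκJ hc]
      exact norm_le_zero_iff.1 this
    rw [hd, hy]; rfl
  refine ⟨(LinearEquiv.ofInjectiveEndo _ hinj).toContinuousLinearEquiv, ?_⟩
  exact ContinuousLinearMap.ext fun _ => rfl

lemma kkt_sqp (h : (P.kkt x H).IsInvertible) (g : Vec n) :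
    P.kkt x H (P.sqp x H g) = -(g, P.c x) := by
  obtain ⟨e, he⟩ := h
  rw [Problem.sqp, map_neg, ← he, ContinuousLinearMap.inverse_equiv]
  simp

lemma sqp_fst (hκJ : 0 < κJ) (hJ : ∀ y, κJ * ‖y‖ ≤ ‖P.jacT x y‖) (hζ : 0 < ζ)
    (hH : P.HAdmissible κH ζ x H) (g : Vec n) :
    H (P.dir x H g) + P.jacT x (P.mult x H g) = -g :=
  congrArg Prod.fst (kkt_sqp (kkt_isInvertible hκJ hJ hζ hH) g)

lemma jac_dir (hκJ : 0 < κJ) (hJ : ∀ y, κJ * ‖y‖ ≤ ‖P.jacT x y‖) (hζ : 0 < ζ)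
    (hH : P.HAdmissible κH ζ x H) (g : Vec n) : P.jac x (P.dir x H g) = -P.c x :=
  congrArg Prod.snd (kkt_sqp (kkt_isInvertible hκJ hJ hζ hH) g)

/-- The gradient tested against `w`, from the first block row of the SQP system. -/
lemma inner_grad (hκJ : 0 < κJ) (hJ : ∀ y, κJ * ‖y‖ ≤ ‖P.jacT x y‖) (hζ : 0 < ζ)
    (hH : P.HAdmissible κH ζ x H) (g w : Vec n) :
    inner ℝ g w = -inner ℝ (P.dir x H g) (H w) - inner ℝ (P.mult x H g) (P.jac x w) := by
  have h := sqp_fst hκJ hJ hζ hH g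
  have h2 : g = -(H (P.dir x H g) + P.jacT x (P.mult x H g)) := by rw [h, neg_neg]
  conv_lhs => rw [h2]
  rw [inner_neg_left, inner_add_left, inner_jacT, hH.inner_symm]
  ring

/-- The search direction splits orthogonally into a tangential part in the kernel of the Jacobian
and a normal part of size `O(‖c‖)` that does not depend on `H` and `g`: the normal part is the
search direction for the identity matrix and the gradient `0`. -/
lemma dir_decomp (hκJ : 0 < κJ) (hJ : ∀ y, κJ * ‖y‖ ≤ ‖P.jacT x y‖) (hζ : 0 < ζ)
    (hH : P.HAdmissible κH ζ x H) (g : Vec n) :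
    ∃ u v : Vec n, P.dir x H g = u + v ∧ P.jac x u = 0 ∧ ‖P.dir x H g‖ ^ 2 = ‖u‖ ^ 2 + ‖v‖ ^ 2 ∧
      κJ * ‖v‖ ≤ ‖P.c x‖ := by
  have hid : P.HAdmissible 1 1 x (ContinuousLinearMap.id ℝ (Vec n)) := by
    refine ⟨IsSelfAdjoint.one _, ContinuousLinearMap.norm_id_le, fun u _ => ?_⟩
    rw [ContinuousLinearMap.id_apply, real_inner_self_eq_norm_sq, one_mul]
  set v := P.dir x (ContinuousLinearMap.id ℝ (Vec n)) 0 with hv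
  set y := P.mult x (ContinuousLinearMap.id ℝ (Vec n)) 0 with hy
  have h1 : v + P.jacT x y = 0 := by simpa using sqp_fst hκJ hJ one_pos hid 0
  have h2 : P.jac x v = -P.c x := jac_dir hκJ hJ one_pos hid 0
  have hvy : v = -P.jacT x y := eq_neg_of_add_eq_zero_left h1
  have hu : P.jac x (P.dir x H g - v) = 0 := by rw [map_sub, jac_dir hκJ hJ hζ hH, h2, sub_self]
  refine ⟨P.dir x H g - v, v, by abel, hu, ?_, ?_⟩
  · have horth : inner ℝ (P.dir x H g - v) v = 0 := by
      rw [real_inner_comm, hvy, inner_neg_left, ← hvy, inner_jacT, hu, inner_zero_right, neg_zero]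
    have := norm_add_sq_eq_norm_sq_add_norm_sq_of_inner_eq_zero _ _ horth
    rw [sub_add_cancel] at this
    rw [pow_two, pow_two, pow_two, this]
  · have h3 : ‖v‖ ^ 2 ≤ ‖y‖ * ‖P.c x‖ := by
      have : ‖v‖ ^ 2 = inner ℝ y (P.c x) := by
        rw [← real_inner_self_eq_norm_sq]
        conv_lhs => rw [hvy]
        rw [inner_neg_left, ← hvy, inner_jacT, h2, inner_neg_right, neg_neg]
      rw [this]
      exact real_inner_le_norm _ _
    have h4 : κJ * ‖y‖ ≤ ‖v‖ := by rw [hvy, norm_neg]; exact hJ y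
    by_cases h0 : ‖v‖ = 0
    · rw [h0, mul_zero]; exact norm_nonneg _
    · have hpos : 0 < ‖v‖ := lt_of_le_of_ne (norm_nonneg _) (Ne.symm h0)
      refine le_of_mul_le_mul_left ?_ hpos
      nlinarith [norm_nonneg (P.c x)]

/-- Curvature along a sum of a tangential vector `u` and an arbitrary vector `v`. -/
lemma curvature_lower (hH : P.HAdmissible κH ζ x H) {u v : Vec n} (hu : P.jac x u = 0) :
    ζ * ‖u‖ ^ 2 - 2 * κH * ‖u‖ * ‖v‖ - κH * ‖v‖ ^ 2 ≤ inner ℝ (u + v) (H (u + v)) := by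
  have h1 := hH.2.2 u hu
  have h2 := abs_le.1 (abs_inner_map_le hH.2.1 u v)
  have h3 := abs_le.1 (abs_inner_map_le hH.2.1 v v)
  have h4 : inner ℝ v (H u) = inner ℝ u (H v) := by rw [← hH.inner_symm, real_inner_comm]
  rw [map_add, inner_add_left, inner_add_right, inner_add_right, h4]
  nlinarith [h1, h2.1, h3.1]

lemma modelRed_eq {τ : ℝ} {d : Vec n} (hd : P.jac x d = -P.c x) (g : Vec n) :
    P.modelRed x τ g d = -τ * inner ℝ g d + l1 (P.c x) := by
  have h0 : l1 (0 : Vec m) = 0 := by simp [l1]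
  simp only [Problem.modelRed, Problem.model, hd, map_zero, inner_zero_right, add_zero,
    add_neg_cancel, h0]
  ring

/-- After an update the merit parameter is at most the trial value. -/
lemma tauUpdate_mul_tauDenom_le {par : Params} (hpar : par.Valid) {τ : ℝ}
    (hpos : 0 < P.tauUpdate par x H g τ) :
    P.tauUpdate par x H g τ * P.tauDenom x H g ≤ (1 - par.σ) * l1 (P.c x) := by
  by_cases hD : P.tauDenom x H g ≤ 0
  · exact (mul_nonpos_of_nonneg_of_nonpos hpos.le hD).trans
      (mul_nonneg (by linarith [hpar.σ_mem.2]) (l1_nonneg _))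
  push Not at hD
  unfold Problem.tauUpdate at hpos ⊢
  split_ifs with h
  · rcases h with h | h
    · exact absurd h (not_le.2 hD)
    · exact (le_div_iff₀ hD).1 h
  · exact (le_div_iff₀ hD).1 (min_le_right _ _)

lemma tauUpdate_le {par : Params} (hpar : par.Valid) {τ : ℝ} (hτ : 0 ≤ τ) :
    P.tauUpdate par x H g τ ≤ τ := by
  unfold Problem.tauUpdate
  split_ifs with h
  · exact le_rfl
  · exact (min_le_left _ _).trans (by nlinarith [hpar.ετ_mem.1])

end System

/-! ### The thresholds -/

/-- The model reduction dominates `‖d‖² + ‖c‖` if the merit parameter is at most the trial value.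
The curvature term, used with a small weight `w`, controls the tangential part of `d`; what it loses
in the normal part is paid by the reduction `σ ‖c‖₁` of the constraint violation. -/
lemma modelRed_lower {n m : ℕ} {P : Problem n m} {x g : Vec n} {H : Vec n →L[ℝ] Vec n}
    {κJ κH ζ σ τi τ w N : ℝ} (hκJ : 0 < κJ) (hJ : ∀ y, κJ * ‖y‖ ≤ ‖P.jacT x y‖) (hζ : 0 < ζ)
    (hH : P.HAdmissible κH ζ x H) (hκH : 0 ≤ κH) (hτi : 0 < τi) (hσ : 0 < σ) (hw0 : 0 < w)
    (hw1 : w ≤ 1) (hN0 : 0 ≤ N) (hN : ‖P.c x‖ ≤ N * κJ ^ 2)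
    (hwA : τi * w * ((2 * κH ^ 2 / ζ + κH) * N) ≤ σ / 2) (hτ : 0 < τ) (hτle : τ ≤ τi)
    (htrial : τ * P.tauDenom x H g ≤ (1 - σ) * l1 (P.c x)) :
    min (w * ζ / 2) (σ / (2 * τi * (1 + N))) * τ * (‖P.dir x H g‖ ^ 2 + ‖P.c x‖)
      ≤ P.modelRed x τ g (P.dir x H g) := by
  obtain ⟨u, v, h1, h2, h3, h4⟩ := dir_decomp hκJ hJ hζ hH g
  rw [modelRed_eq (jac_dir hκJ hJ hζ hH g)]
  have h5 := curvature_lower (v := v) hH h2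
  rw [← h1] at h5
  rw [h3]
  rw [Problem.tauDenom] at htrial
  obtain ⟨A, hA⟩ : ∃ A, A = (2 * κH ^ 2 / ζ + κH) * N := ⟨_, rfl⟩
  obtain ⟨κl, hκl⟩ : ∃ κl, κl = min (w * ζ / 2) (σ / (2 * τi * (1 + N))) := ⟨_, rfl⟩
  obtain ⟨Q, hQ⟩ : ∃ Q, Q = inner ℝ (P.dir x H g) (H (P.dir x H g)) := ⟨_, rfl⟩
  rw [← hA] at hwA
  rw [← hκl]
  rw [← hQ] at h5 htrial
  have hA0 : 0 ≤ A := by rw [hA]; positivity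
  have hc0 := norm_nonneg (P.c x)
  have hcl := norm_le_l1 (P.c x)
  have hvN : ‖v‖ ^ 2 ≤ N * ‖P.c x‖ := by
    have h6 : (κJ ^ 2) * ‖v‖ ^ 2 ≤ κJ ^ 2 * (N * ‖P.c x‖) := by
      calc κJ ^ 2 * ‖v‖ ^ 2 = (κJ * ‖v‖) * (κJ * ‖v‖) := by ring
        _ ≤ ‖P.c x‖ * ‖P.c x‖ := by gcongr
        _ ≤ N * κJ ^ 2 * ‖P.c x‖ := by gcongr
        _ = _ := by ring
    exact le_of_mul_le_mul_left h6 (by positivity)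
  have hcurv : ζ / 2 * ‖u‖ ^ 2 - A * ‖P.c x‖ ≤ Q := by
    have h6 : 2 * κH * ‖u‖ * ‖v‖ ≤ ζ / 2 * ‖u‖ ^ 2 + 2 * κH ^ 2 / ζ * ‖v‖ ^ 2 := by
      have h7 : 0 ≤ ζ / 2 * (‖u‖ - 2 * κH / ζ * ‖v‖) ^ 2 := by positivity
      have h8 : ζ / 2 * (‖u‖ - 2 * κH / ζ * ‖v‖) ^ 2
          = ζ / 2 * ‖u‖ ^ 2 + 2 * κH ^ 2 / ζ * ‖v‖ ^ 2 - 2 * κH * ‖u‖ * ‖v‖ := by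
        field_simp
        ring
      linarith
    have h9 : (2 * κH ^ 2 / ζ + κH) * ‖v‖ ^ 2 ≤ A * ‖P.c x‖ := by
      rw [hA, mul_assoc]; gcongr
    linarith
  have hmax : w * Q ≤ max Q 0 := by
    rcases le_total Q 0 with h | h
    · exact (mul_nonpos_of_nonneg_of_nonpos hw0.le h).trans (le_max_right _ _)
    · exact (mul_le_of_le_one_left h hw1).trans (le_max_left _ _)
  have hl0 : 0 < κl := by rw [hκl]; exact lt_min (by positivity) (by positivity)
  have hl1 : κl ≤ w * ζ / 2 := by rw [hκl]; exact min_le_left _ _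
  have hl2 : κl * τi * (1 + N) ≤ σ / 2 := by
    have : κl ≤ σ / (2 * τi * (1 + N)) := by rw [hκl]; exact min_le_right _ _
    rw [le_div_iff₀ (by positivity)] at this
    linarith
  have e1 : τ * (w * (ζ / 2 * ‖u‖ ^ 2 - A * ‖P.c x‖)) ≤ τ * max Q 0 := by
    gcongr
    exact (mul_le_mul_of_nonneg_left hcurv hw0.le).trans hmax
  have e2 : τ * w * A * ‖P.c x‖ ≤ σ / 2 * ‖P.c x‖ := by
    have : τ * w * A ≤ τi * w * A := by gcongr
    gcongr
    linarith
  have e3 : κl * τ * (‖v‖ ^ 2 + ‖P.c x‖) ≤ σ / 2 * ‖P.c x‖ := by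
    calc κl * τ * (‖v‖ ^ 2 + ‖P.c x‖) ≤ κl * τi * (N * ‖P.c x‖ + ‖P.c x‖) := by gcongr
      _ = κl * τi * (1 + N) * ‖P.c x‖ := by ring
      _ ≤ _ := by gcongr
  have e4 : κl * τ * ‖u‖ ^ 2 ≤ τ * (w * (ζ / 2 * ‖u‖ ^ 2)) := by
    calc κl * τ * ‖u‖ ^ 2 ≤ w * ζ / 2 * τ * ‖u‖ ^ 2 := by gcongr
      _ = _ := by ring
  have e5 : σ * ‖P.c x‖ ≤ σ * l1 (P.c x) := by gcongr
  linarith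

/-- The uniform bounds behind the thresholds. The multiplier for the true gradient is bounded, the
update with the true gradient keeps the merit parameter away from zero, and the model reduction for
an arbitrary gradient estimate dominates `‖d‖² + ‖c‖` as soon as the merit parameter is at most the
trial value. -/
lemma exists_thresholds {n m : ℕ} {P : Problem n m} {par : Params} {L : ℝ} {lip : Fin m → ℝ}
    {κH ζ τbmin : ℝ} (hP : P.Regular L lip) (hpar : par.Valid) (hκH : 0 < κH) (hζ : 0 < ζ)
    (hτb : 0 < τbmin) :
    ∃ κy κl τmin : ℝ, 0 < κy ∧ 0 < κl ∧ 0 < τmin ∧ ∀ x ∈ P.dom, ∀ H, P.HAdmissible κH ζ x H →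
      ‖P.mult x H (gradient P.f x)‖ ≤ κy ∧
      (∀ τ, τbmin ≤ τ → τmin ≤ P.tauUpdate par x H (gradient P.f x) τ) ∧
      ∀ g τ, 0 < τ → τ ≤ par.τinit →
        τ * P.tauDenom x H g ≤ (1 - par.σ) * l1 (P.c x) →
        κl * τ * (‖P.dir x H g‖ ^ 2 + ‖P.c x‖) ≤ P.modelRed x τ g (P.dir x H g) := by
  obtain ⟨G₀, hG₀⟩ := hP.grad_f_bounded
  obtain ⟨S₀, hS₀⟩ := hP.c_bounded
  obtain ⟨κJ, hκJ, hJ⟩ := hP.singularValues_lower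
  obtain ⟨G, hGpos, hG⟩ : ∃ G : ℝ, 0 ≤ G ∧ ∀ x ∈ P.dom, ‖gradient P.f x‖ ≤ G :=
    ⟨|G₀|, abs_nonneg _, fun x hx => (hG₀ x hx).trans (le_abs_self _)⟩
  obtain ⟨S, hSpos, hS⟩ : ∃ S : ℝ, 0 ≤ S ∧ ∀ x ∈ P.dom, ‖P.c x‖ ≤ S :=
    ⟨|S₀|, abs_nonneg _, fun x hx => (hS₀ x hx).trans (le_abs_self _)⟩
  have hτi := hpar.τinit_pos
  obtain ⟨hσ0, hσ1⟩ := hpar.σ_mem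
  obtain ⟨hε0, hε1⟩ := hpar.ετ_mem
  -- bounds for the normal part, the tangential part and the multiplier
  obtain ⟨V, hV⟩ : ∃ V, V = S / κJ := ⟨_, rfl⟩
  obtain ⟨U, hU⟩ : ∃ U, U = (κH * V + G) / ζ := ⟨_, rfl⟩
  obtain ⟨Y, hY⟩ : ∃ Y, Y = (G + κH * (U + V)) / κJ + 1 := ⟨_, rfl⟩
  -- `B ‖c‖₁` bounds the denominator of the trial merit parameter
  obtain ⟨B, hB⟩ : ∃ B, B = κH * (2 * U + V) / κJ + Y := ⟨_, rfl⟩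
  have hV0 : 0 ≤ V := by rw [hV]; positivity
  have hU0 : 0 ≤ U := by rw [hU]; positivity
  have hY0 : 0 < Y := by rw [hY]; positivity
  have hB0 : 0 < B := by rw [hB]; positivity
  -- the squared normal part is at most `N ‖c‖`, and `A ‖c‖` bounds its effect on the curvature
  obtain ⟨N, hN⟩ : ∃ N, N = S / κJ ^ 2 := ⟨_, rfl⟩
  have hN0 : 0 ≤ N := by rw [hN]; positivity
  obtain ⟨A, hA⟩ : ∃ A, A = (2 * κH ^ 2 / ζ + κH) * N := ⟨_, rfl⟩
  have hA0 : 0 ≤ A := by rw [hA]; positivity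
  -- the weight with which the curvature term is used
  obtain ⟨w, hw⟩ : ∃ w, w = min 1 (par.σ / (2 * par.τinit * (A + 1))) := ⟨_, rfl⟩
  have hw0 : 0 < w := by rw [hw]; exact lt_min one_pos (by positivity)
  have hw1 : w ≤ 1 := by rw [hw]; exact min_le_left _ _
  have hwA : par.τinit * w * A ≤ par.σ / 2 := by
    have h1 : w ≤ par.σ / (2 * par.τinit * (A + 1)) := by rw [hw]; exact min_le_right _ _
    rw [le_div_iff₀ (by positivity)] at h1
    have : 0 ≤ par.τinit * w := by positivity
    nlinarith
  refine ⟨Y, min (w * ζ / 2) (par.σ / (2 * par.τinit * (1 + N))),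
    min ((1 - par.ετ) * τbmin) ((1 - par.σ) / B), hY0, lt_min (by positivity) (by positivity),
    lt_min (mul_pos (by linarith) hτb) (div_pos (by linarith) hB0), ?_⟩
  intro x hx H hH
  have hJx := hJ x hx
  have hmult : ∀ u v : Vec n, P.dir x H (gradient P.f x) = u + v → P.jac x u = 0 →
      κJ * ‖v‖ ≤ ‖P.c x‖ → ‖u‖ ≤ U ∧ ‖v‖ ≤ V ∧ ‖P.mult x H (gradient P.f x)‖ ≤ Y := by
    intro u v huv hu hv
    have hvV : ‖v‖ ≤ V := by
      rw [hV, le_div_iff₀ hκJ]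
      linarith [hS x hx]
    have huU : ‖u‖ ≤ U := by
      have h1 := inner_grad hκJ hJx hζ hH (gradient P.f x) u
      rw [hu, inner_zero_right, sub_zero, huv, inner_add_left] at h1
      have h2 := hH.2.2 u hu
      have h3 := abs_le.1 (abs_inner_map_le hH.2.1 v u)
      have h4 := abs_le.1 (abs_real_inner_le_norm (gradient P.f x) u)
      have h5 : ‖u‖ * (ζ * ‖u‖) ≤ ‖u‖ * (κH * V + G) := by
        have h6 : κH * ‖v‖ * ‖u‖ ≤ κH * V * ‖u‖ := by gcongr
        have h7 : ‖gradient P.f x‖ * ‖u‖ ≤ G * ‖u‖ := by gcongr; exact hG x hx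
        nlinarith [h3.1, h4.1]
      rw [hU, le_div_iff₀ hζ]
      by_cases h0 : ‖u‖ = 0
      · rw [h0]; nlinarith [mul_nonneg hκH.le hV0]
      · have := le_of_mul_le_mul_left h5 (lt_of_le_of_ne (norm_nonneg _) (Ne.symm h0))
        linarith
    refine ⟨huU, hvV, ?_⟩
    have h1 := sqp_fst hκJ hJx hζ hH (gradient P.f x)
    have h2 : P.jacT x (P.mult x H (gradient P.f x))
        = -gradient P.f x - H (P.dir x H (gradient P.f x)) := by rw [← h1]; abel
    have h3 := hJx (P.mult x H (gradient P.f x))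
    have h4 : ‖P.jacT x (P.mult x H (gradient P.f x))‖ ≤ G + κH * (U + V) := by
      rw [h2]
      refine (norm_sub_le _ _).trans ?_
      rw [norm_neg]
      refine add_le_add (hG x hx) ?_
      refine (H.le_opNorm _).trans ?_
      rw [huv]
      have := norm_add_le u v
      gcongr
      · exact hH.2.1
      · linarith
    have h5 : ‖P.mult x H (gradient P.f x)‖ ≤ (G + κH * (U + V)) / κJ := by
      rw [le_div_iff₀ hκJ]; linarith
    linarith
  refine ⟨?_, ?_, ?_⟩
  · obtain ⟨u, v, h1, h2, -, h4⟩ := dir_decomp hκJ hJx hζ hH (gradient P.f x)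
    exact (hmult u v h1 h2 h4).2.2
  · intro τ hτ
    obtain ⟨u, v, h1, h2, -, h4⟩ := dir_decomp hκJ hJx hζ hH (gradient P.f x)
    obtain ⟨huU, hvV, hyY⟩ := hmult u v h1 h2 h4
    have hD : P.tauDenom x H (gradient P.f x) ≤ B * l1 (P.c x) := by
      have h5 := inner_grad hκJ hJx hζ hH (gradient P.f x) (P.dir x H (gradient P.f x))
      rw [jac_dir hκJ hJx hζ hH, inner_neg_right] at h5
      have h6 : inner ℝ (P.mult x H (gradient P.f x)) (P.c x) ≤ Y * ‖P.c x‖ :=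
        (real_inner_le_norm _ _).trans (by gcongr)
      have h7 := curvature_lower (v := v) hH h2
      rw [← h1] at h7
      have h8 : κH * ‖v‖ * (2 * ‖u‖ + ‖v‖) ≤ κH * (2 * U + V) / κJ * ‖P.c x‖ := by
        have : ‖v‖ ≤ ‖P.c x‖ / κJ := by rw [le_div_iff₀ hκJ]; linarith
        calc κH * ‖v‖ * (2 * ‖u‖ + ‖v‖) ≤ κH * (‖P.c x‖ / κJ) * (2 * U + V) := by gcongr
          _ = _ := by ring
      have h9 : 0 ≤ ζ * ‖u‖ ^ 2 := by positivity
      have h10 : 0 ≤ κH * ‖v‖ * (2 * ‖u‖ + ‖v‖) := by positivity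
      have h11 : P.tauDenom x H (gradient P.f x) ≤ B * ‖P.c x‖ := by
        rw [Problem.tauDenom, hB, add_mul]
        rcases max_cases (inner ℝ (P.dir x H (gradient P.f x))
          (H (P.dir x H (gradient P.f x)))) 0 with ⟨h, _⟩ | ⟨h, _⟩ <;> rw [h] <;> linarith
      exact h11.trans (by gcongr; exact norm_le_l1 _)
    unfold Problem.tauUpdate
    split_ifs with h
    · refine (min_le_left _ _).trans (le_trans ?_ hτ)
      exact mul_le_of_le_one_left hτb.le (by linarith only [hε0])
    · push Not at h
      have hDpos := h.1
      refine min_le_min ?_ ?_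
      · exact mul_le_mul_of_nonneg_left hτ (by linarith only [hε1])
      · rw [div_le_div_iff₀ hB0 hDpos, mul_assoc]
        exact mul_le_mul_of_nonneg_left (by linarith only [hD]) (by linarith only [hσ1])
  · intro g τ hτ hτle htrial
    exact modelRed_lower hκJ hJx hζ hH hκH.le hτi hσ0 hw0 hw1 hN0
      (by rw [hN, div_mul_cancel₀ _ (by positivity)]; exact hS x hx) (by rw [← hA]; exact hwA)
      hτ hτle htrial

/-! ### Perturbation of the gradient -/

section Perturbation

variable {n m : ℕ} {P : Problem n m} {x : Vec n} {H : Vec n →L[ℝ] Vec n} {κJ κH ζ : ℝ}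

/-- How the step reacts to the gradient: the change of the direction is tangential, so that the
first block row, tested against it, gives its energy. -/
lemma dir_sub (hκJ : 0 < κJ) (hJ : ∀ y, κJ * ‖y‖ ≤ ‖P.jacT x y‖) (hζ : 0 < ζ)
    (hH : P.HAdmissible κH ζ x H) (g g' : Vec n) :
    P.jac x (P.dir x H g' - P.dir x H g) = 0 ∧
    inner ℝ (g' - g) (P.dir x H g' - P.dir x H g) =
      -inner ℝ (P.dir x H g' - P.dir x H g) (H (P.dir x H g' - P.dir x H g)) ∧
    0 ≤ inner ℝ (P.dir x H g' - P.dir x H g) (H (P.dir x H g' - P.dir x H g)) ∧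
    inner ℝ (P.dir x H g' - P.dir x H g) (H (P.dir x H g' - P.dir x H g)) ≤ ‖g' - g‖ ^ 2 / ζ ∧
    ‖P.dir x H g' - P.dir x H g‖ ≤ ‖g' - g‖ / ζ := by
  obtain ⟨w, hw⟩ : ∃ w, w = P.dir x H g' - P.dir x H g := ⟨_, rfl⟩
  have hJw : P.jac x w = 0 := by
    rw [hw, map_sub, jac_dir hκJ hJ hζ hH, jac_dir hκJ hJ hζ hH, sub_self]
  have h1 : inner ℝ (g' - g) w = -inner ℝ w (H w) := by
    rw [inner_sub_left, inner_grad hκJ hJ hζ hH g, inner_grad hκJ hJ hζ hH g', hJw,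
      inner_zero_right, inner_zero_right]
    conv_rhs => rw [hw, inner_sub_left, ← hw]
    ring
  have h2 := hH.2.2 w hJw
  have h3 := abs_le.1 (abs_real_inner_le_norm (g' - g) w)
  rw [h1] at h3
  have hwn : ‖w‖ ≤ ‖g' - g‖ / ζ := by
    rw [le_div_iff₀ hζ]
    by_cases h0 : ‖w‖ = 0
    · rw [h0, zero_mul]; exact norm_nonneg _
    · refine le_of_mul_le_mul_left ?_ (lt_of_le_of_ne (norm_nonneg w) (Ne.symm h0))
      linarith [h3.1]
  rw [← hw]
  refine ⟨hJw, h1, le_trans (by positivity) h2, ?_, hwn⟩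
  calc inner ℝ w (H w) ≤ ‖g' - g‖ * ‖w‖ := by linarith [h3.1]
    _ ≤ ‖g' - g‖ * (‖g' - g‖ / ζ) := by gcongr
    _ = _ := by ring

/-- The change of `gᵀd` and of the denominator of the trial merit parameter under a change of the
gradient. The bound may be taken relative to either of the two directions. -/
lemma inner_dir_sub_le (hκJ : 0 < κJ) (hJ : ∀ y, κJ * ‖y‖ ≤ ‖P.jacT x y‖) (hζ : 0 < ζ)
    (hH : P.HAdmissible κH ζ x H) (g g' : Vec n) {ρ : ℝ}
    (hρ : ρ = ‖P.dir x H g‖ ∨ ρ = ‖P.dir x H g'‖) :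
    |inner ℝ g (P.dir x H g) - inner ℝ g' (P.dir x H g')|
        ≤ (1 + κH / ζ) * ‖g' - g‖ * ρ + ‖g' - g‖ ^ 2 / ζ ∧
      P.tauDenom x H g - P.tauDenom x H g'
        ≤ (1 + κH / ζ) * ‖g' - g‖ * ρ + ‖g' - g‖ ^ 2 / ζ := by
  have hκH : 0 ≤ κH := (norm_nonneg _).trans hH.2.1
  obtain ⟨hJw, hew, hr0, hr1, hwn⟩ := dir_sub hκJ hJ hζ hH g g'
  obtain ⟨d, hd⟩ : ∃ d, d = P.dir x H g := ⟨_, rfl⟩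
  obtain ⟨d', hd'⟩ : ∃ d', d' = P.dir x H g' := ⟨_, rfl⟩
  have hgw := inner_grad hκJ hJ hζ hH g (P.dir x H g' - P.dir x H g)
  rw [hJw, inner_zero_right, sub_zero] at hgw
  simp only [Problem.tauDenom]
  rw [← hd, ← hd'] at hρ hJw hew hr0 hr1 hwn hgw ⊢
  obtain ⟨w, hw⟩ : ∃ w, w = d' - d := ⟨_, rfl⟩
  rw [← hw] at hJw hew hr0 hr1 hwn hgw
  have hdw : d' = d + w := by rw [hw]; abel
  have hsymm : inner ℝ w (H d) = inner ℝ d (H w) := by rw [← hH.inner_symm, real_inner_comm]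
  -- `X` is the change of `gᵀd` and `Q` that of `dᵀHd`, relative to `d` and relative to `d'`
  obtain ⟨r, hr⟩ : ∃ r, r = inner ℝ w (H w) := ⟨_, rfl⟩
  have hd'w : inner ℝ d' (H w) = inner ℝ d (H w) + r := by rw [hdw, inner_add_left, hr]
  have hed' : inner ℝ (g' - g) d' = inner ℝ (g' - g) d - r := by
    rw [hdw, inner_add_right, hew, hr]; ring
  have hX : inner ℝ g d - inner ℝ g' d' = -inner ℝ (g' - g) d' + inner ℝ d (H w) := by
    rw [inner_sub_left]
    have : inner ℝ g d' = inner ℝ g d - inner ℝ d (H w) := by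
      rw [hdw, inner_add_right, hgw]; ring
    rw [this]; ring
  have hQ : inner ℝ d (H d) - inner ℝ d' (H d') = -2 * inner ℝ d (H w) - r := by
    rw [hdw, map_add, inner_add_left, inner_add_right, inner_add_right, hsymm, hr]; ring
  rw [← hr] at hr0 hr1
  have hmax : max (inner ℝ d (H d)) 0 - max (inner ℝ d' (H d')) 0
      ≤ max (inner ℝ d (H d) - inner ℝ d' (H d')) 0 := by
    rcases max_cases (inner ℝ d (H d)) 0 with h | h <;>
    rcases max_cases (inner ℝ d' (H d')) 0 with h' | h' <;>
    rcases max_cases (inner ℝ d (H d) - inner ℝ d' (H d')) 0 with h'' | h'' <;> linarith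
  have key : ∀ z : Vec n, |inner ℝ (g' - g) z| ≤ ‖g' - g‖ * ‖z‖ ∧
      |inner ℝ z (H w)| ≤ κH / ζ * ‖g' - g‖ * ‖z‖ := by
    refine fun z => ⟨abs_real_inner_le_norm _ _, (abs_inner_map_le hH.2.1 z w).trans ?_⟩
    calc κH * ‖z‖ * ‖w‖ ≤ κH * ‖z‖ * (‖g' - g‖ / ζ) := by gcongr
      _ = _ := by ring
  have hrr : (0 : ℝ) ≤ ‖g' - g‖ ^ 2 / ζ := by positivity
  rcases hρ with rfl | rfl
  · obtain ⟨k1, k2⟩ := key d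
    rw [abs_le] at k1 k2
    have e : (1 + κH / ζ) * ‖g' - g‖ * ‖d‖ = ‖g' - g‖ * ‖d‖ + κH / ζ * ‖g' - g‖ * ‖d‖ := by ring
    rw [e]
    refine ⟨abs_le.2 ⟨by linarith [k1.1, k1.2, k2.1, k2.2], by linarith [k1.1, k1.2, k2.1, k2.2]⟩,
      ?_⟩
    rcases max_cases (inner ℝ d (H d) - inner ℝ d' (H d')) 0 with h | h <;>
      linarith [k1.1, k1.2, k2.1, k2.2]
  · obtain ⟨k1, k2⟩ := key d'
    rw [abs_le] at k1 k2
    have e : (1 + κH / ζ) * ‖g' - g‖ * ‖d'‖ = ‖g' - g‖ * ‖d'‖ + κH / ζ * ‖g' - g‖ * ‖d'‖ := by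
      ring
    rw [e]
    refine ⟨abs_le.2 ⟨by linarith [k1.1, k1.2, k2.1, k2.2], by linarith [k1.1, k1.2, k2.1, k2.2]⟩,
      ?_⟩
    rcases max_cases (inner ℝ d (H d) - inner ℝ d' (H d')) 0 with h | h <;>
      linarith [k1.1, k1.2, k2.1, k2.2]

/-- An upper bound of `g'ᵀd'` that uses the multiplier for `g` only: the multiplier for the
estimate `g'` need not be bounded. -/
lemma inner_dir_le (hκJ : 0 < κJ) (hJ : ∀ y, κJ * ‖y‖ ≤ ‖P.jacT x y‖) (hζ : 0 < ζ)
    (hH : P.HAdmissible κH ζ x H) (g g' : Vec n) {κy : ℝ} (hy : ‖P.mult x H g‖ ≤ κy) :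
    inner ℝ g' (P.dir x H g') ≤ max κH κy * (‖P.dir x H g'‖ ^ 2 + ‖P.c x‖)
      + (1 + κH / ζ) * ‖g' - g‖ * ‖P.dir x H g'‖ := by
  have hκH : 0 ≤ κH := (norm_nonneg _).trans hH.2.1
  obtain ⟨-, -, -, -, hwn⟩ := dir_sub hκJ hJ hζ hH g g'
  have h1 := inner_grad hκJ hJ hζ hH g (P.dir x H g')
  rw [jac_dir hκJ hJ hζ hH, inner_neg_right] at h1
  obtain ⟨d, hd⟩ : ∃ d, d = P.dir x H g := ⟨_, rfl⟩
  obtain ⟨d', hd'⟩ : ∃ d', d' = P.dir x H g' := ⟨_, rfl⟩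
  rw [← hd'] at h1 ⊢
  rw [← hd] at h1
  rw [← hd, ← hd'] at hwn
  have h2 : inner ℝ g' d' = inner ℝ (g' - g) d' + inner ℝ g d' := by rw [inner_sub_left]; ring
  have h3 : inner ℝ d (H d') = inner ℝ d' (H d') - inner ℝ (d' - d) (H d') := by
    rw [inner_sub_left]; ring
  have h4 := abs_le.1 (abs_inner_map_le hH.2.1 d' d')
  have h5 := abs_le.1 (abs_inner_map_le hH.2.1 (d' - d) d')
  have h6 := real_inner_le_norm (g' - g) d'
  have h7 : inner ℝ (P.mult x H g) (P.c x) ≤ κy * ‖P.c x‖ :=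
    (real_inner_le_norm _ _).trans (by gcongr)
  have h8 : κH * ‖d' - d‖ * ‖d'‖ ≤ κH / ζ * ‖g' - g‖ * ‖d'‖ := by
    calc κH * ‖d' - d‖ * ‖d'‖ ≤ κH * (‖g' - g‖ / ζ) * ‖d'‖ := by gcongr
      _ = _ := by ring
  have h9 : κH * ‖d'‖ ^ 2 ≤ max κH κy * ‖d'‖ ^ 2 := by gcongr; exact le_max_left _ _
  have h10 : κy * ‖P.c x‖ ≤ max κH κy * ‖P.c x‖ := by gcongr; exact le_max_right _ _
  have e : (1 + κH / ζ) * ‖g' - g‖ * ‖d'‖ = ‖g' - g‖ * ‖d'‖ + κH / ζ * ‖g' - g‖ * ‖d'‖ := by ring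
  rw [e]
  linarith [h4.1, h5.2]

/-- The loss of model reduction when the gradient `g` and the merit parameter updated with `g` are
replaced by an estimate `g'` and the old merit parameter. If the update takes the trial value, then
the trial conditions `τ D = (1 - σ) ‖c‖₁ ≥ τ' D'` compare the merit parameters. -/
lemma modelRed_sub_le {par : Params} (hpar : par.Valid) (hκJ : 0 < κJ)
    (hJ : ∀ y, κJ * ‖y‖ ≤ ‖P.jacT x y‖) (hζ : 0 < ζ)
    (hH : P.HAdmissible κH ζ x H) (g g' : Vec n) {τ' R : ℝ} (hτ' : 0 < τ')
    (htrial : τ' * P.tauDenom x H g' ≤ (1 - par.σ) * l1 (P.c x))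
    (hR1 : |inner ℝ g (P.dir x H g) - inner ℝ g' (P.dir x H g')| ≤ R)
    (hR2 : P.tauDenom x H g - P.tauDenom x H g' ≤ R) :
    P.modelRed x (P.tauUpdate par x H g τ') g (P.dir x H g)
        - P.modelRed x τ' g' (P.dir x H g') ≤ 2 * (τ' * R) ∨
      P.modelRed x (P.tauUpdate par x H g τ') g (P.dir x H g)
        - P.modelRed x τ' g' (P.dir x H g')
          ≤ (1 + par.ετ) * (τ' * R) + par.ετ * (τ' * inner ℝ g' (P.dir x H g')) := by
  obtain ⟨hε0, hε1⟩ := hpar.ετ_mem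
  rw [modelRed_eq (jac_dir hκJ hJ hζ hH g), modelRed_eq (jac_dir hκJ hJ hζ hH g')]
  obtain ⟨a, ha⟩ : ∃ a, a = inner ℝ g (P.dir x H g) := ⟨_, rfl⟩
  obtain ⟨b, hb⟩ : ∃ b, b = inner ℝ g' (P.dir x H g') := ⟨_, rfl⟩
  have haD : a ≤ P.tauDenom x H g := by
    rw [Problem.tauDenom, ← ha]; linarith [le_max_right (inner ℝ (P.dir x H g) (H (P.dir x H g))) 0]
  rw [← ha, ← hb] at hR1 ⊢
  have hX := abs_le.1 hR1
  have hR0 : 0 ≤ R := (abs_nonneg _).trans hR1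
  have hτR : 0 ≤ τ' * R := by positivity
  have hX1 : τ' * (b - a) ≤ τ' * R := by gcongr; linarith [hX.1]
  unfold Problem.tauUpdate
  split_ifs with h
  · left; linarith
  · push Not at h
    rcases min_cases ((1 - par.ετ) * τ') ((1 - par.σ) * l1 (P.c x) / P.tauDenom x H g) with
      ⟨hm, -⟩ | ⟨hm, hlt⟩
    · right
      rw [hm]
      have h1 : par.ετ * (τ' * (a - b)) ≤ par.ετ * (τ' * R) := by gcongr; linarith [hX.2]
      linarith
    · left
      rw [hm]
      obtain ⟨t, ht⟩ : ∃ t, t = (1 - par.σ) * l1 (P.c x) / P.tauDenom x H g := ⟨_, rfl⟩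
      have htD : t * P.tauDenom x H g = (1 - par.σ) * l1 (P.c x) := by
        rw [ht, div_mul_cancel₀ _ h.1.ne']
      rw [← ht] at hlt h ⊢
      -- the trial conditions replace `(τ' - t) D` by `τ' (D - D')`
      have h1 : (τ' - t) * a ≤ τ' * R := by
        calc (τ' - t) * a ≤ (τ' - t) * P.tauDenom x H g :=
              mul_le_mul_of_nonneg_left haD (by linarith [h.2])
          _ ≤ τ' * (P.tauDenom x H g - P.tauDenom x H g') := by linarith
          _ ≤ τ' * R := by gcongr
      linarith

end Perturbation

/-! ### The constants -/

/-- The signs of the constants. -/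
structure Constants.Valid (C : Constants) : Prop where
  par : C.toParams.Valid
  L_pos : 0 < C.L
  Γ_nonneg : 0 ≤ C.Γ
  κH_pos : 0 < C.κH
  ζ_pos : 0 < C.ζ
  κl_pos : 0 < C.κl
  τmin_pos : 0 < C.τmin
  τbmin_pos : 0 < C.τbmin
  κFO_nonneg : 0 ≤ C.κFO

/-- The number `2 A / (r₁ + r₂)` with `r₂² = r₁² + 4 a` is the positive root of
`a η² + A r₁ η = A²`. -/
lemma quadratic_lt_of_lt_root {A a r₁ r₂ η : ℝ} (hη : 0 < η) (hr₁ : 0 ≤ r₁)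
    (hr₂ : 0 ≤ r₂) (hr : r₂ ^ 2 = r₁ ^ 2 + 4 * a) (h : η < 2 * A * (1 / (r₁ + r₂))) :
    a * η ^ 2 + A * r₁ * η < A ^ 2 := by
  have hpos : 0 < r₁ + r₂ := by
    rcases (add_nonneg hr₁ hr₂).eq_or_lt with h0 | h0
    · rw [← h0, div_zero, mul_zero] at h; linarith
    · exact h0
  rw [mul_one_div, lt_div_iff₀ hpos] at h
  have h1 : η * r₂ < 2 * A - η * r₁ := by linarith
  have h2 : (η * r₂) ^ 2 < (2 * A - η * r₁) ^ 2 :=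
    pow_lt_pow_left₀ h1 (by positivity) two_ne_zero
  have h3 : (η * r₂) ^ 2 = η ^ 2 * r₁ ^ 2 + 4 * (a * η ^ 2) := by rw [mul_pow, hr]; ring
  nlinarith

namespace Constants

variable {C : Constants}

lemma Valid.q1_one_le (hC : C.Valid) : 1 ≤ C.q1 := by
  have := hC.κH_pos; have := hC.ζ_pos
  rw [q1]; linarith [show 0 < C.κH / C.ζ by positivity]

lemma Valid.q1_le_q3 (hC : C.Valid) : C.q1 ≤ C.q3 := by
  have := hC.κH_pos; have := hC.ζ_pos
  rw [q1, q3, mul_div_assoc]; linarith [show 0 < C.κH / C.ζ by positivity]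

lemma Valid.q3_one_le (hC : C.Valid) : 1 ≤ C.q3 := hC.q1_one_le.trans hC.q1_le_q3

lemma Valid.ω2_pos (hC : C.Valid) : 0 < C.ω2 := by
  have := hC.κH_pos; have := hC.κl_pos
  rw [ω2]
  have : 0 < max C.κH C.κy := lt_max_of_lt_left hC.κH_pos
  positivity

lemma Valid.ω3_nonneg (hC : C.Valid) : 0 ≤ C.ω3 := by
  have h1 := hC.q1_one_le; have := hC.κFO_nonneg; have := hC.ζ_pos
  have := hC.par.τinit_pos; have := hC.par.αmax_mem.1
  rw [ω3]; positivity

lemma Valid.ω4_nonneg (hC : C.Valid) : 0 ≤ C.ω4 := by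
  have h1 := hC.q1_one_le; have h2 := hC.q3_one_le; have := hC.κFO_nonneg; have := hC.ζ_pos
  have := hC.par.τinit_pos; have := hC.par.αmax_mem.1; have := hC.τmin_pos
  have : 0 < 1 - C.σ := by linarith [hC.par.σ_mem.2]
  rw [ω4]
  refine le_max_of_le_right ?_
  positivity

/-- The first half of the condition on `η`: it keeps the margin positive in the case that the
update with the true gradient multiplies the merit parameter by `1 - ε_τ`. -/
lemma ηAdmissible.first (hC : C.Valid) (h : C.ηAdmissible) :
    C.η ^ 2 * (C.τinit / C.κl * (1 + C.ετ * C.ω2)) < (1 - C.θ) ^ 2 * (1 - C.η * C.ω5) := by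
  obtain ⟨hη, hlt⟩ := h
  have hA : 0 < 1 - C.θ := by linarith [hC.par.θ_mem.2]
  have hε := hC.par.ετ_mem.1
  have hτ := hC.par.τinit_pos
  have hq := hC.q1_one_le
  have hl := hC.κl_pos
  have hm := hC.τmin_pos
  have hζ := hC.ζ_pos
  have hω := hC.ω2_pos
  obtain ⟨s, hs⟩ : ∃ s, s = √(C.κl * C.τmin) := ⟨_, rfl⟩
  have hs0 : 0 < s := by rw [hs]; positivity
  have hs2 : C.κl * C.τmin = s ^ 2 := by rw [hs, Real.sq_sqrt (by positivity)]
  have h1 : 0 ≤ C.η1 := by rw [η1]; positivity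
  have h2 : 0 ≤ C.η2 := Real.sqrt_nonneg _
  have h3 : C.η2 ^ 2 = C.η1 ^ 2 + 4 * (C.τinit * (1 + C.ετ * C.ω2) / C.κl
      + (1 - C.θ) ^ 2 * (1 + C.ετ) * C.τinit / C.ζ
      + (1 - C.θ) ^ 2 * C.ετ * C.τinit * C.q1 ^ 2 / 4) := by
    rw [η2, Real.sq_sqrt (by positivity), η1, ← hs, hs2]
    field_simp
    ring
  have h4 := quadratic_lt_of_lt_root hη h1 h2 h3
    (hlt.trans_le (mul_le_mul_of_nonneg_left (min_le_left _ _) (by linarith)))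
  have h5 : (1 - C.θ) ^ 2 * (C.η * C.ω5) = ((1 - C.θ) ^ 2 * (1 + C.ετ) * C.τinit / C.ζ
      + (1 - C.θ) ^ 2 * C.ετ * C.τinit * C.q1 ^ 2 / 4) * C.η ^ 2
      + (1 - C.θ) * C.η1 * C.η := by
    rw [ω5, η1, ← hs]
    field_simp
    ring
  have h6 : C.η ^ 2 * (C.τinit / C.κl * (1 + C.ετ * C.ω2))
      = C.τinit * (1 + C.ετ * C.ω2) / C.κl * C.η ^ 2 := by ring
  rw [mul_sub, mul_one, h5, h6]
  linarith

/-- The second half of the condition on `η`: it keeps the margin positive in the case that the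
update with the true gradient takes the trial value. -/
lemma ηAdmissible.second (hC : C.Valid) (h : C.ηAdmissible) :
    C.η ^ 2 * (C.τinit / C.κl) < (1 - C.θ) ^ 2 * (1 - C.η * C.ω6) := by
  obtain ⟨hη, hlt⟩ := h
  have hA : 0 < 1 - C.θ := by linarith [hC.par.θ_mem.2]
  have hσ : 0 < 1 - C.σ := by linarith [hC.par.σ_mem.2]
  have hτ := hC.par.τinit_pos
  have hq := hC.q1_one_le
  have hq3 := hC.q3_one_le
  have hl := hC.κl_pos
  have hm := hC.τmin_pos
  have hζ := hC.ζ_pos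
  obtain ⟨s, hs⟩ : ∃ s, s = √(C.κl * C.τmin) := ⟨_, rfl⟩
  have hs0 : 0 < s := by rw [hs]; positivity
  have hs2 : C.κl * C.τmin = s ^ 2 := by rw [hs, Real.sq_sqrt (by positivity)]
  have hs3 : C.τmin ^ 3 * C.κl = C.τmin ^ 2 * s ^ 2 := by rw [← hs2]; ring
  have h1 : 0 ≤ C.η3 := by rw [η3]; positivity
  have h2 : 0 ≤ C.η4 := Real.sqrt_nonneg _
  have h3 : C.η4 ^ 2 = C.η3 ^ 2 + 4 * (C.τinit / C.κl
      + (1 - C.θ) ^ 2 * (C.τinit ^ 2 * C.q1 / ((1 - C.σ) * C.τmin * C.ζ) + C.τinit / C.ζ)) := by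
    rw [η4, Real.sq_sqrt (by positivity), η3, ← hs, mul_assoc ((1 - C.σ) ^ 2), hs3]
    field_simp
    ring
  have h4 := quadratic_lt_of_lt_root hη h1 h2 h3
    (hlt.trans_le (mul_le_mul_of_nonneg_left (min_le_right _ _) (by linarith)))
  have h5 : (1 - C.θ) ^ 2 * (C.η * C.ω6) = (1 - C.θ) ^ 2 *
      (C.τinit ^ 2 * C.q1 / ((1 - C.σ) * C.τmin * C.ζ) + C.τinit / C.ζ) * C.η ^ 2
      + (1 - C.θ) * C.η3 * C.η := by
    rw [ω6, η3, ← hs]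
    field_simp
    ring
  have h6 : C.η ^ 2 * (C.τinit / C.κl) = C.τinit / C.κl * C.η ^ 2 := by ring
  rw [mul_sub, mul_one, h5, h6]
  linarith

lemma ηAdmissible.ω5_lt (hC : C.Valid) (h : C.ηAdmissible) : 0 < 1 - C.η * C.ω5 := by
  have h1 := h.first hC
  have hτ := hC.par.τinit_pos
  have hl := hC.κl_pos
  have hε := hC.par.ετ_mem.1
  have hω := hC.ω2_pos
  exact pos_of_mul_pos_right (lt_of_le_of_lt (by positivity) h1) (sq_nonneg _)

lemma ηAdmissible.ω6_lt (hC : C.Valid) (h : C.ηAdmissible) : 0 < 1 - C.η * C.ω6 := by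
  have h1 := h.second hC
  have hτ := hC.par.τinit_pos
  have hl := hC.κl_pos
  exact pos_of_mul_pos_right (lt_of_le_of_lt (by positivity) h1) (sq_nonneg _)

lemma ηAdmissible.margin_pos (hC : C.Valid) (h : C.ηAdmissible) : 0 < C.margin := by
  have h1 := h.first hC
  have h2 := h.second hC
  have h5 := h.ω5_lt hC
  have h6 := h.ω6_lt hC
  have hη := h.1
  have hA : 0 < 1 - C.θ := by linarith [hC.par.θ_mem.2]
  have hτ := hC.par.τinit_pos
  have hl := hC.κl_pos
  have hε := hC.par.ετ_mem.1
  have hω := hC.ω2_pos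
  have hk : (0 : ℝ) ≤ C.τinit / C.κl := by positivity
  rw [margin, sub_pos]
  rcases max_choice (√((1 + C.ετ * C.ω2) / (1 - C.η * C.ω5))) (1 / √(1 - C.η * C.ω6))
    with h' | h' <;> rw [h'] <;> refine lt_of_pow_lt_pow_left₀ 2 hA.le ?_
  · rw [mul_pow, mul_pow, Real.sq_sqrt hk, Real.sq_sqrt (by positivity), mul_div_assoc',
      div_lt_iff₀ h5, mul_assoc]
    exact h1
  · rw [mul_pow, mul_pow, Real.sq_sqrt hk, div_pow, Real.sq_sqrt h6.le, one_pow, mul_one_div,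
      div_lt_iff₀ h6]
    exact h2

lemma Valid.curv_pos (hC : C.Valid) : 0 < C.curv := by
  have := hC.L_pos; have := hC.Γ_nonneg; have := hC.κl_pos; have := hC.κFO_nonneg
  have := hC.τbmin_pos
  rw [curv]; positivity

lemma ηAdmissible.ωp_pos (hC : C.Valid) (h : C.ηAdmissible) : 0 < C.ωp := by
  have h5 := h.ω5_lt hC
  have h6 := h.ω6_lt hC
  have := hC.ω2_pos; have := hC.ω3_nonneg; have := hC.ω4_nonneg; have := hC.par.ετ_mem.1
  exact lt_min (lt_min (by positivity) h6) (by positivity)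

lemma ηAdmissible.αtilde_pos (hC : C.Valid) (h : C.ηAdmissible) : 0 < C.αtilde := by
  have h1 := h.margin_pos hC
  have := hC.curv_pos; have := hC.L_pos; have := hC.Γ_nonneg; have := hC.κl_pos
  have := hC.τbmin_pos
  have hA : 0 < 1 - C.θ := by linarith [hC.par.θ_mem.2]
  exact lt_min (by positivity) (by positivity)

lemma Valid.αtilde_le (hC : C.Valid) : C.αtilde ≤ 2 * C.κl / C.L := by
  have hL := hC.L_pos; have := hC.Γ_nonneg; have hl := hC.κl_pos; have := hC.κFO_nonneg
  have := hC.τbmin_pos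
  have hθ := hC.par.θ_mem.1
  have hA : 0 < 1 - C.θ := by linarith [hC.par.θ_mem.2]
  refine (min_le_left _ _).trans ?_
  have h1 : C.L / (2 * C.κl) ≤ C.curv := by
    rw [curv]
    have h2 : 0 ≤ √(C.τinit / C.κl) * C.κFO := by positivity
    have h3 : 0 ≤ C.Γ / (2 * C.τbmin * C.κl) := by positivity
    linarith
  calc (1 - C.θ) / C.curv ≤ 1 / (C.L / (2 * C.κl)) := by gcongr; linarith
    _ = _ := by rw [one_div_div]

lemma Valid.scale_pos (hC : C.Valid) : 0 < C.scale := by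
  have := hC.κl_pos; have := hC.τmin_pos
  have : 0 < max C.κH 1 := lt_max_of_lt_right one_pos
  rw [scale]; positivity

end Constants

/-! ### Comparison of the two model reductions -/

section Comparison

variable {n m : ℕ} {P : Problem n m} {x g g' : Vec n} {H : Vec n →L[ℝ] Vec n} {κJ τ' Δ Δ' : ℝ}
  {C : Constants}

lemma Constants.η_mul_ω5 (C : Constants) : C.η * C.ω5 =
    (1 + C.ετ) * (C.τinit * (C.q1 * C.η / √(C.κl * C.τmin) + C.η ^ 2 / C.ζ))
      + C.ετ * (C.τinit * (C.q1 ^ 2 * C.η ^ 2 / 4)) := by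
  rw [Constants.ω5]; ring

lemma Constants.ηAdmissible.ω6_ge (hC : C.Valid) (h : C.ηAdmissible) (hτ : C.τmin ≤ C.τinit) :
    2 * (C.τinit * (C.q1 * C.η / √(C.κl * C.τmin) + C.η ^ 2 / C.ζ)) ≤ C.η * C.ω6 := by
  have hη := h.1
  have hτi := hC.par.τinit_pos
  have hm := hC.τmin_pos
  have hσ0 := hC.par.σ_mem.1
  have hσ : 0 < 1 - C.σ := by linarith [hC.par.σ_mem.2]
  have hζ := hC.ζ_pos
  have hq := hC.q1_one_le
  have hq3 := hC.q1_le_q3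
  have hl := hC.κl_pos
  have h1 : C.τinit ≤ C.τinit ^ 2 / ((1 - C.σ) * C.τmin) := by
    rw [le_div_iff₀ (by positivity), pow_two]
    have : (1 - C.σ) * C.τmin ≤ 1 * C.τinit := by gcongr; linarith
    rw [one_mul] at this
    gcongr
  have h2 : C.η / C.ζ + C.q1 / √(C.κl * C.τmin)
      ≤ C.q1 * (C.η / C.ζ) + C.q3 / √(C.κl * C.τmin) := by
    gcongr
    exact le_mul_of_one_le_left (by positivity) hq
  have h3 : C.τinit * (C.η / C.ζ + C.q1 / √(C.κl * C.τmin)) ≤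
      C.τinit ^ 2 / ((1 - C.σ) * C.τmin) *
        (C.q1 * (C.η / C.ζ) + C.q3 / √(C.κl * C.τmin)) := by gcongr
  have h4 : C.η * C.ω6 = C.η * (C.τinit ^ 2 / ((1 - C.σ) * C.τmin) *
        (C.q1 * (C.η / C.ζ) + C.q3 / √(C.κl * C.τmin)))
        + C.η * (C.τinit * (C.η / C.ζ + C.q1 / √(C.κl * C.τmin))) := by
    rw [Constants.ω6]; ring
  have h5 : C.τinit * (C.q1 * C.η / √(C.κl * C.τmin) + C.η ^ 2 / C.ζ)
      = C.η * (C.τinit * (C.η / C.ζ + C.q1 / √(C.κl * C.τmin))) := by ring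
  rw [h4, h5]
  nlinarith

/-- The comparison when the gradient error is at most `η √Δl` for the true model reduction. -/
lemma modelRed_compare_of_err_le_sqrt (hC : C.Valid) (hη : C.ηAdmissible) (hκJ : 0 < κJ)
    (hJ : ∀ y, κJ * ‖y‖ ≤ ‖P.jacT x y‖) (hH : P.HAdmissible C.κH C.ζ x H)
    (hτ' : 0 < τ') (hτ'le : τ' ≤ C.τinit)
    (htrial : τ' * P.tauDenom x H g' ≤ (1 - C.σ) * l1 (P.c x))
    (hy : ‖P.mult x H g‖ ≤ C.κy)
    (hτmin : C.τmin ≤ P.tauUpdate C.toParams x H g τ')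
    (hΔ : Δ = P.modelRed x (P.tauUpdate C.toParams x H g τ') g (P.dir x H g))
    (hΔ' : Δ' = P.modelRed x τ' g' (P.dir x H g'))
    (hd : C.κl * P.tauUpdate C.toParams x H g τ' * (‖P.dir x H g‖ ^ 2 + ‖P.c x‖) ≤ Δ)
    (hd' : C.κl * τ' * (‖P.dir x H g'‖ ^ 2 + ‖P.c x‖) ≤ Δ')
    (he : ‖g' - g‖ ≤ C.η * √Δ) :
    (1 - C.η * C.ω6) * Δ ≤ Δ' ∨ (1 - C.η * C.ω5) * Δ ≤ (1 + C.ετ * C.ω2) * Δ' := by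
  have hζ := hC.ζ_pos
  have hl := hC.κl_pos
  have hm := hC.τmin_pos
  have hη0 := hη.1
  have hq := hC.q1_one_le
  have hε := hC.par.ετ_mem.1
  have hτi := hC.par.τinit_pos
  have hτt : 0 < P.tauUpdate C.toParams x H g τ' := hm.trans_le hτmin
  have hΔ0 : 0 ≤ Δ := le_trans (by positivity) hd
  have hs2 := Real.sq_sqrt hΔ0
  have hτminle : C.τmin ≤ C.τinit := hτmin.trans ((tauUpdate_le hC.par hτ'.le).trans hτ'le)
  have hk : 0 < √(C.κl * C.τmin) := by positivity
  -- the direction is small relative to the model reduction, so `R` is a multiple of it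
  have hdn : ‖P.dir x H g‖ ≤ √Δ / √(C.κl * C.τmin) := by
    rw [le_div_iff₀ hk]
    refine Real.le_sqrt_of_sq_le ?_
    rw [mul_pow, Real.sq_sqrt (by positivity)]
    calc ‖P.dir x H g‖ ^ 2 * (C.κl * C.τmin)
        ≤ C.κl * P.tauUpdate C.toParams x H g τ' * (‖P.dir x H g‖ ^ 2 + 0) := by
          rw [add_zero, mul_comm]; gcongr
      _ ≤ C.κl * P.tauUpdate C.toParams x H g τ' * (‖P.dir x H g‖ ^ 2 + ‖P.c x‖) := by
          gcongr; exact norm_nonneg _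
      _ ≤ Δ := hd
  obtain ⟨b1, b2⟩ := inner_dir_sub_le hκJ hJ hζ hH g g' (Or.inl rfl)
  have hR : (1 + C.κH / C.ζ) * ‖g' - g‖ * ‖P.dir x H g‖ + ‖g' - g‖ ^ 2 / C.ζ
      ≤ (C.q1 * C.η / √(C.κl * C.τmin) + C.η ^ 2 / C.ζ) * Δ := by
    calc (1 + C.κH / C.ζ) * ‖g' - g‖ * ‖P.dir x H g‖ + ‖g' - g‖ ^ 2 / C.ζ
        ≤ C.q1 * (C.η * √Δ) * (√Δ / √(C.κl * C.τmin)) + (C.η * √Δ) ^ 2 / C.ζ := by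
          rw [← Constants.q1]; gcongr
      _ = (C.q1 * C.η / √(C.κl * C.τmin) + C.η ^ 2 / C.ζ) * √Δ ^ 2 := by ring
      _ = _ := by rw [hs2]
  have hcoef : 0 ≤ C.q1 * C.η / √(C.κl * C.τmin) + C.η ^ 2 / C.ζ := by positivity
  have hτR : τ' * ((C.q1 * C.η / √(C.κl * C.τmin) + C.η ^ 2 / C.ζ) * Δ)
      ≤ C.τinit * (C.q1 * C.η / √(C.κl * C.τmin) + C.η ^ 2 / C.ζ) * Δ := by
    rw [← mul_assoc]; gcongr
  rcases modelRed_sub_le hC.par hκJ hJ hζ hH g g' hτ' htrial (b1.trans hR) (b2.trans hR)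
    with h | h <;> rw [← hΔ, ← hΔ'] at h
  · left
    have := mul_le_mul_of_nonneg_right (hη.ω6_ge hC hτminle) hΔ0
    linarith
  · right
    have h1 := inner_dir_le hκJ hJ hζ hH g g' hy
    have h2 : (1 + C.κH / C.ζ) * ‖g' - g‖ * ‖P.dir x H g'‖
        ≤ ‖P.dir x H g'‖ ^ 2 + C.q1 ^ 2 * C.η ^ 2 / 4 * Δ := by
      calc (1 + C.κH / C.ζ) * ‖g' - g‖ * ‖P.dir x H g'‖
          ≤ C.q1 * (C.η * √Δ) * ‖P.dir x H g'‖ := by rw [← Constants.q1]; gcongr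
        -- Young's inequality, the source of the `1` in `ω₂` and of the last term of `ω₅`
        _ ≤ ‖P.dir x H g'‖ ^ 2 + C.q1 ^ 2 * C.η ^ 2 / 4 * √Δ ^ 2 := by
          linarith [sq_nonneg (‖P.dir x H g'‖ - C.q1 * C.η * √Δ / 2)]
        _ = _ := by rw [hs2]
    have hM : 0 ≤ max C.κH C.κy := hC.κH_pos.le.trans (le_max_left _ _)
    have h3 : inner ℝ g' (P.dir x H g') ≤ (max C.κH C.κy + 1) *
        (‖P.dir x H g'‖ ^ 2 + ‖P.c x‖) + C.q1 ^ 2 * C.η ^ 2 / 4 * Δ := by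
      linarith [norm_nonneg (P.c x)]
    have h4 : τ' * inner ℝ g' (P.dir x H g') ≤ C.ω2 * Δ'
        + C.τinit * (C.q1 ^ 2 * C.η ^ 2 / 4 * Δ) := by
      calc τ' * inner ℝ g' (P.dir x H g') ≤ τ' * ((max C.κH C.κy + 1) *
            (‖P.dir x H g'‖ ^ 2 + ‖P.c x‖) + C.q1 ^ 2 * C.η ^ 2 / 4 * Δ) := by gcongr
        _ = C.ω2 * (C.κl * τ' * (‖P.dir x H g'‖ ^ 2 + ‖P.c x‖))
            + τ' * (C.q1 ^ 2 * C.η ^ 2 / 4 * Δ) := by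
            rw [Constants.ω2]; field_simp
        _ ≤ _ := by
            have := hC.ω2_pos
            gcongr
    have h5 : C.ετ * (τ' * inner ℝ g' (P.dir x H g')) ≤ C.ετ * (C.ω2 * Δ'
        + C.τinit * (C.q1 ^ 2 * C.η ^ 2 / 4 * Δ)) := by gcongr
    have h6 := mul_le_mul_of_nonneg_left hτR (show 0 ≤ 1 + C.ετ by linarith)
    rw [C.η_mul_ω5]
    linarith

/-- The comparison when the gradient error is at most a multiple of `√Δl` for the estimated model
reduction. -/
lemma modelRed_compare_of_err_le_sqrt' (hC : C.Valid) (hκJ : 0 < κJ)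
    (hJ : ∀ y, κJ * ‖y‖ ≤ ‖P.jacT x y‖) (hH : P.HAdmissible C.κH C.ζ x H)
    (hτ' : 0 < τ') (hτ'le : τ' ≤ C.τinit)
    (htrial : τ' * P.tauDenom x H g' ≤ (1 - C.σ) * l1 (P.c x))
    (hy : ‖P.mult x H g‖ ≤ C.κy) (hτmin : C.τmin ≤ P.tauUpdate C.toParams x H g τ')
    (hΔ : Δ = P.modelRed x (P.tauUpdate C.toParams x H g τ') g (P.dir x H g))
    (hΔ' : Δ' = P.modelRed x τ' g' (P.dir x H g'))
    (hd' : C.κl * τ' * (‖P.dir x H g'‖ ^ 2 + ‖P.c x‖) ≤ Δ')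
    (he : ‖g' - g‖ ≤ C.κFO * C.αmax * √Δ') :
    Δ ≤ (1 + C.ω3 + C.ω4) * Δ' := by
  have hζ := hC.ζ_pos
  have hl := hC.κl_pos
  have hm := hC.τmin_pos
  have hq := hC.q1_one_le
  have hq3 := hC.q1_le_q3
  have hq31 := hC.q3_one_le
  have hε := hC.par.ετ_mem.1
  have hτi := hC.par.τinit_pos
  have hFO := hC.κFO_nonneg
  have hα := hC.par.αmax_mem.1
  have hσ0 := hC.par.σ_mem.1
  have hσ : 0 < 1 - C.σ := by linarith [hC.par.σ_mem.2]
  have hΔ0 : 0 ≤ Δ' := le_trans (by positivity) hd'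
  have hs2 := Real.sq_sqrt hΔ0
  have hτminle : C.τmin ≤ C.τinit := hτmin.trans ((tauUpdate_le hC.par hτ'.le).trans hτ'le)
  have hsl : 0 < √C.κl := by positivity
  have hdn : τ' * ‖P.dir x H g'‖ ≤ √C.τinit / √C.κl * √Δ' := by
    have h1 : √C.κl * (√τ' * ‖P.dir x H g'‖) ≤ √Δ' := by
      refine Real.le_sqrt_of_sq_le ?_
      rw [mul_pow, mul_pow, Real.sq_sqrt hl.le, Real.sq_sqrt hτ'.le]
      refine le_trans ?_ hd'
      rw [mul_assoc]
      gcongr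
      linarith [norm_nonneg (P.c x)]
    calc τ' * ‖P.dir x H g'‖ = √τ' * (√C.κl * (√τ' * ‖P.dir x H g'‖)) / √C.κl := by
          field_simp
          rw [Real.sq_sqrt hτ'.le, mul_comm]
      _ ≤ √C.τinit * √Δ' / √C.κl := by gcongr
      _ = _ := by ring
  have hed : τ' * (C.q1 * ‖g' - g‖ * ‖P.dir x H g'‖)
      ≤ C.q1 * C.κFO * √C.τinit * C.αmax / √C.κl * Δ' := by
    calc τ' * (C.q1 * ‖g' - g‖ * ‖P.dir x H g'‖)
        = C.q1 * ‖g' - g‖ * (τ' * ‖P.dir x H g'‖) := by ring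
      _ ≤ C.q1 * (C.κFO * C.αmax * √Δ') * (√C.τinit / √C.κl * √Δ') := by gcongr
      _ = C.q1 * C.κFO * √C.τinit * C.αmax / √C.κl * √Δ' ^ 2 := by ring
      _ = _ := by rw [hs2]
  obtain ⟨R, hRdef⟩ : ∃ R, R = (1 + C.κH / C.ζ) * ‖g' - g‖ * ‖P.dir x H g'‖
      + ‖g' - g‖ ^ 2 / C.ζ := ⟨_, rfl⟩
  have hR : τ' * R ≤ C.ω3 * Δ' := by
    rw [hRdef, mul_add, ← Constants.q1, Constants.ω3, add_mul]
    refine add_le_add hed ?_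
    calc τ' * (‖g' - g‖ ^ 2 / C.ζ) ≤ C.τinit * ((C.κFO * C.αmax * √Δ') ^ 2 / C.ζ) := by gcongr
      _ = C.τinit * C.κFO ^ 2 * C.αmax ^ 2 / C.ζ * √Δ' ^ 2 := by ring
      _ = _ := by rw [hs2]
  obtain ⟨b1, b2⟩ := inner_dir_sub_le hκJ hJ hζ hH g g' (Or.inr rfl)
  rw [← hRdef] at b1 b2
  rcases modelRed_sub_le hC.par hκJ hJ hζ hH g g' hτ' htrial b1 b2
    with h | h <;> rw [← hΔ, ← hΔ'] at h
  · have h1 : C.ω3 ≤ C.ω4 := by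
      rw [Constants.ω4, Constants.ω3]
      refine le_max_of_le_right ?_
      have h2 : 1 ≤ C.τinit / ((1 - C.σ) * C.τmin) := by
        rw [le_div_iff₀ (by positivity), one_mul]
        calc (1 - C.σ) * C.τmin ≤ 1 * C.τinit := by gcongr; linarith
          _ = _ := one_mul _
      refine le_trans ?_ (le_mul_of_one_le_left (by positivity) h2)
      refine add_le_add (by gcongr) (le_mul_of_one_le_left (by positivity) hq)
    have h2 := mul_le_mul_of_nonneg_right h1 hΔ0
    linarith
  · have h1 := inner_dir_le hκJ hJ hζ hH g g' hy
    rw [← Constants.q1] at h1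
    have hM : 0 ≤ max C.κH C.κy := hC.κH_pos.le.trans (le_max_left _ _)
    have h4 : τ' * inner ℝ g' (P.dir x H g') ≤ max C.κH C.κy / C.κl * Δ'
        + C.q1 * C.κFO * √C.τinit * C.αmax / √C.κl * Δ' := by
      calc τ' * inner ℝ g' (P.dir x H g') ≤ τ' * (max C.κH C.κy *
            (‖P.dir x H g'‖ ^ 2 + ‖P.c x‖) + C.q1 * ‖g' - g‖ * ‖P.dir x H g'‖) := by gcongr
        _ = max C.κH C.κy / C.κl * (C.κl * τ' * (‖P.dir x H g'‖ ^ 2 + ‖P.c x‖))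
            + τ' * (C.q1 * ‖g' - g‖ * ‖P.dir x H g'‖) := by field_simp
        _ ≤ _ := by gcongr
    have h5 : C.ετ * (τ' * inner ℝ g' (P.dir x H g')) ≤ C.ετ * (max C.κH C.κy / C.κl * Δ'
        + C.q1 * C.κFO * √C.τinit * C.αmax / √C.κl * Δ') := by gcongr
    have h6 : C.ετ * (max C.κH C.κy / C.κl + √C.τinit * C.q1 * C.κFO * C.αmax / √C.κl + C.ω3)
        ≤ C.ω4 := le_max_left _ _
    have h7 := mul_le_mul_of_nonneg_right h6 hΔ0
    have h8 : C.ετ * (τ' * R) ≤ C.ετ * (C.ω3 * Δ') := by gcongr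
    have h9 : √C.τinit * C.q1 * C.κFO * C.αmax / √C.κl
      = C.q1 * C.κFO * √C.τinit * C.αmax / √C.κl := by ring
    rw [h9] at h7
    linarith

end Comparison

/-! ### Sufficient decrease of the merit function -/

/-- Second-order Taylor estimate on the unit interval. -/
lemma abs_taylor_le_of_lipschitz_deriv {φ φ' : ℝ → ℝ} {K : ℝ}
    (hφ : ∀ t ∈ Set.Icc (0 : ℝ) 1, HasDerivAt φ (φ' t) t)
    (hK : ∀ t ∈ Set.Icc (0 : ℝ) 1, |φ' t - φ' 0| ≤ K * t) :
    |φ 1 - φ 0 - φ' 0| ≤ K / 2 := by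
  have h := image_norm_le_of_norm_deriv_right_le_deriv_boundary (a := (0 : ℝ)) (b := 1)
    (f := fun t => φ t - φ 0 - t * φ' 0) (f' := fun t => φ' t - φ' 0)
    (B := fun t => K / 2 * t ^ 2) (B' := fun t => K * t) ?_ ?_ (by simp) ?_ ?_
    (x := 1) (Set.right_mem_Icc.2 zero_le_one)
  · simpa using h
  · intro t ht
    have h1 := (((hφ t ht).sub_const (φ 0)).sub ((hasDerivAt_id t).mul_const (φ' 0)))
    exact h1.continuousAt.continuousWithinAt
  · intro t ht
    have h1 := (((hφ t ⟨ht.1, ht.2.le⟩).sub_const (φ 0)).sub ((hasDerivAt_id t).mul_const (φ' 0)))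
    rw [one_mul] at h1
    exact h1.hasDerivWithinAt
  · intro t
    have h1 : HasDerivAt (fun t => K / 2 * t ^ 2) (K / 2 * (2 * t)) t := by
      simpa using (hasDerivAt_pow 2 t).const_mul (K / 2)
    rwa [show K / 2 * (2 * t) = K * t by ring] at h1
  · intro t ht
    exact hK t ⟨ht.1, ht.2.le⟩

lemma abs_sub_sub_inner_le {n : ℕ} {s : Set (Vec n)} (hs : Convex ℝ s) {f : Vec n → ℝ} {K : ℝ}
    (hf : ∀ x ∈ s, DifferentiableAt ℝ f x)
    (hK : ∀ x ∈ s, ∀ y ∈ s, ‖gradient f x - gradient f y‖ ≤ K * ‖x - y‖) {x w : Vec n}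
    (hx : x ∈ s) (hxw : x + w ∈ s) :
    |f (x + w) - f x - inner ℝ (gradient f x) w| ≤ K / 2 * ‖w‖ ^ 2 := by
  have hmem : ∀ t ∈ Set.Icc (0 : ℝ) 1, x + t • w ∈ s := by
    intro t ht
    have := hs.add_smul_sub_mem hx hxw ht
    simpa using this
  have h := abs_taylor_le_of_lipschitz_deriv (φ := fun t => f (x + t • w))
    (φ' := fun t => inner ℝ (gradient f (x + t • w)) w) (K := K * ‖w‖ ^ 2) ?_ ?_
  · simp only [one_smul, zero_smul, add_zero] at h
    linarith
  · intro t ht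
    have h1 := (hf _ (hmem t ht)).hasGradientAt.hasFDerivAt
    have h2 : HasDerivAt (fun t : ℝ => x + t • w) w t := by
      simpa using ((hasDerivAt_id t).smul_const w).const_add x
    exact h1.comp_hasDerivAt t h2
  · intro t ht
    simp only [zero_smul, add_zero]
    rw [← inner_sub_left]
    refine (abs_real_inner_le_norm _ _).trans ?_
    have h1 := hK _ (hmem t ht) x hx
    rw [add_sub_cancel_left, norm_smul, Real.norm_eq_abs, abs_of_nonneg ht.1] at h1
    calc _ ≤ K * (t * ‖w‖) * ‖w‖ := by gcongr
      _ = _ := by ring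

section Merit

variable {n m : ℕ} {P : Problem n m} {L : ℝ} {lip : Fin m → ℝ}

lemma Problem.Regular.differentiableAt_f (hP : P.Regular L lip) {x : Vec n} (hx : x ∈ P.dom) :
    DifferentiableAt ℝ P.f x :=
  (hP.contDiff_f.contDiffAt (hP.isOpen_dom.mem_nhds hx)).differentiableAt one_ne_zero

lemma Problem.Regular.differentiableAt_c (hP : P.Regular L lip) {x : Vec n} (hx : x ∈ P.dom) :
    DifferentiableAt ℝ P.c x :=
  (hP.contDiff_c.contDiffAt (hP.isOpen_dom.mem_nhds hx)).differentiableAt one_ne_zero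

lemma Problem.Regular.hasFDerivAt_c (hP : P.Regular L lip) {x : Vec n} (hx : x ∈ P.dom)
    (i : Fin m) : HasFDerivAt (fun z => P.c z i)
      ((EuclideanSpace.proj i : Vec m →L[ℝ] ℝ).comp (P.jac x)) x :=
  (EuclideanSpace.proj i : Vec m →L[ℝ] ℝ).hasFDerivAt.comp x
    (hP.differentiableAt_c hx).hasFDerivAt

lemma Problem.Regular.inner_gradient_c (hP : P.Regular L lip) {x : Vec n} (hx : x ∈ P.dom)
    (i : Fin m) (w : Vec n) : inner ℝ (gradient (fun z => P.c z i) x) w = P.jac x w i := by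
  have h := (hP.hasFDerivAt_c hx i)
  have h2 := h.differentiableAt.hasGradientAt.hasFDerivAt.unique h
  have h3 := congrArg (fun T : Vec n →L[ℝ] ℝ => T w) h2
  simpa using h3

lemma Problem.Regular.l1_c_le (hP : P.Regular L lip) {x w : Vec n} (hx : x ∈ P.dom)
    (hxw : x + w ∈ P.dom) :
    l1 (P.c (x + w)) ≤ l1 (P.c x + P.jac x w) + (∑ i, lip i) / 2 * ‖w‖ ^ 2 := by
  rw [l1, l1, Finset.sum_div, Finset.sum_mul, ← Finset.sum_add_distrib]
  refine Finset.sum_le_sum fun i _ => ?_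
  have h := abs_sub_sub_inner_le hP.convex_dom (f := fun z => P.c z i)
    (fun z hz => (hP.hasFDerivAt_c hz i).differentiableAt) (hP.grad_c_lipschitz i) hx hxw
  rw [hP.inner_gradient_c hx] at h
  have h2 := abs_add_le (P.c (x + w) i - P.c x i - P.jac x w i) (P.c x i + P.jac x w i)
  have h3 : P.c (x + w) i - P.c x i - P.jac x w i + (P.c x i + P.jac x w i) = P.c (x + w) i := by
    ring
  rw [h3] at h2
  have h4 : (P.c x + P.jac x w) i = P.c x i + P.jac x w i := rfl
  rw [h4]
  linarith

/-- The change of the merit function along a step with linearized feasibility. -/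
lemma Problem.Regular.merit_trial_le (hP : P.Regular L lip) {x d g : Vec n} {α τ : ℝ}
    (hα : 0 ≤ α) (hα1 : α ≤ 1) (hτ : 0 ≤ τ) (hx : x ∈ P.dom) (hx' : x + α • d ∈ P.dom)
    (hd : P.jac x d = -P.c x) :
    P.merit (x + α • d) τ ≤ P.merit x τ - α * P.modelRed x τ g d
      + α * (τ * (‖g - gradient P.f x‖ * ‖d‖)
        + (τ * L + ∑ i, lip i) / 2 * α * ‖d‖ ^ 2) := by
  have h1 := (abs_le.1 (abs_sub_sub_inner_le hP.convex_dom
    (fun z hz => hP.differentiableAt_f hz) hP.grad_f_lipschitz hx hx')).2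
  have h2 := hP.l1_c_le hx hx'
  have h3 : l1 (P.c x + P.jac x (α • d)) = (1 - α) * l1 (P.c x) := by
    have : P.c x + P.jac x (α • d) = (1 - α) • P.c x := by
      rw [map_smul, hd, smul_neg, sub_smul, one_smul, sub_eq_add_neg]
    rw [this, l1, l1, Finset.mul_sum]
    refine Finset.sum_congr rfl fun i _ => ?_
    rw [PiLp.smul_apply, smul_eq_mul, abs_mul, abs_of_nonneg (by linarith)]
  have h4 : ‖α • d‖ ^ 2 = α ^ 2 * ‖d‖ ^ 2 := by
    rw [norm_smul, mul_pow, Real.norm_eq_abs, sq_abs]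
  rw [h3] at h2
  rw [h4] at h1 h2
  rw [real_inner_smul_right] at h1
  rw [modelRed_eq hd, Problem.merit, Problem.merit]
  have h5 := (abs_le.1 (abs_real_inner_le_norm (g - gradient P.f x) d)).1
  rw [inner_sub_left] at h5
  have h6 := mul_le_mul_of_nonneg_left h1 hτ
  have h7 : α * τ * (inner ℝ (gradient P.f x) d)
      ≤ α * τ * (inner ℝ g d + ‖g - gradient P.f x‖ * ‖d‖) :=
    mul_le_mul_of_nonneg_left (by linarith) (by positivity)
  linarith

end Merit

/-- The error terms of `merit_trial_le` are absorbed by `(1 - θ) Δl`, for step sizes up to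
`α̃ / γ` rather than `α̃`. The factor `γ` comes from a lower bound of the model reduction with a
constant `κ` that is larger than `κ_l` by the factor `γ⁻²`. -/
lemma step_error_le {C : Constants} (hC : C.Valid) (hη : C.ηAdmissible)
    {κ τ' α E ρ Δ Δ' : ℝ} (hκ : C.κl ≤ C.γ ^ 2 * κ) (hτ' : C.τbmin ≤ τ') (hτ'le : τ' ≤ C.τinit)
    (hα : 0 ≤ α) (hαle : C.γ * α ≤ C.αtilde) (hρ : 0 ≤ ρ) (hΔ0 : 0 ≤ Δ)
    (hlow : κ * τ' * ρ ^ 2 ≤ Δ')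
    (herr : E ≤ C.κFO * α * √Δ' ∨ E ≤ C.η * √Δ ∧
      ((1 - C.η * C.ω6) * Δ ≤ Δ' ∨ (1 - C.η * C.ω5) * Δ ≤ (1 + C.ετ * C.ω2) * Δ')) :
    τ' * (E * ρ) + (τ' * C.L + C.Γ) / 2 * α * ρ ^ 2 ≤ (1 - C.θ) * Δ' := by
  have hl := hC.κl_pos
  have hL := hC.L_pos
  have hΓ := hC.Γ_nonneg
  have hb := hC.τbmin_pos
  obtain ⟨hγ0, hγ1⟩ := hC.par.γ_mem
  have hτi := hC.par.τinit_pos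
  have hτ0 : 0 < τ' := hb.trans_le hτ'
  have hFO := hC.κFO_nonneg
  have hη0 := hη.1
  have hκ0 : 0 < κ := by
    by_contra! hc
    nlinarith [mul_nonneg (sq_nonneg C.γ) (neg_nonneg.2 hc)]
  have hΔ'0 : 0 ≤ Δ' := le_trans (by positivity) hlow
  have hs2 := Real.sq_sqrt hΔ'0
  have hlow' : C.κl * (τ' * ρ ^ 2) ≤ C.γ ^ 2 * Δ' := by
    calc C.κl * (τ' * ρ ^ 2) ≤ C.γ ^ 2 * κ * (τ' * ρ ^ 2) := by gcongr
      _ = C.γ ^ 2 * (κ * τ' * ρ ^ 2) := by ring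
      _ ≤ _ := by gcongr
  have h1 : τ' * ρ ^ 2 ≤ C.γ ^ 2 * Δ' / C.κl := by rw [le_div_iff₀ hl]; linarith
  have h2 : τ' * ρ ≤ C.γ * √(C.τinit / C.κl) * √Δ' := by
    have h3 : √τ' * ρ ≤ C.γ * √Δ' / √C.κl := by
      refine le_of_sq_le_sq ?_ (by positivity)
      rw [mul_pow, div_pow, mul_pow, Real.sq_sqrt hτ0.le, Real.sq_sqrt hl.le, hs2]
      exact h1
    calc τ' * ρ = √τ' * (√τ' * ρ) := by rw [← mul_assoc, Real.mul_self_sqrt hτ0.le]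
      _ ≤ √C.τinit * (C.γ * √Δ' / √C.κl) := by gcongr
      _ = _ := by rw [Real.sqrt_div hτi.le]; ring
  have h4 : (τ' * C.L + C.Γ) / 2 * α * ρ ^ 2
      ≤ C.γ * α * (C.L / (2 * C.κl) + C.Γ / (2 * C.τbmin * C.κl)) * Δ' := by
    have h5 : C.Γ * ρ ^ 2 ≤ C.Γ / C.τbmin * (τ' * ρ ^ 2) := by
      rw [div_mul_eq_mul_div, le_div_iff₀ hb]
      calc C.Γ * ρ ^ 2 * C.τbmin ≤ C.Γ * ρ ^ 2 * τ' := by gcongr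
        _ = _ := by ring
    calc (τ' * C.L + C.Γ) / 2 * α * ρ ^ 2
        = (C.L * (τ' * ρ ^ 2) + C.Γ * ρ ^ 2) / 2 * α := by ring
      _ ≤ (C.L * (τ' * ρ ^ 2) + C.Γ / C.τbmin * (τ' * ρ ^ 2)) / 2 * α := by gcongr
      _ = (C.L + C.Γ / C.τbmin) / 2 * α * (τ' * ρ ^ 2) := by ring
      _ ≤ (C.L + C.Γ / C.τbmin) / 2 * α * (C.γ ^ 2 * Δ' / C.κl) := by gcongr
      _ ≤ (C.L + C.Γ / C.τbmin) / 2 * α * (C.γ * Δ' / C.κl) := by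
          gcongr
          nlinarith
      _ = _ := by field_simp
  rcases herr with he | ⟨he, hcmp⟩
  · have h5 : τ' * (E * ρ) ≤ C.γ * α * (√(C.τinit / C.κl) * C.κFO) * Δ' := by
      calc τ' * (E * ρ) = E * (τ' * ρ) := by ring
        _ ≤ C.κFO * α * √Δ' * (C.γ * √(C.τinit / C.κl) * √Δ') := by gcongr
        _ = C.γ * α * (√(C.τinit / C.κl) * C.κFO) * √Δ' ^ 2 := by ring
        _ = _ := by rw [hs2]
    have h6 : C.γ * α * C.curv ≤ 1 - C.θ := by
      rw [← le_div_iff₀ hC.curv_pos]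
      exact hαle.trans (min_le_left _ _)
    have h7 := mul_le_mul_of_nonneg_right h6 hΔ'0
    rw [Constants.curv] at h7
    linarith
  · have h5 := hη.ω5_lt hC
    have h6 := hη.ω6_lt hC
    obtain ⟨X, hX⟩ : ∃ X, X = max (√((1 + C.ετ * C.ω2) / (1 - C.η * C.ω5)))
      (1 / √(1 - C.η * C.ω6)) := ⟨_, rfl⟩
    have h7 : √Δ ≤ X * √Δ' := by
      have hsq : (0 : ℝ) < √(1 - C.η * C.ω6) := Real.sqrt_pos.2 h6
      rcases hcmp with h | h
      · have h8 : √Δ ≤ 1 / √(1 - C.η * C.ω6) * √Δ' := by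
          rw [one_div_mul_eq_div, le_div_iff₀ hsq, ← Real.sqrt_mul hΔ0, mul_comm]
          exact Real.sqrt_le_sqrt h
        refine h8.trans ?_
        gcongr
        rw [hX]; exact le_max_right _ _
      · have h8 : √Δ ≤ √((1 + C.ετ * C.ω2) / (1 - C.η * C.ω5)) * √Δ' := by
          have := hC.ω2_pos
          have := hC.par.ετ_mem.1
          rw [← Real.sqrt_mul (by positivity)]
          refine Real.sqrt_le_sqrt ?_
          rw [div_mul_eq_mul_div, le_div_iff₀ h5]
          linarith
        refine h8.trans ?_
        gcongr
        rw [hX]; exact le_max_left _ _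
    have hX0 : 0 ≤ X := by rw [hX]; exact le_max_of_le_left (Real.sqrt_nonneg _)
    have h8 : τ' * (E * ρ) ≤ C.η * √(C.τinit / C.κl) * X * Δ' := by
      calc τ' * (E * ρ) = E * (τ' * ρ) := by ring
        _ ≤ C.η * (X * √Δ') * (C.γ * √(C.τinit / C.κl) * √Δ') := by
            gcongr
            exact he.trans (by gcongr)
        _ ≤ C.η * (X * √Δ') * (1 * √(C.τinit / C.κl) * √Δ') := by gcongr
        _ = C.η * √(C.τinit / C.κl) * X * √Δ' ^ 2 := by ring
        _ = _ := by rw [hs2]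
    have h9 : C.γ * α * (C.L / (2 * C.κl) + C.Γ / (2 * C.τbmin * C.κl)) ≤ C.margin := by
      have h10 : C.L / (2 * C.κl) + C.Γ / (2 * C.τbmin * C.κl)
          = (C.τbmin * C.L + C.Γ) / (2 * C.τbmin * C.κl) := by field_simp
      have h11 := hαle.trans (min_le_right _ _)
      rw [le_div_iff₀ (by positivity)] at h11
      rw [h10, mul_div_assoc', div_le_iff₀ (by positivity)]
      linarith
    have h10 := mul_le_mul_of_nonneg_right h9 hΔ'0
    have h11 : C.margin = 1 - C.θ - C.η * √(C.τinit / C.κl) * X := by rw [Constants.margin, hX]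
    rw [h11] at h10
    linarith

/-! ### Counting iterations -/

section Counting

open Classical in
/-- The number of indices `k < t` with the property `S`. -/
noncomputable def count (S : ℕ → Prop) (t : ℕ) : ℕ := ((Finset.range t).filter S).card

open Classical in
lemma count_succ (S : ℕ → Prop) (t : ℕ) : count S (t + 1) = count S t + if S t then 1 else 0 := by
  unfold count
  rw [Finset.range_add_one, Finset.filter_insert]
  split_ifs with h
  · rw [Finset.card_insert_of_notMem (by simp)]
  · simp

lemma count_zero (S : ℕ → Prop) : count S 0 = 0 := by simp [count]

/-- The level of the step size `α`: the number of factors `γ⁻¹` that separate it from `a`,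
rounded down. -/
noncomputable def level (γ a α : ℝ) : ℤ := ⌊Real.log (α / a) / Real.log γ⁻¹⌋

variable {γ a α β : ℝ}

lemma level_gamma_mul (hγ : γ ∈ Set.Ioo (0 : ℝ) 1) (ha : 0 < a) (hα : 0 < α) :
    level γ a (γ * α) = level γ a α - 1 := by
  have h1 : 0 < Real.log γ⁻¹ := Real.log_pos ((one_lt_inv₀ hγ.1).2 hγ.2)
  have h2 : Real.log (γ * α / a) / Real.log γ⁻¹ = Real.log (α / a) / Real.log γ⁻¹ - 1 := by
    rw [mul_div_assoc, Real.log_mul hγ.1.ne' (by positivity), add_div, Real.log_inv]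
    rw [Real.log_inv] at h1
    have : Real.log γ ≠ 0 := by linarith
    field_simp
    ring
  rw [level, h2, Int.floor_sub_one, level]

lemma level_inv_mul (hγ : γ ∈ Set.Ioo (0 : ℝ) 1) (ha : 0 < a) (hα : 0 < α) :
    level γ a (γ⁻¹ * α) = level γ a α + 1 := by
  have h := level_gamma_mul hγ ha (mul_pos (inv_pos.2 hγ.1) hα)
  rw [← mul_assoc, mul_inv_cancel₀ hγ.1.ne', one_mul] at h
  linarith

lemma level_mono (hγ : γ ∈ Set.Ioo (0 : ℝ) 1) (ha : 0 < a) (hα : 0 < α) (h : α ≤ β) :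
    level γ a α ≤ level γ a β := by
  have h1 : 0 < Real.log γ⁻¹ := Real.log_pos ((one_lt_inv₀ hγ.1).2 hγ.2)
  unfold level
  gcongr

lemma level_nonneg_iff (hγ : γ ∈ Set.Ioo (0 : ℝ) 1) (ha : 0 < a) (hα : 0 < α) :
    0 ≤ level γ a α ↔ a ≤ α := by
  have h1 : 0 < Real.log γ⁻¹ := Real.log_pos ((one_lt_inv₀ hγ.1).2 hγ.2)
  rw [level, Int.floor_nonneg, le_div_iff₀ h1, zero_mul,
    Real.log_nonneg_iff (by positivity), one_le_div ha]

/-- Among `t` iterations, the favourable ones (with property `S`) exceed one half by at most the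
number of those that succeed with step size at least `a`, plus half the initial level. Favourable iterations at a level at most zero succeed. So a favourable
iteration that is not both successful and of step size at least `a` moves the level one unit towards
zero, and every other iteration moves it by at most one unit. -/
lemma two_mul_count_le {αmax : ℝ} {s : ℕ → ℝ} {A S : ℕ → Prop} {t : ℕ}
    (hγ : γ ∈ Set.Ioo (0 : ℝ) 1) (ha : 0 < a) (hamax : a ≤ γ * αmax) (ha0 : a ≤ s 0)
    (hs0 : s 0 ≤ αmax)
    (hsucc : ∀ k, A k → s (k + 1) = min αmax (γ⁻¹ * s k))
    (hfail : ∀ k, ¬A k → s (k + 1) = γ * s k)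
    (hS : ∀ k < t, S k → γ * s k ≤ a → A k) :
    2 * (count S t : ℝ) ≤ t + 2 * count (fun k => S k ∧ A k ∧ a ≤ s k) t
      + Real.log (s 0 / a) / Real.log γ⁻¹ := by
  classical
  have hγ0 := hγ.1
  have hinv : 1 ≤ γ⁻¹ := (one_le_inv₀ hγ0).2 hγ.2.le
  have hbd : ∀ k, 0 < s k ∧ s k ≤ αmax := by
    intro k
    induction k with
    | zero => exact ⟨ha.trans_le ha0, hs0⟩
    | succ k ih =>
      by_cases hA : A k
      · rw [hsucc k hA]
        exact ⟨lt_min (ih.1.trans_le ih.2) (mul_pos (inv_pos.2 hγ0) ih.1), min_le_left _ _⟩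
      · rw [hfail k hA]
        exact ⟨mul_pos hγ0 ih.1, (mul_le_of_le_one_left ih.1.le hγ.2.le).trans ih.2⟩
  -- every step changes `|level|` by at most one, and a step towards level zero lowers it by one
  have hmove : ∀ k, |level γ a (s (k + 1))| ≤ |level γ a (s k)| + 1 ∧
      (A k → level γ a (s k) < 0 → |level γ a (s (k + 1))| = |level γ a (s k)| - 1) ∧
      (¬A k → 0 < level γ a (s k) → |level γ a (s (k + 1))| = |level γ a (s k)| - 1) := by
    intro k
    obtain ⟨hk0, hk1⟩ := hbd k
    by_cases hA : A k
    · have hup : level γ a (s (k + 1)) ≤ level γ a (s k) + 1 := by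
        rw [← level_inv_mul hγ ha hk0, hsucc k hA]
        exact level_mono hγ ha (hsucc k hA ▸ (hbd (k + 1)).1) (min_le_right _ _)
      have hlow : level γ a (s k) ≤ level γ a (s (k + 1)) := by
        rw [hsucc k hA]
        exact level_mono hγ ha hk0 (le_min hk1 (le_mul_of_one_le_left hk0.le hinv))
      refine ⟨by grind, fun _ hneg => ?_, fun h => absurd hA h⟩
      have hlt : s k < a := by
        rw [← not_le, ← level_nonneg_iff hγ ha hk0]; exact not_le.2 hneg
      have heq : s (k + 1) = γ⁻¹ * s k := by
        rw [hsucc k hA]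
        refine min_eq_right ?_
        rw [inv_mul_le_iff₀ hγ0]
        exact hlt.le.trans hamax
      rw [heq, level_inv_mul hγ ha hk0]
      grind
    · have heq : level γ a (s (k + 1)) = level γ a (s k) - 1 := by
        rw [hfail k hA, level_gamma_mul hγ ha hk0]
      rw [heq]
      refine ⟨by grind, fun h => absurd h hA, fun _ hpos => by grind⟩
  -- a level at most zero only gives `s k < a / γ`, whence the form of the hypothesis `hS`
  have hlow : ∀ k, level γ a (s k) ≤ 0 → γ * s k ≤ a := by
    intro k hk
    have h1 : level γ a (γ * s k) < 0 := by rw [level_gamma_mul hγ ha (hbd k).1]; linarith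
    rw [← not_le, level_nonneg_iff hγ ha (mul_pos hγ0 (hbd k).1), not_le] at h1
    exact h1.le
  have key : ∀ r ≤ t, 2 * (count S r : ℤ) + |level γ a (s r)|
      ≤ r + 2 * count (fun k => S k ∧ A k ∧ a ≤ s k) r + |level γ a (s 0)| := by
    intro r
    induction r with
    | zero => intro _; simp [count_zero]
    | succ r ih =>
      intro hr
      have ih' := ih (by omega)
      obtain ⟨m1, m2, m3⟩ := hmove r
      rw [count_succ, count_succ]
      have hS' := hS r (by omega)
      have hlow' := hlow r
      have hnn := level_nonneg_iff hγ ha (hbd r).1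
      by_cases h1 : S r
      · by_cases h2 : A r
        · by_cases h3 : a ≤ s r
          · simp only [h1, h2, h3, and_self, if_true]
            push_cast
            omega
          · have h4 : level γ a (s r) < 0 := by
              rw [← not_le, hnn]; exact h3
            have := m2 h2 h4
            simp only [h1, h2, h3, and_false, if_true, if_false]
            push_cast
            omega
        · have h4 : 0 < level γ a (s r) := by
            by_contra! hc
            exact h2 (hS' h1 (hlow' hc))
          have := m3 h2 h4
          simp only [h1, h2, false_and, and_false, if_true, if_false]
          push_cast
          omega
      · simp only [h1, false_and, if_false]
        push_cast
        omega
  have h := key t le_rfl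
  have h0 : 0 ≤ level γ a (s 0) := (level_nonneg_iff hγ ha (hbd 0).1).2 ha0
  rw [abs_of_nonneg h0] at h
  have h' : 2 * (count S t : ℤ) ≤ t + 2 * count (fun k => S k ∧ A k ∧ a ≤ s k) t
      + level γ a (s 0) := by linarith [abs_nonneg (level γ a (s t))]
  have h'' : 2 * (count S t : ℝ) ≤ t + 2 * count (fun k => S k ∧ A k ∧ a ≤ s k) t
      + (level γ a (s 0) : ℝ) := by exact_mod_cast h'
  have h3 : (level γ a (s 0) : ℝ) ≤ Real.log (s 0 / a) / Real.log γ⁻¹ := Int.floor_le _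
  linarith

/-- If a nonnegative potential `Φ` loses at least `h` in every favourable successful iteration
with step size at least `a` and gains at most `e k` in each iteration, then the number of favourable
iterations is bounded. -/
lemma count_bound {αmax h : ℝ} {s Φ e : ℕ → ℝ} {A S : ℕ → Prop} {t : ℕ}
    (hγ : γ ∈ Set.Ioo (0 : ℝ) 1) (ha : 0 < a) (hamax : a ≤ γ * αmax) (ha0 : a ≤ s 0)
    (hs0 : s 0 ≤ αmax)
    (hsucc : ∀ k, A k → s (k + 1) = min αmax (γ⁻¹ * s k))
    (hfail : ∀ k, ¬A k → s (k + 1) = γ * s k)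
    (hS : ∀ k < t, S k → γ * s k ≤ a → A k)
    (hΦ0 : ∀ k, 0 ≤ Φ k) (hh : 0 ≤ h) (hΦ : ∀ k < t, Φ (k + 1) ≤ Φ k + e k)
    (hΦS : ∀ k < t, S k → A k → a ≤ s k → Φ (k + 1) ≤ Φ k - h + e k) :
    h * (count S t - t / 2 - Real.log (s 0 / a) / (2 * Real.log γ⁻¹))
      ≤ Φ 0 + ∑ k ∈ Finset.range t, e k := by
  classical
  have key : ∀ r ≤ t, Φ r ≤ Φ 0 + ∑ k ∈ Finset.range r, e k
      - h * count (fun k => S k ∧ A k ∧ a ≤ s k) r := by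
    intro r
    induction r with
    | zero => intro _; simp [count_zero]
    | succ r ih =>
      intro hr
      have ih' := ih (by omega)
      rw [count_succ, Finset.sum_range_succ]
      by_cases h1 : S r ∧ A r ∧ a ≤ s r
      · have := hΦS r (by omega) h1.1 h1.2.1 h1.2.2
        rw [if_pos h1]
        push_cast
        linarith
      · have := hΦ r (by omega)
        rw [if_neg h1, add_zero]
        linarith
  have h1 := key t le_rfl
  have h2 := two_mul_count_le (t := t) hγ ha hamax ha0 hs0 hsucc hfail hS
  have h3 : (count S t : ℝ) - t / 2 - Real.log (s 0 / a) / (2 * Real.log γ⁻¹)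
      ≤ count (fun k => S k ∧ A k ∧ a ≤ s k) t := by
    have : Real.log (s 0 / a) / (2 * Real.log γ⁻¹) = Real.log (s 0 / a) / Real.log γ⁻¹ / 2 := by
      rw [mul_comm, div_div]
    rw [this]
    linarith
  have h4 := mul_le_mul_of_nonneg_left h3 hh
  linarith [hΦ0 t]

end Counting

/-! ### One realization of the algorithm -/

section Run

variable {n m : ℕ} {Ω₀ Ω₁ : Type*} [MeasurableSpace Ω₀] [MeasurableSpace Ω₁]

/-- The gradient estimate of iteration `k` is as accurate as the first-order oracle promises. -/
def GradAccurate (P : Problem n m) (par : Params) (I : Input n Ω₀ Ω₁) (εg κFO : ℝ)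
    (w : ℕ → Sample n Ω₀ Ω₁) (k : ℕ) : Prop :=
  ‖gbark P par I w k - gk P par I w k‖
    ≤ max εg (κFO * (state P par I w k).α * √(redbark P par I w k))

/-- Iteration `k` is favourable: its gradient estimate is accurate and the errors of its two function
estimates add up to at most `2 εf`. -/
def Favourable (P : Problem n m) (par : Params) (I : Input n Ω₀ Ω₁) (εg κFO : ℝ)
    (w : ℕ → Sample n Ω₀ Ω₁) (k : ℕ) : Prop :=
  GradAccurate P par I εg κFO w k ∧ ek P par I w k + epk P par I w k ≤ 2 * I.εf

/-- The assumptions on one realization together with the bounds that follow from them. The constant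
`κ` is a lower bound of the estimated model reduction that may be larger than `κ_l`. -/
structure GoodRun (P : Problem n m) (C : Constants) (I : Input n Ω₀ Ω₁) (κ : ℝ)
    (w : ℕ → Sample n Ω₀ Ω₁) : Prop where
  dom : ∀ k, xk P C.toParams I w k ∈ P.dom ∧ xpk P C.toParams I w k ∈ P.dom
  adm : ∀ k, P.HAdmissible C.κH C.ζ (xk P C.toParams I w k) (w k).H
  τbar_ge : ∀ k, C.τbmin ≤ taubark P C.toParams I w k
  mult_le : ∀ k, ‖yk P C.toParams I w k‖ ≤ C.κy
  τ_ge : ∀ k, C.τmin ≤ tauk P C.toParams I w k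
  redbark_ge : ∀ k, C.κl * taubark P C.toParams I w k *
    (‖dbark P C.toParams I w k‖ ^ 2 + ‖P.c (xk P C.toParams I w k)‖) ≤ redbark P C.toParams I w k
  redk_ge : ∀ k, C.κl * tauk P C.toParams I w k *
    (‖dk P C.toParams I w k‖ ^ 2 + ‖P.c (xk P C.toParams I w k)‖) ≤ redk P C.toParams I w k
  redbark_ge' : ∀ k, κ * taubark P C.toParams I w k * ‖dbark P C.toParams I w k‖ ^ 2
    ≤ redbark P C.toParams I w k

section Params

variable {P : Problem n m} {par : Params} {I : Input n Ω₀ Ω₁} {w : ℕ → Sample n Ω₀ Ω₁}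

lemma state_succ_of_accept {k : ℕ} (h : Accept P par I (state P par I w k) (w k)) :
    state P par I w (k + 1) = ⟨xpk P par I w k,
      min par.αmax (par.γ⁻¹ * (state P par I w k).α), taubark P par I w k⟩ := by
  rw [state, step, if_pos h]
  rfl

lemma state_succ_of_not_accept {k : ℕ} (h : ¬Accept P par I (state P par I w k) (w k)) :
    state P par I w (k + 1) = ⟨xk P par I w k,
      par.γ * (state P par I w k).α, taubark P par I w k⟩ := by
  rw [state, step, if_neg h]
  rfl

lemma state_succ_τ (k : ℕ) : (state P par I w (k + 1)).τ = taubark P par I w k := by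
  by_cases h : Accept P par I (state P par I w k) (w k)
  · rw [state_succ_of_accept h]
  · rw [state_succ_of_not_accept h]

lemma state_α_mem (hpar : par.Valid) (k : ℕ) : (state P par I w k).α ∈ Set.Ioc 0 par.αmax := by
  induction k with
  | zero => exact hpar.α0_mem
  | succ k ih =>
    by_cases h : Accept P par I (state P par I w k) (w k)
    · rw [state_succ_of_accept h]
      exact ⟨lt_min hpar.αmax_mem.1 (mul_pos (inv_pos.2 hpar.γ_mem.1) ih.1), min_le_left _ _⟩
    · rw [state_succ_of_not_accept h]
      exact ⟨mul_pos hpar.γ_mem.1 ih.1,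
        (mul_le_of_le_one_left ih.1.le hpar.γ_mem.2.le).trans ih.2⟩

lemma state_τ_le (hpar : par.Valid) (hτ : ∀ k, 0 < taubark P par I w k) (k : ℕ) :
    (state P par I w k).τ ≤ par.τinit ∧ 0 < (state P par I w k).τ := by
  induction k with
  | zero => exact ⟨le_rfl, hpar.τinit_pos⟩
  | succ k ih =>
    rw [state_succ_τ]
    exact ⟨(tauUpdate_le hpar ih.2.le).trans ih.1, hτ k⟩

lemma taubark_le (hpar : par.Valid) (hτ : ∀ k, 0 < taubark P par I w k) (k : ℕ) :
    taubark P par I w k ≤ par.τinit := by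
  rw [← state_succ_τ]; exact (state_τ_le hpar hτ _).1

lemma taubark_le_state_τ (hpar : par.Valid) (hτ : ∀ k, 0 < taubark P par I w k) (k : ℕ) :
    taubark P par I w k ≤ (state P par I w k).τ :=
  tauUpdate_le hpar (state_τ_le hpar hτ k).2.le

lemma taubark_mul_tauDenom_le (hpar : par.Valid) (hτ : ∀ k, 0 < taubark P par I w k) (k : ℕ) :
    taubark P par I w k * P.tauDenom (xk P par I w k) (w k).H (gbark P par I w k)
      ≤ (1 - par.σ) * l1 (P.c (xk P par I w k)) :=
  tauUpdate_mul_tauDenom_le hpar (hτ k)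

lemma ek_nonneg (k : ℕ) : 0 ≤ ek P par I w k := abs_nonneg _

lemma epk_nonneg (k : ℕ) : 0 ≤ epk P par I w k := abs_nonneg _

end Params

variable {P : Problem n m} {C : Constants} {I : Input n Ω₀ Ω₁} {w : ℕ → Sample n Ω₀ Ω₁} {κ : ℝ}
  {lip : Fin m → ℝ} {L εg ε κJ : ℝ}

namespace GoodRun

lemma τbar_pos (h : GoodRun P C I κ w) (hC : C.Valid) (k : ℕ) : 0 < taubark P C.toParams I w k :=
  hC.τbmin_pos.trans_le (h.τbar_ge k)

lemma redbark_nonneg (h : GoodRun P C I κ w) (hC : C.Valid) (k : ℕ) :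
    0 ≤ redbark P C.toParams I w k := by
  have := hC.κl_pos
  have := h.τbar_pos hC k
  exact le_trans (by positivity) (h.redbark_ge k)

lemma redk_nonneg (h : GoodRun P C I κ w) (hC : C.Valid) (k : ℕ) :
    0 ≤ redk P C.toParams I w k := by
  have := hC.κl_pos
  have := hC.τmin_pos.trans_le (h.τ_ge k)
  exact le_trans (by positivity) (h.redk_ge k)

/-- A small true model reduction certifies approximate stationarity, because it dominates
`‖d‖² + ‖c‖` and `∇f + Jᵀy = -H d`. -/
lemma stationary (h : GoodRun P C I κ w) (hC : C.Valid) (hκJ : 0 < κJ)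
    (hJ : ∀ x ∈ P.dom, ∀ y, κJ * ‖y‖ ≤ ‖P.jacT x y‖) (hε : 0 ≤ ε) {k : ℕ}
    (hk : √(redk P C.toParams I w k) ≤ C.εΔ ε) :
    max ‖gradient P.f (xk P C.toParams I w k) +
        P.jacT (xk P C.toParams I w k) (yk P C.toParams I w k)‖
      (√‖P.c (xk P C.toParams I w k)‖) ≤ ε := by
  have hl := hC.κl_pos
  have hm := hC.τmin_pos
  have hM : 0 < max C.κH 1 := lt_max_of_lt_right one_pos
  have hs : 0 < √(C.κl * C.τmin) := by positivity
  have hτ : 0 < tauk P C.toParams I w k := hm.trans_le (h.τ_ge k)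
  have hΔ : ‖dk P C.toParams I w k‖ ^ 2 + ‖P.c (xk P C.toParams I w k)‖
      ≤ (ε / max C.κH 1) ^ 2 := by
    have h1 : C.κl * C.τmin *
        (‖dk P C.toParams I w k‖ ^ 2 + ‖P.c (xk P C.toParams I w k)‖)
        ≤ redk P C.toParams I w k := by
      refine le_trans ?_ (h.redk_ge k)
      gcongr
      exact h.τ_ge k
    have h2 : redk P C.toParams I w k ≤ C.εΔ ε ^ 2 :=
      (Real.sqrt_le_left (by have := hC.scale_pos; rw [Constants.εΔ]; positivity)).1 hk
    have h3 : C.εΔ ε = ε / max C.κH 1 * √(C.κl * C.τmin) := by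
      rw [Constants.εΔ, Constants.scale]; field_simp
    rw [h3, mul_pow, Real.sq_sqrt (by positivity)] at h2
    have h4 := h1.trans h2
    rw [mul_comm] at h4
    exact le_of_mul_le_mul_right h4 (by positivity)
  have hd : ‖dk P C.toParams I w k‖ ≤ ε / max C.κH 1 := by
    refine le_of_sq_le_sq ?_ (by positivity)
    linarith [norm_nonneg (P.c (xk P C.toParams I w k))]
  have hc : √‖P.c (xk P C.toParams I w k)‖ ≤ ε / max C.κH 1 := by
    rw [Real.sqrt_le_left (by positivity)]
    linarith [sq_nonneg ‖dk P C.toParams I w k‖]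
  refine max_le ?_ (hc.trans (div_le_self hε (le_max_right _ _)))
  have h5 := sqp_fst hκJ (hJ _ (h.dom k).1) hC.ζ_pos (h.adm k) (gk P C.toParams I w k)
  have h6 : gradient P.f (xk P C.toParams I w k) +
      P.jacT (xk P C.toParams I w k) (yk P C.toParams I w k)
      = -(w k).H (dk P C.toParams I w k) := by
    have h7 : (w k).H (dk P C.toParams I w k)
        + P.jacT (xk P C.toParams I w k) (yk P C.toParams I w k)
        = -gradient P.f (xk P C.toParams I w k) := h5
    rw [← neg_eq_iff_eq_neg.2 h7]
    abel
  rw [h6, norm_neg]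
  calc ‖(w k).H (dk P C.toParams I w k)‖ ≤ ‖(w k).H‖ * ‖dk P C.toParams I w k‖ :=
        ContinuousLinearMap.le_opNorm _ _
    _ ≤ max C.κH 1 * (ε / max C.κH 1) := by
        gcongr
        exact (h.adm k).2.1.trans (le_max_left _ _)
    _ = ε := mul_div_cancel₀ _ hM.ne'

/-- In a favourable iteration before the stopping time, the gradient error is small relative to one
of the two model reductions, and these are comparable. -/
lemma favourable_compare (h : GoodRun P C I κ w) (hC : C.Valid) (hη : C.ηAdmissible)
    (hκJ : 0 < κJ) (hJ : ∀ x ∈ P.dom, ∀ y, κJ * ‖y‖ ≤ ‖P.jacT x y‖)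
    (hεg : εg ≤ C.η * C.εΔ ε) {k : ℕ} (hk : C.εΔ ε < √(redk P C.toParams I w k))
    (hS : GradAccurate P C.toParams I εg C.κFO w k) :
    C.ωp * redk P C.toParams I w k ≤ redbark P C.toParams I w k ∧
    (‖gbark P C.toParams I w k - gk P C.toParams I w k‖
        ≤ C.κFO * (state P C.toParams I w k).α * √(redbark P C.toParams I w k) ∨
      ‖gbark P C.toParams I w k - gk P C.toParams I w k‖ ≤ C.η * √(redk P C.toParams I w k) ∧
      ((1 - C.η * C.ω6) * redk P C.toParams I w k ≤ redbark P C.toParams I w k ∨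
        (1 - C.η * C.ω5) * redk P C.toParams I w k
          ≤ (1 + C.ετ * C.ω2) * redbark P C.toParams I w k)) := by
  have hτ := h.τbar_pos hC
  have hτle := taubark_le hC.par hτ k
  have htr := taubark_mul_tauDenom_le hC.par hτ k
  have hr := h.redk_nonneg hC k
  have hr' := h.redbark_nonneg hC k
  have h2 := hC.ω2_pos
  have h3 := hC.ω3_nonneg
  have h4 := hC.ω4_nonneg
  have hε := hC.par.ετ_mem.1
  have hα := (state_α_mem (P := P) (I := I) (w := w) hC.par k)
  rw [GradAccurate, le_max_iff] at hS
  rcases hS with he | he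
  · have he' : ‖gbark P C.toParams I w k - gk P C.toParams I w k‖
        ≤ C.η * √(redk P C.toParams I w k) :=
      he.trans (hεg.trans (mul_le_mul_of_nonneg_left hk.le hη.1.le))
    have hcmp := modelRed_compare_of_err_le_sqrt hC hη hκJ (hJ _ (h.dom k).1) (h.adm k) (hτ k)
      hτle htr (h.mult_le k) (h.τ_ge k) rfl rfl (h.redk_ge k) (h.redbark_ge k) he'
    refine ⟨?_, Or.inr ⟨he', hcmp⟩⟩
    rcases hcmp with hc | hc
    · have h5 : C.ωp ≤ 1 - C.η * C.ω6 := (min_le_left _ _).trans (min_le_right _ _)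
      exact (mul_le_mul_of_nonneg_right h5 hr).trans hc
    · have h5 : C.ωp ≤ (1 - C.η * C.ω5) / (1 + C.ετ * C.ω2) :=
        (min_le_left _ _).trans (min_le_left _ _)
      refine (mul_le_mul_of_nonneg_right h5 hr).trans ?_
      rw [div_mul_eq_mul_div, div_le_iff₀ (by positivity)]
      exact hc.trans_eq (mul_comm _ _)
  · refine ⟨?_, Or.inl he⟩
    have he' : ‖gbark P C.toParams I w k - gk P C.toParams I w k‖
        ≤ C.κFO * C.αmax * √(redbark P C.toParams I w k) := by
      refine he.trans ?_
      have := hC.κFO_nonneg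
      gcongr
      exact hα.2
    have hcmp := modelRed_compare_of_err_le_sqrt' hC hκJ (hJ _ (h.dom k).1) (h.adm k) (hτ k)
      hτle htr (h.mult_le k) (h.τ_ge k) rfl rfl (h.redbark_ge k) he'
    have h5 : C.ωp ≤ 1 / (1 + C.ω3 + C.ω4) := min_le_right _ _
    refine (mul_le_mul_of_nonneg_right h5 hr).trans ?_
    rw [one_div_mul_eq_div, div_le_iff₀ (by positivity)]
    exact hcmp.trans_eq (mul_comm _ _)

/-- A favourable iteration before the stopping time with step size at most `α̃ / γ` succeeds. -/
lemma accept_of_favourable (h : GoodRun P C I κ w) (hC : C.Valid) (hη : C.ηAdmissible)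
    (hP : P.Regular C.L lip) (hΓ : C.Γ = ∑ i, lip i) (hκ : C.κl ≤ C.γ ^ 2 * κ)
    (hκJ : 0 < κJ) (hJ : ∀ x ∈ P.dom, ∀ y, κJ * ‖y‖ ≤ ‖P.jacT x y‖)
    (hεg : εg ≤ C.η * C.εΔ ε) {k : ℕ} (hk : C.εΔ ε < √(redk P C.toParams I w k))
    (hS : Favourable P C.toParams I εg C.κFO w k)
    (hα : C.γ * (state P C.toParams I w k).α ≤ C.αtilde) :
    Accept P C.toParams I (state P C.toParams I w k) (w k) := by
  obtain ⟨hα0, hαm⟩ := state_α_mem (P := P) (I := I) (w := w) hC.par k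
  have hτ := h.τbar_pos hC
  have hτle := taubark_le hC.par hτ k
  obtain ⟨-, hcmp⟩ := h.favourable_compare hC hη hκJ hJ hεg hk hS.1
  have h1 := step_error_le hC hη hκ (h.τbar_ge k) hτle hα0.le hα
    (norm_nonneg (dbark P C.toParams I w k)) (h.redk_nonneg hC k) (h.redbark_ge' k) hcmp
  have h2 := hP.merit_trial_le (g := gbark P C.toParams I w k) hα0.le
    (hαm.trans hC.par.αmax_mem.2) (hτ k).le (h.dom k).1 (h.dom k).2
    (jac_dir hκJ (hJ _ (h.dom k).1) hC.ζ_pos (h.adm k) (gbark P C.toParams I w k))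
  rw [← hΓ] at h2
  have h3 : P.merit (xpk P C.toParams I w k) (taubark P C.toParams I w k)
      ≤ P.merit (xk P C.toParams I w k) (taubark P C.toParams I w k)
        - (state P C.toParams I w k).α * C.θ * redbark P C.toParams I w k := by
    have h4 := mul_le_mul_of_nonneg_left h1 hα0.le
    have h5 : P.merit (xpk P C.toParams I w k) (taubark P C.toParams I w k)
      ≤ P.merit (xk P C.toParams I w k) (taubark P C.toParams I w k)
        - (state P C.toParams I w k).α * redbark P C.toParams I w k
        + (state P C.toParams I w k).α * (taubark P C.toParams I w k *
          (‖gbark P C.toParams I w k - gk P C.toParams I w k‖ * ‖dbark P C.toParams I w k‖) +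
          (taubark P C.toParams I w k * C.L + C.Γ) / 2 * (state P C.toParams I w k).α *
            ‖dbark P C.toParams I w k‖ ^ 2) := h2
    linarith
  have he := hS.2
  have e1 := (abs_le.1 (le_refl (ek P C.toParams I w k))).1
  have e2 := (abs_le.1 (le_refl (epk P C.toParams I w k))).2
  have e1' : P.f (xk P C.toParams I w k) - ek P C.toParams I w k
      ≤ I.zeroth.est (xk P C.toParams I w k) (w k).ξ0 := by linarith
  have e2' : I.zeroth.est (xpk P C.toParams I w k) (w k).ξp
      ≤ P.f (xpk P C.toParams I w k) + epk P C.toParams I w k := by linarith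
  have e3 : I.zeroth.est (xpk P C.toParams I w k) (w k).ξp
      ≤ I.zeroth.est (xk P C.toParams I w k) (w k).ξ0
        + (P.f (xpk P C.toParams I w k) - P.f (xk P C.toParams I w k)) + 2 * I.εf := by linarith
  have e4 := mul_le_mul_of_nonneg_left e3 (hτ k).le
  rw [Problem.merit, Problem.merit] at h3
  have goal : taubark P C.toParams I w k * I.zeroth.est (xpk P C.toParams I w k) (w k).ξp
        + l1 (P.c (xpk P C.toParams I w k))
      ≤ taubark P C.toParams I w k * I.zeroth.est (xk P C.toParams I w k) (w k).ξ0
        + l1 (P.c (xk P C.toParams I w k))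
        - (state P C.toParams I w k).α * C.θ * redbark P C.toParams I w k
        + 2 * taubark P C.toParams I w k * I.εf := by linarith
  exact goal

/-- The potential of the complexity analysis: the merit function above a lower bound that is valid
for every value of the merit parameter above `τ̄_min`. -/
noncomputable def _root_.SSSQP.potential (P : Problem n m) (C : Constants) (I : Input n Ω₀ Ω₁)
    (finf φmin : ℝ) (w : ℕ → Sample n Ω₀ Ω₁) (k : ℕ) : ℝ :=
  P.merit (xk P C.toParams I w k) (state P C.toParams I w k).τ - φmin
    - ((state P C.toParams I w k).τ - C.τbmin) * finf

variable {finf φmin : ℝ}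

lemma potential_nonneg (h : GoodRun P C I κ w) (hC : C.Valid)
    (hfinf : ∀ x ∈ P.dom, finf ≤ P.f x) (hφ : ∀ x ∈ P.dom, φmin ≤ P.merit x C.τbmin) (k : ℕ) :
    0 ≤ potential P C I finf φmin w k := by
  have h1 := hφ _ (h.dom k).1
  have h2 := hfinf _ (h.dom k).1
  have h3 : C.τbmin ≤ (state P C.toParams I w k).τ :=
    (h.τbar_ge k).trans (taubark_le_state_τ hC.par (h.τbar_pos hC) k)
  have h4 := mul_le_mul_of_nonneg_left h2 (sub_nonneg.2 h3)
  rw [Problem.merit] at h1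
  rw [potential, Problem.merit]
  linarith

lemma potential_succ_le (h : GoodRun P C I κ w) (hC : C.Valid) (hεf : 0 ≤ I.εf)
    (hfinf : ∀ x ∈ P.dom, finf ≤ P.f x) (k : ℕ) :
    potential P C I finf φmin w (k + 1) ≤ potential P C I finf φmin w k
        + C.τinit * (2 * I.εf + (ek P C.toParams I w k + epk P C.toParams I w k)) ∧
    (Accept P C.toParams I (state P C.toParams I w k) (w k) →
      potential P C I finf φmin w (k + 1) ≤ potential P C I finf φmin w k
        - (state P C.toParams I w k).α * C.θ * redbark P C.toParams I w k
        + C.τinit * (2 * I.εf + (ek P C.toParams I w k + epk P C.toParams I w k))) := by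
  have hτ := h.τbar_pos hC
  have hτle := taubark_le hC.par hτ k
  have hτi := hC.par.τinit_pos
  have hα0 := (state_α_mem (P := P) (I := I) (w := w) hC.par k).1
  have hr := h.redbark_nonneg hC k
  have hθ := hC.par.θ_mem.1
  have hE : 0 ≤ 2 * I.εf + (ek P C.toParams I w k + epk P C.toParams I w k) :=
    add_nonneg (by positivity) (add_nonneg (ek_nonneg k) (epk_nonneg k))
  -- decreasing the merit parameter does not increase the potential, since `f ≥ f_inf`
  have hdrop : (taubark P C.toParams I w k - (state P C.toParams I w k).τ) *
      (P.f (xk P C.toParams I w k) - finf) ≤ 0 :=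
    mul_nonpos_of_nonpos_of_nonneg (sub_nonpos.2 (taubark_le_state_τ hC.par hτ k))
      (sub_nonneg.2 (hfinf _ (h.dom k).1))
  have hτE := mul_le_mul_of_nonneg_right hτle hE
  have key : Accept P C.toParams I (state P C.toParams I w k) (w k) →
      potential P C I finf φmin w (k + 1) ≤ potential P C I finf φmin w k
        - (state P C.toParams I w k).α * C.θ * redbark P C.toParams I w k
        + C.τinit * (2 * I.εf + (ek P C.toParams I w k + epk P C.toParams I w k)) := by
    intro hA
    have h1 : taubark P C.toParams I w k * I.zeroth.est (xpk P C.toParams I w k) (w k).ξp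
          + l1 (P.c (xpk P C.toParams I w k))
        ≤ taubark P C.toParams I w k * I.zeroth.est (xk P C.toParams I w k) (w k).ξ0
          + l1 (P.c (xk P C.toParams I w k))
          - (state P C.toParams I w k).α * C.θ * redbark P C.toParams I w k
          + 2 * taubark P C.toParams I w k * I.εf := hA
    have e1 := (abs_le.1 (le_refl (ek P C.toParams I w k))).2
    have e2 := (abs_le.1 (le_refl (epk P C.toParams I w k))).1
    have e3 : P.f (xpk P C.toParams I w k) - P.f (xk P C.toParams I w k)
        ≤ I.zeroth.est (xpk P C.toParams I w k) (w k).ξp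
          - I.zeroth.est (xk P C.toParams I w k) (w k).ξ0
          + (ek P C.toParams I w k + epk P C.toParams I w k) := by linarith
    have e4 := mul_le_mul_of_nonneg_left e3 (hτ k).le
    have hx : xk P C.toParams I w (k + 1) = xpk P C.toParams I w k := by
      rw [xk, state_succ_of_accept hA]
    rw [potential, potential, state_succ_τ, hx, Problem.merit, Problem.merit]
    linarith
  refine ⟨?_, key⟩
  by_cases hA : Accept P C.toParams I (state P C.toParams I w k) (w k)
  · have := key hA
    have h2 : 0 ≤ (state P C.toParams I w k).α * C.θ * redbark P C.toParams I w k := by positivity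
    linarith
  · have hx : xk P C.toParams I w (k + 1) = xk P C.toParams I w k := by
      rw [xk, state_succ_of_not_accept hA]
    rw [potential, potential, state_succ_τ, hx, Problem.merit, Problem.merit]
    have := mul_nonneg hτi.le hE
    linarith

/-- A realization with many favourable iterations and a moderate total noise stops in time. -/
lemma exists_sqrt_redk_le (h : GoodRun P C I κ w) (hC : C.Valid) (hη : C.ηAdmissible)
    (hP : P.Regular C.L lip) (hΓ : C.Γ = ∑ i, lip i) (hκ : C.κl ≤ C.γ ^ 2 * κ)
    (hκα : C.αtilde ≤ C.γ * C.α0) (hκJ : 0 < κJ)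
    (hJ : ∀ x ∈ P.dom, ∀ y, κJ * ‖y‖ ≤ ‖P.jacT x y‖)
    (hεf : 0 ≤ I.εf) (hεg : εg ≤ C.η * C.εΔ ε) (hε : 0 < ε)
    (hfinf : ∀ x ∈ P.dom, finf ≤ P.f x) (hφ : ∀ x ∈ P.dom, φmin ≤ P.merit x C.τbmin)
    {s pHat : ℝ} {t : ℕ}
    (hpHat : 1 / 2 + (4 * C.τinit * I.εf + s) / C.progress ε < pHat)
    (ht : C.Rhat (P.merit I.x0 C.τinit - φmin - (C.τinit - C.τbmin) * finf) ε /
      (pHat - 1 / 2 - (4 * C.τinit * I.εf + s) / C.progress ε) ≤ t)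
    (hcount : pHat * t < count (Favourable P C.toParams I εg C.κFO w) t)
    (hnoise : ∑ k ∈ Finset.range t, (ek P C.toParams I w k + epk P C.toParams I w k)
      ≤ (2 * I.εf + s / C.τinit) * t) :
    ∃ k < t, √(redk P C.toParams I w k) ≤ C.εΔ ε := by
  by_contra! hnot
  have hα0 := hC.par.α0_mem
  have hαt := hη.αtilde_pos hC
  have hγ := hC.par.γ_mem
  have hωp := hη.ωp_pos hC
  have hθ := hC.par.θ_mem.1
  have hτi := hC.par.τinit_pos
  have hεΔ : 0 < C.εΔ ε := div_pos hε hC.scale_pos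
  have hh : 0 < C.progress ε := by rw [Constants.progress]; positivity
  have hle : C.γ * C.α0 ≤ C.α0 := mul_le_of_le_one_left hα0.1.le hγ.2.le
  have hmain := count_bound (t := t) (h := C.progress ε)
    (s := fun k => (state P C.toParams I w k).α)
    (Φ := potential P C I finf φmin w)
    (e := fun k => C.τinit * (2 * I.εf + (ek P C.toParams I w k + epk P C.toParams I w k)))
    (A := fun k => Accept P C.toParams I (state P C.toParams I w k) (w k))
    (S := Favourable P C.toParams I εg C.κFO w) (αmax := C.αmax)
    hγ hαt (hκα.trans (mul_le_mul_of_nonneg_left hα0.2 hγ.1.le)) (hκα.trans hle) hα0.2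
    (fun k hA => by simp only [state_succ_of_accept hA])
    (fun k hA => by simp only [state_succ_of_not_accept hA])
    (fun k hk hS hle => h.accept_of_favourable hC hη hP hΓ hκ hκJ hJ hεg (hnot k hk) hS hle)
    (fun k => h.potential_nonneg hC hfinf hφ k) hh.le
    (fun k _ => (h.potential_succ_le hC hεf hfinf k).1)
    (fun k hk hS hA hle => by
      have h1 := (h.potential_succ_le (φmin := φmin) hC hεf hfinf k).2 hA
      have h2 := (h.favourable_compare hC hη hκJ hJ hεg (hnot k hk) hS.1).1
      have h3 : C.εΔ ε ^ 2 ≤ redk P C.toParams I w k := by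
        rw [← Real.sq_sqrt (h.redk_nonneg hC k)]
        exact pow_le_pow_left₀ hεΔ.le (hnot k hk).le 2
      have h4 : C.progress ε
          ≤ (state P C.toParams I w k).α * C.θ * redbark P C.toParams I w k := by
        rw [Constants.progress, mul_assoc _ C.ωp]
        have := hαt.le.trans hle
        gcongr
        exact (mul_le_mul_of_nonneg_left h3 hωp.le).trans h2
      linarith)
  have h0 : potential P C I finf φmin w 0
      = P.merit I.x0 C.τinit - φmin - (C.τinit - C.τbmin) * finf := rfl
  obtain ⟨gap, hgap⟩ : ∃ gap, gap = P.merit I.x0 C.τinit - φmin - (C.τinit - C.τbmin) * finf :=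
    ⟨_, rfl⟩
  rw [h0, ← hgap] at hmain
  rw [← hgap] at ht
  have hs0 : (state P C.toParams I w 0).α = C.α0 := rfl
  simp only [hs0] at hmain
  have hlog : Real.log (C.α0 / C.αtilde) / (2 * Real.log C.γ⁻¹)
      = (Real.log C.αtilde - Real.log C.α0) / (2 * Real.log C.γ) := by
    rw [Real.log_div hα0.1.ne' hαt.ne', Real.log_inv, mul_neg, div_neg, ← neg_div, neg_sub]
  rw [hlog] at hmain
  have hsum : ∑ k ∈ Finset.range t,
      C.τinit * (2 * I.εf + (ek P C.toParams I w k + epk P C.toParams I w k))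
      ≤ (4 * C.τinit * I.εf + s) * t := by
    rw [← Finset.mul_sum, Finset.sum_add_distrib, Finset.sum_const, Finset.card_range,
      nsmul_eq_mul]
    calc _ ≤ C.τinit * (t * (2 * I.εf) + (2 * I.εf + s / C.τinit) * t) := by gcongr
      _ = _ := by field_simp; ring
  have hden : 0 < pHat - 1 / 2 - (4 * C.τinit * I.εf + s) / C.progress ε := by linarith
  rw [div_le_iff₀ hden, Constants.Rhat] at ht
  have hlm : (Real.log C.αtilde - Real.log C.α0) / (2 * Real.log C.γ)
      ≤ max ((Real.log C.αtilde - Real.log C.α0) / (2 * Real.log C.γ)) 0 := le_max_left _ _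
  have h5 := mul_le_mul_of_nonneg_left ht hh.le
  have h6 : C.progress ε * (gap / C.progress ε) = gap := mul_div_cancel₀ _ hh.ne'
  have h7 : C.progress ε * ((4 * C.τinit * I.εf + s) / C.progress ε)
      = 4 * C.τinit * I.εf + s := mul_div_cancel₀ _ hh.ne'
  have h8 : C.progress ε * (pHat * t) < C.progress ε *
      count (Favourable P C.toParams I εg C.κFO w) t := by gcongr
  have h9 := mul_le_mul_of_nonneg_left hlm hh.le
  have h10 : C.progress ε * (t * (pHat - 1 / 2 - (4 * C.τinit * I.εf + s) / C.progress ε))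
      = C.progress ε * (pHat * t) - C.progress ε * t / 2 - (4 * C.τinit * I.εf + s) * t := by
    linear_combination -(t : ℝ) * h7
  rw [h10, mul_add, h6] at h5
  linarith

end GoodRun

end Run

/-! ### Conditional laws -/

section CondLaw

/-- Disintegration of a joint law, from its values on rectangles. -/
lemma lintegral_eq_of_rectangles {Ω Ω' Z : Type*} {mΩ : MeasurableSpace Ω}
    {mΩ' : MeasurableSpace Ω'} {mZ : MeasurableSpace Z} {μ : Measure Ω} [IsFiniteMeasure μ]
    {π : Ω → Ω'} (hπ : Measurable π) {ξ : Ω → Z} (hξ : Measurable ξ) {κ : Kernel Ω' Z}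
    [IsMarkovKernel κ]
    (h : ∀ A S, MeasurableSet A → MeasurableSet S →
      μ (π ⁻¹' A ∩ ξ ⁻¹' S) = ∫⁻ ω in π ⁻¹' A, κ (π ω) S ∂μ)
    {g : Ω' × Z → ℝ≥0∞} (hg : Measurable g) :
    ∫⁻ ω, g (π ω, ξ ω) ∂μ = ∫⁻ ω, ∫⁻ z, g (π ω, z) ∂κ (π ω) ∂μ := by
  have hmap : μ.map (fun ω => (π ω, ξ ω)) = (μ.map π) ⊗ₘ κ := by
    refine Measure.ext_prod fun {A S} hA hS => ?_
    rw [Measure.map_apply (hπ.prodMk hξ) (hA.prod hS), Measure.compProd_apply_prod hA hS,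
      setLIntegral_map hA (κ.measurable_coe hS) hπ, ← h A S hA hS]
    rfl
  rw [← lintegral_map hg (hπ.prodMk hξ), hmap, Measure.lintegral_compProd hg,
    lintegral_map hg.lintegral_kernel_prod_right' hπ]

/-- If `ξ` has the law `κ (q ω)` given `m`, then functions of the past and of `ξ` can be integrated
first over `ξ`. -/
lemma lintegral_mul_of_condLaw {Ω Q Z : Type*} {m mΩ : MeasurableSpace Ω} {mQ : MeasurableSpace Q}
    {mZ : MeasurableSpace Z} (hm : m ≤ mΩ) {μ : Measure Ω} [IsProbabilityMeasure μ]
    {κ : Kernel Q Z} [IsMarkovKernel κ] {q : Ω → Q} (hq : Measurable[m] q) {ξ : Ω → Z}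
    (hξ : Measurable ξ)
    (hlaw : ∀ S, MeasurableSet S → μ⟦ξ ⁻¹' S | m⟧ =ᵐ[μ] fun ω => (κ (q ω)).real S)
    {Y : Ω → ℝ≥0∞} (hY : Measurable[m] Y) {g : Ω × Z → ℝ≥0∞} (hg : Measurable[m.prod mZ] g) :
    ∫⁻ ω, Y ω * g (ω, ξ ω) ∂μ = ∫⁻ ω, Y ω * ∫⁻ z, g (ω, z) ∂κ (q ω) ∂μ := by
  have hrect : ∀ A S, MeasurableSet[m] A → MeasurableSet S →
      μ (A ∩ ξ ⁻¹' S) = ∫⁻ ω in A, κ (q ω) S ∂μ := by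
    intro A S hA hS
    have hSξ := hξ hS
    have h1 := setIntegral_condExp (μ := μ) hm
      (f := (ξ ⁻¹' S).indicator fun _ => (1 : ℝ)) ((integrable_const 1).indicator hSξ) hA
    rw [setIntegral_congr_ae (hm _ hA) ((hlaw S hS).mono fun ω h _ => h),
      setIntegral_indicator hSξ] at h1
    simp only [integral_const, smul_eq_mul, mul_one, measureReal_restrict_apply_univ] at h1
    have h2 : ∫ ω in A, (κ (q ω)).real S ∂μ = (∫⁻ ω in A, κ (q ω) S ∂μ).toReal := by
      refine integral_toReal ?_ (Filter.Eventually.of_forall fun ω => measure_lt_top _ _)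
      exact (((κ.measurable_coe hS).comp hq).mono hm le_rfl).aemeasurable
    rw [h2] at h1
    have h3 : ∫⁻ ω in A, κ (q ω) S ∂μ ≠ ⊤ := by
      refine ne_top_of_le_ne_top ENNReal.one_ne_top ?_
      calc ∫⁻ ω in A, κ (q ω) S ∂μ ≤ ∫⁻ ω in A, 1 ∂μ := lintegral_mono fun ω => prob_le_one
        _ = μ A := by simp
        _ ≤ 1 := prob_le_one
    exact ((ENNReal.toReal_eq_toReal_iff' h3 (measure_ne_top _ _)).1 h1).symm
  have h := @lintegral_eq_of_rectangles Ω Ω Z mΩ m mZ μ _ (fun ω => ω) (measurable_id'' hm) ξ hξ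
    (@Kernel.comap Q Z mQ mZ Ω m κ q hq) (@Kernel.IsMarkovKernel.comap Q Z mQ mZ Ω m q κ _ hq)
    hrect (fun p => Y p.1 * g p) ((hY.comp (@measurable_fst Ω Z m mZ)).mul hg)
  rw [h]
  refine lintegral_congr fun ω => ?_
  exact lintegral_const_mul (μ := κ (q ω)) (Y ω) (hg.comp (@measurable_prodMk_left Ω Z m mZ ω))

end CondLaw

/-! ### Exponential supermartingales -/

section Supermartingale

variable {Ω : Type*} {mΩ : MeasurableSpace Ω} {μ : Measure Ω} [IsProbabilityMeasure μ]
  {ℱ : Filtration ℕ mΩ}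

/-- A product of factors with conditional mean at most `r` has mean at most `r ^ t`. Conditional
expectations are replaced by tests against past functions `Y`. -/
lemma lintegral_prod_range_le {G : ℕ → Ω → ℝ≥0∞} {r : ℝ≥0∞} (hr : r ≠ ⊤)
    (hG : ∀ k, Measurable[ℱ (k + 1)] (G k))
    (h : ∀ k (Y : Ω → ℝ≥0∞), Measurable[ℱ k] Y → ∫⁻ ω, Y ω ∂μ ≠ ⊤ →
      ∫⁻ ω, Y ω * G k ω ∂μ ≤ r * ∫⁻ ω, Y ω ∂μ) (t : ℕ) :
    ∫⁻ ω, ∏ k ∈ Finset.range t, G k ω ∂μ ≤ r ^ t := by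
  have hmeas : ∀ t, Measurable[ℱ t] fun ω => ∏ k ∈ Finset.range t, G k ω := by
    intro t
    refine Finset.measurable_prod _ fun k hk => ?_
    exact (hG k).mono (ℱ.mono (by simpa using hk)) le_rfl
  induction t with
  | zero => simp
  | succ t ih =>
    simp only [Finset.prod_range_succ]
    refine (h t _ (hmeas t) (ne_top_of_le_ne_top (ENNReal.pow_ne_top hr) ih)).trans ?_
    rw [pow_succ, mul_comm]
    gcongr

/-- Hoeffding's lemma for a Bernoulli variable. -/
lemma bernoulli_mgf_le {p : ℝ} (hp0 : 0 ≤ p) (hp1 : p ≤ 1) (r : ℝ) :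
    Real.exp (r * p) * (1 - p + p * Real.exp (-r)) ≤ Real.exp (r ^ 2 / 8) := by
  obtain ⟨P, hP⟩ : ∃ P : Measure ℝ, P = ENNReal.ofReal p • Measure.dirac 1
      + ENNReal.ofReal (1 - p) • Measure.dirac 0 := ⟨_, rfl⟩
  have : IsProbabilityMeasure P := by
    refine ⟨?_⟩
    rw [hP]
    simp only [Measure.add_apply, Measure.smul_apply, measure_univ, smul_eq_mul, mul_one]
    rw [← ENNReal.ofReal_add hp0 (by linarith)]
    simp
  have hint : ∀ f : ℝ → ℝ, ∫ x, f x ∂P = p * f 1 + (1 - p) * f 0 := by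
    intro f
    have hi : ∀ (c : ℝ) (a : ℝ), Integrable f (ENNReal.ofReal c • Measure.dirac a) := fun c a =>
      (integrable_dirac (by simp [enorm_lt_top])).smul_measure ENNReal.ofReal_ne_top
    rw [hP, integral_add_measure (hi _ _) (hi _ _), integral_smul_measure, integral_smul_measure,
      integral_dirac, integral_dirac, ENNReal.toReal_ofReal hp0,
      ENNReal.toReal_ofReal (by linarith), smul_eq_mul, smul_eq_mul]
  have hmem : ∀ᵐ x ∂P, x ∈ Set.Icc (0 : ℝ) 1 := by
    rw [hP, ae_add_measure_iff]
    constructor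
    · exact Measure.ae_smul_measure (by simp [ae_dirac_eq]) _
    · exact Measure.ae_smul_measure (by simp [ae_dirac_eq]) _
  have h := (hasSubgaussianMGF_of_mem_Icc (X := fun x => x) aemeasurable_id' hmem).mgf_le (-r)
  rw [mgf, hint, hint] at h
  have e1 : p * Real.exp (-r * (1 - (p * 1 + (1 - p) * 0)))
      + (1 - p) * Real.exp (-r * (0 - (p * 1 + (1 - p) * 0)))
      = Real.exp (r * p) * (1 - p + p * Real.exp (-r)) := by
    have : -r * (1 - (p * 1 + (1 - p) * 0)) = r * p + -r := by ring
    rw [this, Real.exp_add]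
    have : -r * (0 - (p * 1 + (1 - p) * 0)) = r * p := by ring
    rw [this]
    ring
  rw [e1] at h
  refine h.trans_eq ?_
  congr 1
  push_cast
  norm_num
  ring

/-- Lower tail of the number of favourable iterations, each of which is favourable with conditional
probability at least `p`. -/
lemma measure_count_le {S : ℕ → Ω → Prop} {p pHat : ℝ} (hp : 1 / 2 < p) (hp1 : p ≤ 1)
    (hpHat : pHat ≤ p) (hS : ∀ k, MeasurableSet[ℱ (k + 1)] {ω | S k ω})
    (h : ∀ k (Y : Ω → ℝ≥0∞), Measurable[ℱ k] Y → ∫⁻ ω, Y ω ∂μ ≠ ⊤ →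
      ∫⁻ ω, Y ω * {ω | ¬S k ω}.indicator 1 ω ∂μ ≤ ENNReal.ofReal (1 - p) * ∫⁻ ω, Y ω ∂μ) (t : ℕ) :
    μ {ω | (count (fun k => S k ω) t : ℝ) ≤ pHat * t}
      ≤ ENNReal.ofReal (Real.exp (-((p - pHat) ^ 2 / (2 * p ^ 2) * t))) := by
  classical
  -- `r` minimizes `r² / 8 - r (p - p̂)`; the resulting exponent `2 (p - p̂)²` exceeds the one claimed
  -- because `p > 1 / 2`
  obtain ⟨r, hr⟩ : ∃ r, r = 4 * (p - pHat) := ⟨_, rfl⟩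
  have hr0 : 0 ≤ r := by rw [hr]; linarith
  obtain ⟨G, hGdef⟩ : ∃ G : ℕ → Ω → ℝ≥0∞, G = fun k ω =>
    ENNReal.ofReal (Real.exp (r * (p - if S k ω then 1 else 0))) := ⟨_, rfl⟩
  have hGmeas : ∀ k, Measurable[ℱ (k + 1)] (G k) := by
    intro k
    rw [hGdef]
    have h1 : Measurable[ℱ (k + 1)] fun ω => if S k ω then (1 : ℝ) else 0 :=
      Measurable.ite (hS k) measurable_const measurable_const
    exact ((measurable_const.mul (measurable_const.sub h1)).exp).ennreal_ofReal
  have he1 : Real.exp (-r) ≤ 1 := Real.exp_le_one_iff.2 (by linarith)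
  have hGle : ∀ k (Y : Ω → ℝ≥0∞), Measurable[ℱ k] Y → ∫⁻ ω, Y ω ∂μ ≠ ⊤ →
      ∫⁻ ω, Y ω * G k ω ∂μ ≤ ENNReal.ofReal (Real.exp (r ^ 2 / 8)) * ∫⁻ ω, Y ω ∂μ := by
    intro k Y hY hYtop
    obtain ⟨a, ha⟩ : ∃ a, a = ENNReal.ofReal (Real.exp (r * p) * Real.exp (-r)) := ⟨_, rfl⟩
    obtain ⟨b, hb⟩ : ∃ b, b = ENNReal.ofReal (Real.exp (r * p) * (1 - Real.exp (-r))) := ⟨_, rfl⟩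
    have hYm : Measurable Y := hY.mono (ℱ.le k) le_rfl
    have hG : ∀ ω, Y ω * G k ω = a * Y ω + b * (Y ω * {ω | ¬S k ω}.indicator 1 ω) := by
      intro ω
      rw [hGdef, ha, hb]
      by_cases hω : S k ω
      · simp only [hω, if_true, Set.indicator, Set.mem_ofPred_eq, not_true_eq_false, if_false,
          mul_zero, add_zero]
        rw [mul_sub, mul_one, sub_eq_add_neg, Real.exp_add, mul_comm]
      · simp only [hω, if_false, Set.indicator, Set.mem_ofPred_eq, not_false_eq_true, if_true,
          Pi.one_apply, mul_one, sub_zero]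
        rw [← add_mul, ← ENNReal.ofReal_add (by positivity)
          (mul_nonneg (Real.exp_pos _).le (by linarith)), mul_comm]
        congr 2
        ring
    calc ∫⁻ ω, Y ω * G k ω ∂μ
        = a * ∫⁻ ω, Y ω ∂μ + b * ∫⁻ ω, Y ω * {ω | ¬S k ω}.indicator 1 ω ∂μ := by
          rw [lintegral_congr hG, lintegral_add_left (hYm.const_mul a),
            lintegral_const_mul _ hYm, lintegral_const_mul]
          refine hYm.mul (measurable_one.indicator ?_)
          exact (ℱ.le (k + 1) _ (hS k)).compl
      _ ≤ a * ∫⁻ ω, Y ω ∂μ + b * (ENNReal.ofReal (1 - p) * ∫⁻ ω, Y ω ∂μ) := by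
          gcongr
          exact h k Y hY hYtop
      _ = ENNReal.ofReal (Real.exp (r * p) * (1 - p + p * Real.exp (-r))) * ∫⁻ ω, Y ω ∂μ := by
          rw [ha, hb, ← mul_assoc, ← ENNReal.ofReal_mul
            (mul_nonneg (Real.exp_pos _).le (by linarith)), ← add_mul, ← ENNReal.ofReal_add
            (by positivity) (mul_nonneg (mul_nonneg (Real.exp_pos _).le (by linarith))
              (by linarith))]
          congr 2
          ring
      _ ≤ _ := by
          gcongr
          exact bernoulli_mgf_le (by linarith) hp1 r
  have hprod := lintegral_prod_range_le ENNReal.ofReal_ne_top hGmeas hGle t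
  have hprodeq : ∀ ω, ∏ k ∈ Finset.range t, G k ω
      = ENNReal.ofReal (Real.exp (r * (p * t - count (fun k => S k ω) t))) := by
    intro ω
    rw [hGdef, ← ENNReal.ofReal_prod_of_nonneg (fun _ _ => (Real.exp_pos _).le), ← Real.exp_sum,
      ← Finset.mul_sum, Finset.sum_sub_distrib, Finset.sum_const, Finset.card_range,
      nsmul_eq_mul, mul_comm (t : ℝ) p, count, Finset.card_filter]
    push_cast
    rfl
  have hmarkov := mul_meas_ge_le_lintegral₀ (μ := μ)
    (f := fun ω => ∏ k ∈ Finset.range t, G k ω)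
    (Finset.measurable_prod _ fun k _ => (hGmeas k).mono (ℱ.le _) le_rfl).aemeasurable
    (ENNReal.ofReal (Real.exp (r * ((p - pHat) * t))))
  have hsub : {ω | (count (fun k => S k ω) t : ℝ) ≤ pHat * t} ⊆
      {ω | ENNReal.ofReal (Real.exp (r * ((p - pHat) * t))) ≤ ∏ k ∈ Finset.range t, G k ω} := by
    intro ω hω
    rw [Set.mem_ofPred_eq] at hω ⊢
    rw [hprodeq]
    gcongr
    linarith
  have hfin : ENNReal.ofReal (Real.exp (r * ((p - pHat) * t)))
      * μ {ω | (count (fun k => S k ω) t : ℝ) ≤ pHat * t}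
      ≤ ENNReal.ofReal (Real.exp (r ^ 2 / 8)) ^ t :=
    (mul_le_mul_right (measure_mono hsub) _).trans (hmarkov.trans hprod)
  rw [← ENNReal.ofReal_pow (Real.exp_pos _).le, ← Real.exp_nat_mul] at hfin
  have h1 : ENNReal.ofReal (Real.exp (-((p - pHat) ^ 2 / (2 * p ^ 2) * t)))
      = ENNReal.ofReal (Real.exp (-(r * ((p - pHat) * t))))
        * ENNReal.ofReal (Real.exp (r * ((p - pHat) * t)
          - (p - pHat) ^ 2 / (2 * p ^ 2) * t)) := by
    rw [← ENNReal.ofReal_mul (Real.exp_pos _).le, ← Real.exp_add]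
    congr 2
    ring
  have h2 : t * (r ^ 2 / 8) ≤ r * ((p - pHat) * t) - (p - pHat) ^ 2 / (2 * p ^ 2) * t := by
    have h3 : (p - pHat) ^ 2 / (2 * p ^ 2) ≤ 2 * (p - pHat) ^ 2 := by
      rw [div_le_iff₀ (by positivity)]
      have : 1 ≤ 4 * p ^ 2 := by nlinarith
      nlinarith [sq_nonneg (p - pHat)]
    have h4 := mul_le_mul_of_nonneg_right h3 (Nat.cast_nonneg (α := ℝ) t)
    rw [hr]
    linarith
  have h5 : μ {ω | (count (fun k => S k ω) t : ℝ) ≤ pHat * t}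
      = ENNReal.ofReal (Real.exp (-(r * ((p - pHat) * t)))) *
        (ENNReal.ofReal (Real.exp (r * ((p - pHat) * t)))
      * μ {ω | (count (fun k => S k ω) t : ℝ) ≤ pHat * t}) := by
    rw [← mul_assoc, ← ENNReal.ofReal_mul (Real.exp_pos _).le, ← Real.exp_add]
    simp
  rw [h5, h1]
  gcongr
  exact hfin.trans (ENNReal.ofReal_le_ofReal (Real.exp_le_exp.2 h2))

/-- Chernoff bound for a sum whose increments have conditional exponential moments. -/
lemma measure_sum_gt_le {E : ℕ → Ω → ℝ} {r a v c : ℝ} (hr : 0 ≤ r)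
    (hE : ∀ k, Measurable[ℱ (k + 1)] (E k))
    (h : ∀ k (Y : Ω → ℝ≥0∞), Measurable[ℱ k] Y → ∫⁻ ω, Y ω ∂μ ≠ ⊤ →
      ∫⁻ ω, Y ω * ENNReal.ofReal (Real.exp (r * (E k ω - a))) ∂μ
        ≤ ENNReal.ofReal (Real.exp c) * ∫⁻ ω, Y ω ∂μ) (t : ℕ) :
    μ {ω | (a + v) * t < ∑ k ∈ Finset.range t, E k ω}
      ≤ ENNReal.ofReal (Real.exp (t * (-(r * v) + c))) := by
  obtain ⟨G, hGdef⟩ : ∃ G : ℕ → Ω → ℝ≥0∞, G = fun k ω =>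
    ENNReal.ofReal (Real.exp (r * (E k ω - a))) := ⟨_, rfl⟩
  have hGmeas : ∀ k, Measurable[ℱ (k + 1)] (G k) := by
    intro k
    rw [hGdef]
    exact ((measurable_const.mul ((hE k).sub measurable_const)).exp).ennreal_ofReal
  have hprod := lintegral_prod_range_le (G := G) ENNReal.ofReal_ne_top hGmeas
    (by rw [hGdef]; exact h) t
  have hprodeq : ∀ ω, ∏ k ∈ Finset.range t, G k ω
      = ENNReal.ofReal (Real.exp (r * (∑ k ∈ Finset.range t, E k ω - a * t))) := by
    intro ω
    rw [hGdef, ← ENNReal.ofReal_prod_of_nonneg (fun _ _ => (Real.exp_pos _).le), ← Real.exp_sum,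
      ← Finset.mul_sum, Finset.sum_sub_distrib, Finset.sum_const, Finset.card_range,
      nsmul_eq_mul, mul_comm (t : ℝ) a]
  have hmarkov := mul_meas_ge_le_lintegral₀ (μ := μ)
    (f := fun ω => ∏ k ∈ Finset.range t, G k ω)
    (Finset.measurable_prod _ fun k _ => (hGmeas k).mono (ℱ.le _) le_rfl).aemeasurable
    (ENNReal.ofReal (Real.exp (r * (v * t))))
  have hsub : {ω | (a + v) * t < ∑ k ∈ Finset.range t, E k ω} ⊆
      {ω | ENNReal.ofReal (Real.exp (r * (v * t))) ≤ ∏ k ∈ Finset.range t, G k ω} := by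
    intro ω hω
    rw [Set.mem_ofPred_eq] at hω ⊢
    rw [hprodeq]
    gcongr
    linarith
  have hfin : ENNReal.ofReal (Real.exp (r * (v * t)))
      * μ {ω | (a + v) * t < ∑ k ∈ Finset.range t, E k ω} ≤ ENNReal.ofReal (Real.exp c) ^ t :=
    (mul_le_mul_right (measure_mono hsub) _).trans (hmarkov.trans hprod)
  rw [← ENNReal.ofReal_pow (Real.exp_pos _).le, ← Real.exp_nat_mul] at hfin
  have h5 : μ {ω | (a + v) * t < ∑ k ∈ Finset.range t, E k ω}
      = ENNReal.ofReal (Real.exp (-(r * (v * t)))) * (ENNReal.ofReal (Real.exp (r * (v * t)))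
      * μ {ω | (a + v) * t < ∑ k ∈ Finset.range t, E k ω}) := by
    rw [← mul_assoc, ← ENNReal.ofReal_mul (Real.exp_pos _).le, ← Real.exp_add]
    simp
  have h1 : ENNReal.ofReal (Real.exp (t * (-(r * v) + c)))
      = ENNReal.ofReal (Real.exp (-(r * (v * t)))) * ENNReal.ofReal (Real.exp (t * c)) := by
    rw [← ENNReal.ofReal_mul (Real.exp_pos _).le, ← Real.exp_add]
    congr 2
    ring
  rw [h5, h1]
  gcongr

end Supermartingale

/-! ### Optimization of the exponent -/

lemma expNeg_ofReal {x : ℝ} (hx : 0 ≤ x) : expNeg (ENNReal.ofReal x) = Real.exp (-x) := by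
  rw [expNeg, if_neg ENNReal.ofReal_ne_top, ENNReal.toReal_ofReal hx]

lemma expNeg_nonneg (x : ℝ≥0∞) : 0 ≤ expNeg x := by
  unfold expNeg; split_ifs
  · exact le_rfl
  · exact (Real.exp_pos _).le

/-- Minimization of the sub-exponential Chernoff bound over the admissible parameters: the minimizer
is `v / ν²` if this is at most `1 / b`, and `1 / b` otherwise. -/
lemma le_expNeg_bernsteinRate {a v ν b : ℝ} (hv : 0 ≤ v) (hν : 0 ≤ ν) (hb : 0 ≤ b) (t : ℕ)
    (h : ∀ r : ℝ, 0 ≤ r → r * b ≤ 1 → a ≤ Real.exp (t * (-(r * v) + r ^ 2 * ν ^ 2 / 2))) :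
    a ≤ expNeg (bernsteinRate v ν b * (t : ℝ≥0∞)) := by
  have ha1 : a ≤ 1 := by simpa using h 0 le_rfl (by simp)
  have hone : expNeg 0 = 1 := by simp [expNeg]
  rcases hv.eq_or_lt with rfl | hv
  · simpa [bernsteinRate, hone] using ha1
  rcases Nat.eq_zero_or_pos t with rfl | ht
  · simpa [hone] using ha1
  have htR : (0 : ℝ) < t := by exact_mod_cast ht
  have hcast : (t : ℝ≥0∞) = ENNReal.ofReal t := (ENNReal.ofReal_natCast t).symm
  have hne : ENNReal.ofReal (v ^ 2) ≠ 0 := by simpa using by positivity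
  have hne' : ENNReal.ofReal v ≠ 0 := by simpa using hv
  -- the two competing bounds
  have hquad : 0 < ν → v * b ≤ ν ^ 2 → a ≤ Real.exp (-(v ^ 2 / (2 * ν ^ 2) * t)) := by
    intro hν hle
    refine (h (v / ν ^ 2) (by positivity) ?_).trans_eq ?_
    · rw [div_mul_eq_mul_div, div_le_one (by positivity)]; exact hle
    · congr 1
      field_simp
      ring
  have hlin : 0 < b → ν ^ 2 ≤ v * b → a ≤ Real.exp (-(v / (2 * b) * t)) := by
    intro hb hle
    refine (h (1 / b) (by positivity) (by rw [one_div_mul_cancel hb.ne'])).trans ?_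
    gcongr
    have h1 : (1 / b) ^ 2 * ν ^ 2 / 2 ≤ (1 / b) ^ 2 * (v * b) / 2 := by gcongr
    have h2 : (1 / b) ^ 2 * (v * b) / 2 = v / (2 * b) := by field_simp
    have h3 : 1 / b * v = 2 * (v / (2 * b)) := by field_simp
    have h4 : -(1 / b * v) + (1 / b) ^ 2 * ν ^ 2 / 2 ≤ -(v / (2 * b)) := by linarith
    have := mul_le_mul_of_nonneg_left h4 htR.le
    linarith
  rcases hν.eq_or_lt with rfl | hν
  · rcases hb.eq_or_lt with rfl | hb
    · have htop : bernsteinRate v 0 0 * (t : ℝ≥0∞) = ⊤ := by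
        simp [bernsteinRate, ENNReal.div_zero hne, ENNReal.div_zero hne', ht.ne',
          ENNReal.top_mul]
      rw [htop, expNeg, if_pos rfl]
      have hlim : Filter.Tendsto (fun r : ℝ => Real.exp (-(t * v) * r)) Filter.atTop (nhds 0) := by
        refine Real.tendsto_exp_atBot.comp ?_
        exact Filter.tendsto_id.const_mul_atTop_of_neg (by
          have : 0 < t * v := by positivity
          linarith)
      -- with `ν = b = 0` every exponent parameter is admissible
      refine ge_of_tendsto hlim (Filter.eventually_atTop.2 ⟨0, fun r hr => ?_⟩)
      refine (h r hr (by simp)).trans_eq ?_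
      congr 1
      ring
    · have hrate : bernsteinRate v 0 b * (t : ℝ≥0∞) = ENNReal.ofReal (v / (2 * b) * t) := by
        rw [ENNReal.ofReal_mul (by positivity), ENNReal.ofReal_div_of_pos (by positivity), hcast,
          bernsteinRate]
        simp [ENNReal.div_zero hne]
      rw [hrate, expNeg_ofReal (by positivity)]
      exact hlin hb (by rw [zero_pow two_ne_zero]; positivity)
  · rcases hb.eq_or_lt with rfl | hb
    · have hrate : bernsteinRate v ν 0 * (t : ℝ≥0∞)
          = ENNReal.ofReal (v ^ 2 / (2 * ν ^ 2) * t) := by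
        rw [ENNReal.ofReal_mul (by positivity), ENNReal.ofReal_div_of_pos (by positivity), hcast,
          bernsteinRate]
        simp [ENNReal.div_zero hne']
      rw [hrate, expNeg_ofReal (by positivity)]
      exact hquad hν (by rw [mul_zero]; positivity)
    · have hrate : bernsteinRate v ν b * (t : ℝ≥0∞)
          = ENNReal.ofReal (min (v ^ 2 / (2 * ν ^ 2)) (v / (2 * b)) * t) := by
        rw [ENNReal.ofReal_mul (by positivity), ENNReal.ofReal_min,
          ENNReal.ofReal_div_of_pos (by positivity), ENNReal.ofReal_div_of_pos (by positivity),
          hcast, bernsteinRate]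
      rw [hrate, expNeg_ofReal (by positivity)]
      rcases le_total (v * b) (ν ^ 2) with hle | hle
      · refine (hquad hν hle).trans ?_
        gcongr
        exact min_le_left _ _
      · refine (hlin hb hle).trans ?_
        gcongr
        exact min_le_right _ _

/-- A relative form of `le_expNeg_bernsteinRate`. -/
lemma le_ofReal_expNeg_bernsteinRate_mul {A B : ℝ≥0∞} {v ν b : ℝ} (hB : B ≠ ⊤) (hv : 0 ≤ v)
    (hν : 0 ≤ ν) (hb : 0 ≤ b)
    (h : ∀ r : ℝ, 0 ≤ r → r * b ≤ 1 →
      A ≤ ENNReal.ofReal (Real.exp (-(r * v) + r ^ 2 * ν ^ 2 / 2)) * B) :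
    A ≤ ENNReal.ofReal (expNeg (bernsteinRate v ν b)) * B := by
  have hA : A ≠ ⊤ := ne_top_of_le_ne_top (ENNReal.mul_ne_top ENNReal.ofReal_ne_top hB)
    (h 0 le_rfl (by simp))
  by_cases hB0 : B = 0
  · have := h 0 le_rfl (by simp)
    rw [hB0, mul_zero] at this ⊢
    exact this
  have hBpos : 0 < B.toReal := ENNReal.toReal_pos hB0 hB
  have h1 := le_expNeg_bernsteinRate (a := A.toReal / B.toReal) hv hν hb 1 fun r hr hrb => by
    rw [div_le_iff₀ hBpos, Nat.cast_one, one_mul]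
    have h2 := ENNReal.toReal_mono (ENNReal.mul_ne_top ENNReal.ofReal_ne_top hB) (h r hr hrb)
    rwa [ENNReal.toReal_mul, ENNReal.toReal_ofReal (Real.exp_pos _).le] at h2
  rw [Nat.cast_one, mul_one, div_le_iff₀ hBpos] at h1
  rw [← ENNReal.ofReal_toReal hA, ← ENNReal.ofReal_toReal hB,
    ← ENNReal.ofReal_mul (expNeg_nonneg _)]
  exact ENNReal.ofReal_le_ofReal h1

/-! ### Measurability of the algorithm -/

lemma measurable_comp_of_continuousOn {β X E : Type*} {mβ : MeasurableSpace β} [TopologicalSpace X]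
    [MeasurableSpace X] [OpensMeasurableSpace X] [TopologicalSpace E] [MeasurableSpace E]
    [BorelSpace E] [Zero E] {f : X → E} {s : Set X} (hs : IsOpen s) (hf : ContinuousOn f s)
    {x : β → X} (hx : Measurable x) (hxs : ∀ b, x b ∈ s) : Measurable fun b => f (x b) := by
  classical
  have h1 : Measurable (s.piecewise f fun _ => 0) :=
    hf.measurable_piecewise continuousOn_const hs.measurableSet
  have h2 : (fun b => f (x b)) = (s.piecewise f fun _ => 0) ∘ x := by
    funext b
    exact (Set.piecewise_eq_of_mem s f _ (hxs b)).symm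
  rw [h2]
  exact h1.comp hx

lemma measurable_l1 {m : ℕ} : Measurable (l1 : Vec m → ℝ) := by
  unfold l1
  fun_prop

lemma measurable_gradient {n : ℕ} (f : Vec n → ℝ) : Measurable (gradient f) :=
  (InnerProductSpace.toDual ℝ (Vec n)).symm.continuous.measurable.comp (measurable_fderiv ℝ f)

/-- Inversion of continuous linear maps is measurable: it is continuous on the open set of
invertible maps and zero elsewhere. -/
lemma measurable_clm_inverse {E : Type*} [NormedAddCommGroup E] [NormedSpace ℝ E] [CompleteSpace E] :
    Measurable (ContinuousLinearMap.inverse : (E →L[ℝ] E) → (E →L[ℝ] E)) := by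
  classical
  obtain ⟨S, hS⟩ : ∃ S : Set (E →L[ℝ] E),
    S = Set.range (fun e : E ≃L[ℝ] E => (e : E →L[ℝ] E)) := ⟨_, rfl⟩
  have hopen : IsOpen S := hS ▸ ContinuousLinearEquiv.isOpen
  have hcont : ContinuousOn (ContinuousLinearMap.inverse : (E →L[ℝ] E) → (E →L[ℝ] E)) S := by
    intro T hT
    rw [hS] at hT
    obtain ⟨e, rfl⟩ := hT
    exact (contDiffAt_map_inverse (n := 0) e).continuousAt.continuousWithinAt
  have hpw : (ContinuousLinearMap.inverse : (E →L[ℝ] E) → (E →L[ℝ] E))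
      = S.piecewise ContinuousLinearMap.inverse fun _ => 0 := by
    funext T
    by_cases hT : T ∈ S
    · rw [Set.piecewise_eq_of_mem _ _ _ hT]
    · rw [Set.piecewise_eq_of_notMem _ _ _ hT]
      refine ContinuousLinearMap.inverse_of_not_isInvertible fun h => hT ?_
      rw [hS]
      obtain ⟨e, he⟩ := h
      exact ⟨e, he⟩
  rw [hpw]
  exact hcont.measurable_piecewise continuousOn_const hopen.measurableSet

section Measurability

variable {n m : ℕ} {β : Type*} {mβ : MeasurableSpace β} {P : Problem n m} {par : Params}
  {x g d : β → Vec n} {H : β → Vec n →L[ℝ] Vec n} {τ : β → ℝ}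

lemma measurable_jac : Measurable P.jac := measurable_fderiv ℝ P.c

lemma measurable_jacT : Measurable P.jacT :=
  (ContinuousLinearMap.adjoint (𝕜 := ℝ) (E := Vec n) (F := Vec m)).continuous.measurable.comp
    measurable_jac

lemma measurable_kkt (hx : Measurable x) (hH : Measurable H) :
    Measurable fun b => P.kkt (x b) (H b) := by
  have hcont : Continuous fun p : (Vec n →L[ℝ] Vec n) × (Vec m →L[ℝ] Vec n) × (Vec n →L[ℝ] Vec m) =>
      (ContinuousLinearMap.inl ℝ (Vec n) (Vec m)).comp
        (p.1.comp (ContinuousLinearMap.fst ℝ (Vec n) (Vec m))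
          + p.2.1.comp (ContinuousLinearMap.snd ℝ (Vec n) (Vec m)))
      + (ContinuousLinearMap.inr ℝ (Vec n) (Vec m)).comp
        (p.2.2.comp (ContinuousLinearMap.fst ℝ (Vec n) (Vec m))) := by
    fun_prop
  have h := hcont.measurable.comp
    (hH.prodMk ((measurable_jacT (P := P).comp hx).prodMk (measurable_jac (P := P).comp hx)))
  refine (congrArg Measurable (funext fun b => ?_)).mp h
  refine ContinuousLinearMap.ext fun z => ?_
  simp [kkt_apply]

lemma measurable_dir (hx : Measurable x) (hc : Measurable fun b => P.c (x b)) (hH : Measurable H)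
    (hg : Measurable g) : Measurable fun b => P.dir (x b) (H b) (g b) := by
  have h1 : Measurable fun b => (P.kkt (x b) (H b)).inverse :=
    measurable_clm_inverse.comp (measurable_kkt hx hH)
  have hcont : Continuous fun p : ((Vec n × Vec m) →L[ℝ] (Vec n × Vec m)) × (Vec n × Vec m) =>
      (-(p.1 p.2)).1 := by
    fun_prop
  exact hcont.measurable.comp (h1.prodMk (hg.prodMk hc))

lemma measurable_tauDenom (hx : Measurable x) (hc : Measurable fun b => P.c (x b))
    (hH : Measurable H) (hg : Measurable g) :
    Measurable fun b => P.tauDenom (x b) (H b) (g b) := by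
  have hd := measurable_dir hx hc hH hg
  have hcont : Continuous fun p : (Vec n →L[ℝ] Vec n) × Vec n => p.1 p.2 := by fun_prop
  have hHd : Measurable fun b => H b (P.dir (x b) (H b) (g b)) :=
    hcont.measurable.comp (hH.prodMk hd)
  unfold Problem.tauDenom
  exact (hg.inner hd).add ((hd.inner hHd).max measurable_const)

lemma measurable_tauUpdate (hx : Measurable x) (hc : Measurable fun b => P.c (x b))
    (hH : Measurable H) (hg : Measurable g) (hτ : Measurable τ) :
    Measurable fun b => P.tauUpdate par (x b) (H b) (g b) (τ b) := by
  classical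
  have hD := measurable_tauDenom hx hc hH hg
  have htrial : Measurable fun b => (1 - par.σ) * l1 (P.c (x b)) / P.tauDenom (x b) (H b) (g b) :=
    (measurable_const.mul (measurable_l1.comp hc)).div hD
  unfold Problem.tauUpdate
  refine Measurable.ite ?_ hτ ((measurable_const.mul hτ).min htrial)
  exact (measurableSet_le hD measurable_const).union (measurableSet_le hτ htrial)

lemma measurable_modelRed (hx : Measurable x) (hc : Measurable fun b => P.c (x b))
    (hg : Measurable g) (hd : Measurable d) (hτ : Measurable τ) :
    Measurable fun b => P.modelRed (x b) (τ b) (g b) (d b) := by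
  have hcont : Continuous fun p : (Vec n →L[ℝ] Vec m) × Vec n => p.1 p.2 := by fun_prop
  have hJd : Measurable fun b => P.jac (x b) (d b) :=
    hcont.measurable.comp ((measurable_jac.comp hx).prodMk hd)
  have h : (fun b => P.modelRed (x b) (τ b) (g b) (d b)) = fun b =>
      -(τ b * inner ℝ (g b) (d b)) + l1 (P.c (x b)) - l1 (P.c (x b) + P.jac (x b) (d b)) := by
    funext b
    simp only [Problem.modelRed, Problem.model, map_zero, inner_zero_right, add_zero]
    ring
  rw [h]
  exact ((hτ.mul (hg.inner hd)).neg.add (measurable_l1.comp hc)).sub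
    (measurable_l1.comp (hc.add hJd))

variable {Ω₀ Ω₁ : Type*} [MeasurableSpace Ω₀] [MeasurableSpace Ω₁] {I : Input n Ω₀ Ω₁}
  {s : β → State n} {w : β → Sample n Ω₀ Ω₁} {εg κFO : ℝ}

/-- Accuracy of the gradient estimate drawn in the state `s` with the sample `w`. -/
def GradAccurateAt (P : Problem n m) (par : Params) (I : Input n Ω₀ Ω₁) (εg κFO : ℝ) (s : State n)
    (w : Sample n Ω₀ Ω₁) : Prop :=
  ‖gbar I s w - gradient P.f s.x‖ ≤ max εg (κFO * s.α *
    √(P.modelRed s.x (taubar P par I s w) (gbar I s w) (dbar P I s w)))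

/-- What is measurable in a state and a sample before the functions are estimated. -/
structure MeasurableData {n : ℕ} {Ω₀ Ω₁ β : Type*} [MeasurableSpace Ω₁] (mβ : MeasurableSpace β)
    (s : β → State n) (w : β → Sample n Ω₀ Ω₁) : Prop where
  x : Measurable fun b => (s b).x
  α : Measurable fun b => (s b).α
  τ : Measurable fun b => (s b).τ
  H : Measurable fun b => (w b).H
  ξ1 : Measurable fun b => (w b).ξ1

namespace MeasurableData

lemma gbar (h : MeasurableData mβ s w) : Measurable fun b => gbar I (s b) (w b) :=
  I.first.measurable_est.comp (h.x.prodMk h.ξ1)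

variable (hc : Measurable fun b => P.c (s b).x)

include hc

lemma dbar (h : MeasurableData mβ s w) : Measurable fun b => dbar P I (s b) (w b) :=
  measurable_dir h.x hc h.H h.gbar

lemma taubar (h : MeasurableData mβ s w) : Measurable fun b => taubar P par I (s b) (w b) :=
  measurable_tauUpdate h.x hc h.H h.gbar h.τ

lemma trial (h : MeasurableData mβ s w) : Measurable fun b => trial P I (s b) (w b) :=
  h.x.add (h.α.smul (h.dbar hc))

lemma modelRed (h : MeasurableData mβ s w) : Measurable fun b =>
    P.modelRed (s b).x (SSSQP.taubar P par I (s b) (w b)) (SSSQP.gbar I (s b) (w b))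
      (SSSQP.dbar P I (s b) (w b)) :=
  measurable_modelRed h.x hc h.gbar (h.dbar hc) (h.taubar hc)

lemma measurableSet_gradAccurateAt (h : MeasurableData mβ s w) :
    MeasurableSet {b | GradAccurateAt P par I εg κFO (s b) (w b)} := by
  refine measurableSet_le (h.gbar.sub ((measurable_gradient P.f).comp h.x)).norm ?_
  exact measurable_const.max ((measurable_const.mul h.α).mul (h.modelRed hc).sqrt)

lemma measurableSet_accept (h : MeasurableData mβ s w)
    (hct : Measurable fun b => P.c (SSSQP.trial P I (s b) (w b)))
    (hξ0 : Measurable fun b => (w b).ξ0) (hξp : Measurable fun b => (w b).ξp) :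
    MeasurableSet {b | Accept P par I (s b) (w b)} := by
  have h1 : Measurable fun b =>
      meritBar P I (SSSQP.trial P I (s b) (w b)) (SSSQP.taubar P par I (s b) (w b)) (w b).ξp :=
    ((h.taubar hc).mul (I.zeroth.measurable_est.comp ((h.trial hc).prodMk hξp))).add
      (measurable_l1.comp hct)
  have h2 : Measurable fun b =>
      meritBar P I (s b).x (SSSQP.taubar P par I (s b) (w b)) (w b).ξ0 :=
    ((h.taubar hc).mul (I.zeroth.measurable_est.comp (h.x.prodMk hξ0))).add
      (measurable_l1.comp hc)
  refine measurableSet_le h1 ((h2.sub ?_).add ?_)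
  · exact (h.α.mul measurable_const).mul (h.modelRed hc)
  · exact (measurable_const.mul (h.taubar hc)).mul measurable_const

end MeasurableData

end Measurability

/-! ### The stochastic process -/

section Sampling

variable {n m : ℕ} {Ω₀ Ω₁ Ω : Type*} [MeasurableSpace Ω₀] [MeasurableSpace Ω₁]
  {mΩ : MeasurableSpace Ω} {μ : Measure Ω} {ℱ : Filtration ℕ mΩ}
  {P : Problem n m} {par : Params} {I : Input n Ω₀ Ω₁} {W : Ω → ℕ → Sample n Ω₀ Ω₁}
  {L : ℝ} {lip : Fin m → ℝ}

lemma IsRun.measurable_state (hrun : IsRun μ ℱ P par I W) (hP : P.Regular L lip)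
    (hdom : ∀ ω k, xk P par I (W ω) k ∈ P.dom ∧ xpk P par I (W ω) k ∈ P.dom) (k : ℕ) :
    Measurable[ℱ k] (fun ω => (state P par I (W ω) k).x) ∧
    Measurable[ℱ k] (fun ω => (state P par I (W ω) k).α) ∧
    Measurable[ℱ k] (fun ω => (state P par I (W ω) k).τ) := by
  classical
  induction k with
  | zero => exact ⟨measurable_const, measurable_const, measurable_const⟩
  | succ k ih =>
    have hle := ℱ.mono (Nat.le_succ k)
    have hdata : MeasurableData (ℱ (k + 1)) (fun ω => state P par I (W ω) k)
        (fun ω => W ω k) :=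
      ⟨ih.1.mono hle le_rfl, ih.2.1.mono hle le_rfl, ih.2.2.mono hle le_rfl,
        (hrun.measurable_H k).mono hle le_rfl, hrun.measurable_ξ1 k⟩
    have hc : Measurable[ℱ (k + 1)] fun ω => P.c (state P par I (W ω) k).x :=
      measurable_comp_of_continuousOn hP.isOpen_dom hP.contDiff_c.continuousOn hdata.x
        fun ω => (hdom ω k).1
    have hct : Measurable[ℱ (k + 1)] fun ω => P.c (trial P I (state P par I (W ω) k) (W ω k)) :=
      measurable_comp_of_continuousOn hP.isOpen_dom hP.contDiff_c.continuousOn (hdata.trial hc)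
        fun ω => (hdom ω k).2
    have hA : MeasurableSet[ℱ (k + 1)] {ω | Accept P par I (state P par I (W ω) k) (W ω k)} :=
      hdata.measurableSet_accept hc hct (hrun.measurable_ξ0 k) (hrun.measurable_ξp k)
    refine ⟨?_, ?_, ?_⟩
    · have h : (fun ω => (state P par I (W ω) (k + 1)).x) = fun ω =>
          if Accept P par I (state P par I (W ω) k) (W ω k)
          then trial P I (state P par I (W ω) k) (W ω k) else (state P par I (W ω) k).x := by
        funext ω
        rw [state, step]
        split_ifs <;> rfl
      rw [h]
      exact Measurable.ite hA (hdata.trial hc) hdata.x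
    · have h : (fun ω => (state P par I (W ω) (k + 1)).α) = fun ω =>
          if Accept P par I (state P par I (W ω) k) (W ω k)
          then min par.αmax (par.γ⁻¹ * (state P par I (W ω) k).α)
          else par.γ * (state P par I (W ω) k).α := by
        funext ω
        rw [state, step]
        split_ifs <;> rfl
      rw [h]
      exact Measurable.ite hA (measurable_const.min (measurable_const.mul hdata.α))
        (measurable_const.mul hdata.α)
    · simp only [state_succ_τ]
      exact hdata.taubar hc

lemma IsRun.measurableData (hrun : IsRun μ ℱ P par I W) (hP : P.Regular L lip)
    (hdom : ∀ ω k, xk P par I (W ω) k ∈ P.dom ∧ xpk P par I (W ω) k ∈ P.dom) (k : ℕ) :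
    ∀ m' : MeasurableSpace Ω, ℱ k ≤ m' → Measurable[m'] (fun ω => (W ω k).ξ1) →
      MeasurableData m' (fun ω => state P par I (W ω) k) (fun ω => W ω k) := by
  obtain ⟨h1, h2, h3⟩ := hrun.measurable_state hP hdom k
  have h4 := hrun.measurable_H k
  intro m' hm hξ
  exact ⟨h1.mono hm le_rfl, h2.mono hm le_rfl, h3.mono hm le_rfl, h4.mono hm le_rfl, hξ⟩

lemma IsRun.measurable_query (hrun : IsRun μ ℱ P par I W) (hP : P.Regular L lip)
    (hdom : ∀ ω k, xk P par I (W ω) k ∈ P.dom ∧ xpk P par I (W ω) k ∈ P.dom) (k : ℕ) :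
    Measurable[ℱ k] fun ω => query P par I (W ω) k := by
  obtain ⟨h1, h2, h3⟩ := hrun.measurable_state hP hdom k
  exact h1.prodMk (h2.prodMk (h3.prodMk (hrun.measurable_H k)))

variable [IsProbabilityMeasure μ] {εg κFO δ ν b : ℝ}

/-- Given the past, the gradient estimate is inaccurate with probability at most `δ`. -/
lemma IsRun.lintegral_not_gradAccurate_le (hrun : IsRun μ ℱ P par I W) (hP : P.Regular L lip)
    (hdom : ∀ ω k, xk P par I (W ω) k ∈ P.dom ∧ xpk P par I (W ω) k ∈ P.dom)
    (hfirst : ∀ ω k, I.first.ValidAt P par εg κFO δ (query P par I (W ω) k)) (k : ℕ)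
    {Y : Ω → ℝ≥0∞} (hY : Measurable[ℱ k] Y) :
    ∫⁻ ω, Y ω * {ω | ¬GradAccurate P par I εg κFO (W ω) k}.indicator 1 ω ∂μ
      ≤ ENNReal.ofReal δ * ∫⁻ ω, Y ω ∂μ := by
  have := I.first.markov
  obtain ⟨h1, h2, h3⟩ := hrun.measurable_state hP hdom k
  -- the state of iteration `k`, with an independent variable for the gradient sample
  have hfst := @measurable_fst Ω Ω₁ (ℱ k) inferInstance
  have hdata : MeasurableData ((ℱ k).prod inferInstance)
      (fun z => state P par I (W z.1) k) (fun z => { W z.1 k with ξ1 := z.2 }) :=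
    ⟨h1.comp hfst, h2.comp hfst, h3.comp hfst, (hrun.measurable_H k).comp hfst,
      @measurable_snd Ω Ω₁ (ℱ k) inferInstance⟩
  have hc : Measurable[(ℱ k).prod inferInstance]
      fun z : Ω × Ω₁ => P.c (state P par I (W z.1) k).x :=
    measurable_comp_of_continuousOn hP.isOpen_dom hP.contDiff_c.continuousOn hdata.x
      fun z => (hdom z.1 k).1
  have hset := hdata.measurableSet_gradAccurateAt (P := P) (par := par) (I := I) (εg := εg)
    (κFO := κFO) hc
  have h := lintegral_mul_of_condLaw (μ := μ) (ℱ.le k) (hrun.measurable_query hP hdom k)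
    ((hrun.measurable_ξ1 k).mono (ℱ.le (k + 1)) le_rfl) (hrun.law_ξ1 k) hY
    (Measurable.indicator (f := (1 : Ω × Ω₁ → ℝ≥0∞)) measurable_const hset.compl)
  have hl : ∀ ω, {ω | ¬GradAccurate P par I εg κFO (W ω) k}.indicator (1 : Ω → ℝ≥0∞) ω
      = ({z : Ω × Ω₁ | GradAccurateAt P par I εg κFO (state P par I (W z.1) k)
          { W z.1 k with ξ1 := z.2 }}ᶜ).indicator 1 (ω, (W ω k).ξ1) := fun ω => rfl
  simp only [hl]
  rw [h, mul_comm, ← lintegral_mul_const' _ _ ENNReal.ofReal_ne_top]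
  refine lintegral_mono fun ω => ?_
  gcongr
  have hsec : MeasurableSet {ξ : Ω₁ | GradAccurateAt P par I εg κFO (state P par I (W ω) k)
      { W ω k with ξ1 := ξ }} := @measurable_prodMk_left Ω Ω₁ (ℱ k) inferInstance ω _ hset
  have hv : 1 - δ ≤ (I.first.law (query P par I (W ω) k)).real
      {ξ : Ω₁ | GradAccurateAt P par I εg κFO (state P par I (W ω) k)
        { W ω k with ξ1 := ξ }} := hfirst ω k
  have hint : ∫⁻ ξ, ({z : Ω × Ω₁ | GradAccurateAt P par I εg κFO (state P par I (W z.1) k)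
      { W z.1 k with ξ1 := z.2 }}ᶜ).indicator (1 : Ω × Ω₁ → ℝ≥0∞) (ω, ξ)
        ∂(I.first.law (query P par I (W ω) k))
      = I.first.law (query P par I (W ω) k)
        {ξ : Ω₁ | GradAccurateAt P par I εg κFO (state P par I (W ω) k)
          { W ω k with ξ1 := ξ }}ᶜ := by
    rw [← lintegral_indicator_one hsec.compl]
    rfl
  rw [hint, ← ofReal_measureReal, probReal_compl_eq_one_sub hsec]
  exact ENNReal.ofReal_le_ofReal (by linarith)

/-- Given the past, the sum of the two function errors, centred at twice an upper bound `a` of the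
mean error, is sub-exponential. The two errors need not be independent of each other: by convexity
the exponential of half their sum is at most the mean of the exponentials. -/
lemma IsRun.lintegral_exp_noise_le (hrun : IsRun μ ℱ P par I W) (hP : P.Regular L lip)
    (hdom : ∀ ω k, xk P par I (W ω) k ∈ P.dom ∧ xpk P par I (W ω) k ∈ P.dom)
    (hzeroth : ∀ x ∈ P.dom, I.zeroth.ValidAt P I.εf ν b x) {a r : ℝ}
    (ha : ∀ x ∈ P.dom, ∫ ξ, I.zeroth.err P x ξ ∂(I.zeroth.law x) ≤ a) (hr : 0 ≤ r)
    (hrb : r * b ≤ 1) (k : ℕ) {Y : Ω → ℝ≥0∞} (hY : Measurable[ℱ k] Y) :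
    ∫⁻ ω, Y ω * ENNReal.ofReal (Real.exp
        (r / 2 * (ek P par I (W ω) k + epk P par I (W ω) k - 2 * a))) ∂μ
      ≤ ENNReal.ofReal (Real.exp (r ^ 2 * ν ^ 2 / 2)) * ∫⁻ ω, Y ω ∂μ := by
  have := I.zeroth.markov
  have key : ∀ (m' : MeasurableSpace Ω) (hm : m' ≤ mΩ) (X : Ω → Vec n) (ξ : Ω → Ω₀),
      Measurable[m'] X → (∀ ω, X ω ∈ P.dom) → Measurable[mΩ] ξ →
      (∀ S, MeasurableSet S → μ⟦ξ ⁻¹' S | m'⟧ =ᵐ[μ] fun ω => (I.zeroth.law (X ω)).real S) →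
      Measurable[m'] Y →
      ∫⁻ ω, Y ω * ENNReal.ofReal (Real.exp (r * (I.zeroth.err P (X ω) (ξ ω) - a))) ∂μ
        ≤ ENNReal.ofReal (Real.exp (r ^ 2 * ν ^ 2 / 2)) * ∫⁻ ω, Y ω ∂μ := by
    intro m' hm X ξ hX hXdom hξ hlaw hY'
    have hfst := @measurable_fst Ω Ω₀ m' inferInstance
    have hf : Measurable[m'.prod inferInstance] fun z : Ω × Ω₀ => P.f (X z.1) :=
      measurable_comp_of_continuousOn hP.isOpen_dom hP.contDiff_f.continuousOn (hX.comp hfst)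
        fun z => hXdom z.1
    have herr : Measurable[m'.prod inferInstance] fun z : Ω × Ω₀ => I.zeroth.err P (X z.1) z.2 :=
      ((I.zeroth.measurable_est.comp
        ((hX.comp hfst).prodMk (@measurable_snd Ω Ω₀ m' inferInstance))).sub hf).abs
    have h := lintegral_mul_of_condLaw (μ := μ) hm hX hξ hlaw hY'
      (g := fun z => ENNReal.ofReal (Real.exp (r * (I.zeroth.err P (X z.1) z.2 - a))))
      ((measurable_const.mul (herr.sub measurable_const)).exp).ennreal_ofReal
    rw [h, mul_comm, ← lintegral_mul_const' _ _ ENNReal.ofReal_ne_top]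
    refine lintegral_mono fun ω => ?_
    gcongr
    refine le_trans (lintegral_mono fun ξ => ?_) ((hzeroth _ (hXdom ω)).2.2 r hr hrb)
    gcongr
    exact ha _ (hXdom ω)
  have hYm : Measurable Y := hY.mono (ℱ.le k) le_rfl
  have hekm : Measurable fun ω => ek P par I (W ω) k := by
    have hx : Measurable fun ω => xk P par I (W ω) k :=
      (hrun.measurable_state hP hdom k).1.mono (ℱ.le k) le_rfl
    exact ((I.zeroth.measurable_est.comp
      (hx.prodMk ((hrun.measurable_ξ0 k).mono (ℱ.le (k + 1)) le_rfl))).sub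
      (measurable_comp_of_continuousOn hP.isOpen_dom hP.contDiff_f.continuousOn hx
        fun ω => (hdom ω k).1)).abs
  have hm1 : ℱ k ⊔ MeasurableSpace.comap (fun ω => (W ω k).ξ1) inferInstance ≤ mΩ :=
    sup_le (ℱ.le k) ((hrun.measurable_ξ1 k).mono (ℱ.le (k + 1)) le_rfl).comap_le
  have hdata := hrun.measurableData hP hdom k _ le_sup_left
    (measurable_iff_comap_le.2 (le_sup_right (a := ℱ k)))
  have hc : Measurable[ℱ k ⊔ MeasurableSpace.comap (fun ω => (W ω k).ξ1) inferInstance] fun ω => P.c (state P par I (W ω) k).x :=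
    measurable_comp_of_continuousOn hP.isOpen_dom hP.contDiff_c.continuousOn hdata.x
      fun ω => (hdom ω k).1
  have h0 := key (ℱ k) (ℱ.le k) (fun ω => xk P par I (W ω) k) (fun ω => (W ω k).ξ0)
    (hrun.measurable_state hP hdom k).1 (fun ω => (hdom ω k).1)
    ((hrun.measurable_ξ0 k).mono (ℱ.le (k + 1)) le_rfl) (hrun.law_ξ0 k) hY
  have h1 := key _ hm1 (fun ω => xpk P par I (W ω) k) (fun ω => (W ω k).ξp)
    (hdata.trial hc) (fun ω => (hdom ω k).2)
    ((hrun.measurable_ξp k).mono (ℱ.le (k + 1)) le_rfl) (hrun.law_ξp k)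
    (hY.mono le_sup_left le_rfl)
  have hpt : ∀ ω, Y ω * ENNReal.ofReal (Real.exp
        (r / 2 * (ek P par I (W ω) k + epk P par I (W ω) k - 2 * a)))
      ≤ ENNReal.ofReal (1 / 2) *
        (Y ω * ENNReal.ofReal (Real.exp (r * (ek P par I (W ω) k - a)))
          + Y ω * ENNReal.ofReal (Real.exp (r * (epk P par I (W ω) k - a)))) := by
    intro ω
    rw [← mul_add, ← ENNReal.ofReal_add (Real.exp_pos _).le (Real.exp_pos _).le, mul_left_comm,
      ← ENNReal.ofReal_mul (by norm_num)]
    gcongr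
    have e1 : r / 2 * (ek P par I (W ω) k + epk P par I (W ω) k - 2 * a)
        = r * (ek P par I (W ω) k - a) / 2 + r * (epk P par I (W ω) k - a) / 2 := by ring
    have e2 : ∀ z : ℝ, Real.exp z = Real.exp (z / 2) ^ 2 := fun z => by
      rw [← Real.exp_nat_mul]; congr 1; push_cast; ring
    rw [e1, Real.exp_add, e2 (r * (ek P par I (W ω) k - a)), e2 (r * (epk P par I (W ω) k - a))]
    linarith [sq_nonneg (Real.exp (r * (ek P par I (W ω) k - a) / 2)
      - Real.exp (r * (epk P par I (W ω) k - a) / 2))]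
  calc _ ≤ ∫⁻ ω, ENNReal.ofReal (1 / 2) *
        (Y ω * ENNReal.ofReal (Real.exp (r * (ek P par I (W ω) k - a)))
          + Y ω * ENNReal.ofReal (Real.exp (r * (epk P par I (W ω) k - a)))) ∂μ :=
        lintegral_mono hpt
    _ = ENNReal.ofReal (1 / 2) *
        (∫⁻ ω, Y ω * ENNReal.ofReal (Real.exp (r * (ek P par I (W ω) k - a))) ∂μ
          + ∫⁻ ω, Y ω * ENNReal.ofReal (Real.exp (r * (epk P par I (W ω) k - a))) ∂μ) := by
        rw [lintegral_const_mul' _ _ ENNReal.ofReal_ne_top, lintegral_add_left]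
        exact hYm.mul
          ((measurable_const.mul (hekm.sub measurable_const)).exp).ennreal_ofReal
    _ ≤ ENNReal.ofReal (1 / 2) *
        (ENNReal.ofReal (Real.exp (r ^ 2 * ν ^ 2 / 2)) * ∫⁻ ω, Y ω ∂μ
          + ENNReal.ofReal (Real.exp (r ^ 2 * ν ^ 2 / 2)) * ∫⁻ ω, Y ω ∂μ) := by
        gcongr
        · exact h0
        · exact h1
    _ = _ := by
        rw [← two_mul, ← mul_assoc, show (2 : ℝ≥0∞) = ENNReal.ofReal 2 by simp,
          ← ENNReal.ofReal_mul (by norm_num)]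
        norm_num

end Sampling

/-! ### Tail bounds for the algorithm -/

section Tails

variable {n m : ℕ} {Ω₀ Ω₁ Ω : Type*} [MeasurableSpace Ω₀] [MeasurableSpace Ω₁]
  {mΩ : MeasurableSpace Ω} {μ : Measure Ω} {ℱ : Filtration ℕ mΩ}
  {P : Problem n m} {par : Params} {I : Input n Ω₀ Ω₁} {W : Ω → ℕ → Sample n Ω₀ Ω₁}
  {L : ℝ} {lip : Fin m → ℝ} {εg κFO δ ν b p : ℝ}

lemma IsRun.measurableSet_gradAccurate (hrun : IsRun μ ℱ P par I W) (hP : P.Regular L lip)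
    (hdom : ∀ ω k, xk P par I (W ω) k ∈ P.dom ∧ xpk P par I (W ω) k ∈ P.dom) (k : ℕ) :
    MeasurableSet[ℱ (k + 1)] {ω | GradAccurate P par I εg κFO (W ω) k} := by
  have hdata := hrun.measurableData hP hdom k _ (ℱ.mono (Nat.le_succ k)) (hrun.measurable_ξ1 k)
  have hc : Measurable[ℱ (k + 1)] fun ω => P.c (state P par I (W ω) k).x :=
    measurable_comp_of_continuousOn hP.isOpen_dom hP.contDiff_c.continuousOn hdata.x
      fun ω => (hdom ω k).1
  exact hdata.measurableSet_gradAccurateAt hc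

lemma IsRun.measurable_noise (hrun : IsRun μ ℱ P par I W) (hP : P.Regular L lip)
    (hdom : ∀ ω k, xk P par I (W ω) k ∈ P.dom ∧ xpk P par I (W ω) k ∈ P.dom) (k : ℕ) :
    Measurable[ℱ (k + 1)] fun ω => ek P par I (W ω) k + epk P par I (W ω) k := by
  have hdata := hrun.measurableData hP hdom k _ (ℱ.mono (Nat.le_succ k)) (hrun.measurable_ξ1 k)
  have hc : Measurable[ℱ (k + 1)] fun ω => P.c (state P par I (W ω) k).x :=
    measurable_comp_of_continuousOn hP.isOpen_dom hP.contDiff_c.continuousOn hdata.x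
      fun ω => (hdom ω k).1
  have herr : ∀ (X : Ω → Vec n) (ξ : Ω → Ω₀), Measurable[ℱ (k + 1)] X → Measurable[ℱ (k + 1)] ξ →
      (∀ ω, X ω ∈ P.dom) → Measurable[ℱ (k + 1)] fun ω => I.zeroth.err P (X ω) (ξ ω) := by
    intro X ξ hX hξ hXdom
    have hf : Measurable[ℱ (k + 1)] fun ω => P.f (X ω) :=
      measurable_comp_of_continuousOn hP.isOpen_dom hP.contDiff_f.continuousOn hX hXdom
    have he : Measurable[ℱ (k + 1)] fun ω => I.zeroth.est (X ω) (ξ ω) :=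
      I.zeroth.measurable_est.comp (hX.prodMk hξ)
    exact (continuous_abs.measurable).comp (he.sub hf)
  exact (herr _ _ hdata.x (hrun.measurable_ξ0 k) fun ω => (hdom ω k).1).add
    (herr _ _ (hdata.trial hc) (hrun.measurable_ξp k) fun ω => (hdom ω k).2)

lemma noiseGap_nonneg (hzeroth : ∀ x ∈ P.dom, I.zeroth.ValidAt P I.εf ν b x) :
    0 ≤ noiseGap P I := by
  refine Real.sInf_nonneg ?_
  rintro _ ⟨x, hx, rfl⟩
  exact sub_nonneg.2 (hzeroth x hx).2.1

lemma integral_err_le (hzeroth : ∀ x ∈ P.dom, I.zeroth.ValidAt P I.εf ν b x) {x : Vec n}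
    (hx : x ∈ P.dom) :
    ∫ ξ, I.zeroth.err P x ξ ∂(I.zeroth.law x) ≤ I.εf - noiseGap P I := by
  have h : noiseGap P I ≤ I.εf - ∫ ξ, I.zeroth.err P x ξ ∂(I.zeroth.law x) := by
    refine csInf_le ⟨0, ?_⟩ ⟨x, hx, rfl⟩
    rintro _ ⟨x, hx, rfl⟩
    exact sub_nonneg.2 (hzeroth x hx).2.1
  linarith

variable [IsProbabilityMeasure μ]

/-- Given the past, the errors of the two function estimates add up to more than `2 εf` with at most
the probability of a sub-exponential deviation by the gap between `εf` and the mean error. -/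
lemma IsRun.lintegral_noise_gt_le (hrun : IsRun μ ℱ P par I W) (hP : P.Regular L lip)
    (hdom : ∀ ω k, xk P par I (W ω) k ∈ P.dom ∧ xpk P par I (W ω) k ∈ P.dom)
    (hν : 0 ≤ ν) (hb : 0 ≤ b) (hzeroth : ∀ x ∈ P.dom, I.zeroth.ValidAt P I.εf ν b x) (k : ℕ)
    {Y : Ω → ℝ≥0∞} (hY : Measurable[ℱ k] Y) (hYtop : ∫⁻ ω, Y ω ∂μ ≠ ⊤) :
    ∫⁻ ω, Y ω * {ω | 2 * I.εf < ek P par I (W ω) k + epk P par I (W ω) k}.indicator 1 ω ∂μ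
      ≤ ENNReal.ofReal (expNeg (bernsteinRate (noiseGap P I) ν b)) * ∫⁻ ω, Y ω ∂μ := by
  obtain ⟨u, hu⟩ : ∃ u, u = noiseGap P I := ⟨_, rfl⟩
  rw [← hu]
  refine le_ofReal_expNeg_bernsteinRate_mul hYtop (hu ▸ noiseGap_nonneg hzeroth) hν hb
    fun r hr hrb => ?_
  have h := hrun.lintegral_exp_noise_le hP hdom hzeroth (a := I.εf - u)
    (fun x hx => hu ▸ integral_err_le hzeroth hx) hr hrb k hY
  rw [Real.exp_add, ENNReal.ofReal_mul (Real.exp_pos _).le, mul_assoc]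
  refine le_trans ?_ (mul_le_mul_right h _)
  rw [← lintegral_const_mul' _ _ ENNReal.ofReal_ne_top]
  refine lintegral_mono fun ω => ?_
  rw [mul_left_comm, ← ENNReal.ofReal_mul (Real.exp_pos _).le, ← Real.exp_add]
  gcongr
  by_cases hω : 2 * I.εf < ek P par I (W ω) k + epk P par I (W ω) k
  · rw [Set.indicator_of_mem (s := {ω | 2 * I.εf < ek P par I (W ω) k + epk P par I (W ω) k}) hω,
      Pi.one_apply, ENNReal.one_le_ofReal, Real.one_le_exp_iff]
    have := mul_nonneg hr (sub_nonneg.2 hω.le)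
    linarith
  · rw [Set.indicator_of_notMem
      (s := {ω | 2 * I.εf < ek P par I (W ω) k + epk P par I (W ω) k}) hω]
    exact zero_le

/-- The two values of the probability `p` of a favourable iteration: errors bounded by `εf` never
spoil an iteration, and sub-exponential errors do so with the Bernstein probability of a deviation
by `noiseGap`. -/
def NoiseRegime (P : Problem n m) (par : Params) (I : Input n Ω₀ Ω₁)
    (W : Ω → ℕ → Sample n Ω₀ Ω₁) (δ ν b p : ℝ) : Prop :=
  (BoundedNoise P par I W ∧ p = 1 - δ) ∨
    p = 1 - δ - expNeg (bernsteinRate (noiseGap P I) ν b)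

/-- Given the past, an iteration fails to be favourable with probability at most `1 - p`. -/
lemma IsRun.lintegral_not_favourable_le (hrun : IsRun μ ℱ P par I W) (hP : P.Regular L lip)
    (hdom : ∀ ω k, xk P par I (W ω) k ∈ P.dom ∧ xpk P par I (W ω) k ∈ P.dom)
    (hδ : 0 ≤ δ) (hν : 0 ≤ ν) (hb : 0 ≤ b) (hzeroth : ∀ x ∈ P.dom, I.zeroth.ValidAt P I.εf ν b x)
    (hfirst : ∀ ω k, I.first.ValidAt P par εg κFO δ (query P par I (W ω) k))
    (hp : NoiseRegime P par I W δ ν b p) (k : ℕ)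
    {Y : Ω → ℝ≥0∞} (hY : Measurable[ℱ k] Y) (hYtop : ∫⁻ ω, Y ω ∂μ ≠ ⊤) :
    ∫⁻ ω, Y ω * {ω | ¬Favourable P par I εg κFO (W ω) k}.indicator 1 ω ∂μ
      ≤ ENNReal.ofReal (1 - p) * ∫⁻ ω, Y ω ∂μ := by
  have hgrad := hrun.lintegral_not_gradAccurate_le hP hdom hfirst k hY
  rcases hp with ⟨hbd, rfl⟩ | rfl
  · rw [sub_sub_cancel]
    refine le_trans (le_of_eq ?_) hgrad
    have hset : {ω | ¬Favourable P par I εg κFO (W ω) k}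
        = {ω | ¬GradAccurate P par I εg κFO (W ω) k} := by
      ext ω
      have h : ek P par I (W ω) k + epk P par I (W ω) k ≤ 2 * I.εf := by
        linarith [(hbd ω k).1, (hbd ω k).2]
      simp only [Set.mem_ofPred_eq, Favourable, h, and_true]
    rw [hset]
  · have hnoise := hrun.lintegral_noise_gt_le hP hdom hν hb hzeroth k hY hYtop
    rw [show 1 - (1 - δ - expNeg (bernsteinRate (noiseGap P I) ν b))
        = δ + expNeg (bernsteinRate (noiseGap P I) ν b) by ring,
      ENNReal.ofReal_add hδ (expNeg_nonneg _), add_mul]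
    refine le_trans ?_ (add_le_add hgrad hnoise)
    have hYm : Measurable Y := hY.mono (ℱ.le k) le_rfl
    have hS : MeasurableSet {ω | ¬GradAccurate P par I εg κFO (W ω) k} :=
      (ℱ.le (k + 1) _ (hrun.measurableSet_gradAccurate hP hdom k)).compl
    rw [← lintegral_add_left (f := fun ω => Y ω *
      {ω | ¬GradAccurate P par I εg κFO (W ω) k}.indicator 1 ω)
      (hYm.mul (measurable_one.indicator hS))]
    refine lintegral_mono fun ω => ?_
    rw [← mul_add]
    gcongr
    by_cases h1 : GradAccurate P par I εg κFO (W ω) k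
    · by_cases h2 : ek P par I (W ω) k + epk P par I (W ω) k ≤ 2 * I.εf
      · rw [Set.indicator_of_notMem (s := {ω | ¬Favourable P par I εg κFO (W ω) k})
          fun h => h ⟨h1, h2⟩]
        exact zero_le
      · rw [Set.indicator_of_mem 
          (s := {ω | 2 * I.εf < ek P par I (W ω) k + epk P par I (W ω) k}) (not_le.1 h2)]
        exact le_add_left (Set.indicator_le_self _ _ _)
    · rw [Set.indicator_of_mem (s := {ω | ¬GradAccurate P par I εg κFO (W ω) k}) h1]
      exact le_add_right (Set.indicator_le_self _ _ _)

lemma IsRun.measureReal_count_le (hrun : IsRun μ ℱ P par I W) (hP : P.Regular L lip)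
    (hdom : ∀ ω k, xk P par I (W ω) k ∈ P.dom ∧ xpk P par I (W ω) k ∈ P.dom)
    (hδ : 0 ≤ δ) (hν : 0 ≤ ν) (hb : 0 ≤ b) (hzeroth : ∀ x ∈ P.dom, I.zeroth.ValidAt P I.εf ν b x)
    (hfirst : ∀ ω k, I.first.ValidAt P par εg κFO δ (query P par I (W ω) k))
    (hp : NoiseRegime P par I W δ ν b p) (hp2 : 1 / 2 < p) {pHat : ℝ} (hpHat : pHat ≤ p) (t : ℕ) :
    μ.real {ω | (count (Favourable P par I εg κFO (W ω)) t : ℝ) ≤ pHat * t}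
      ≤ Real.exp (-((p - pHat) ^ 2 / (2 * p ^ 2) * t)) := by
  have hp1 : p ≤ 1 := by
    rcases hp with ⟨-, rfl⟩ | rfl
    · linarith
    · linarith [expNeg_nonneg (bernsteinRate (noiseGap P I) ν b)]
  have hS : ∀ k, MeasurableSet[ℱ (k + 1)] {ω | Favourable P par I εg κFO (W ω) k} := fun k =>
    (hrun.measurableSet_gradAccurate hP hdom k).inter
      (measurableSet_le (hrun.measurable_noise hP hdom k) measurable_const)
  have h := measure_count_le (μ := μ) hp2 hp1 hpHat hS (fun k Y hY hYtop =>
    hrun.lintegral_not_favourable_le hP hdom hδ hν hb hzeroth hfirst hp k hY hYtop) t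
  exact ENNReal.toReal_le_of_le_ofReal (Real.exp_pos _).le h

/-- Upper tail of the total noise. The sum `e_k + e_k⁺` times `τ̄₋₁` has conditional sub-exponential
parameters `2 τ̄₋₁ ν` and `2 τ̄₋₁ b`. -/
lemma IsRun.measureReal_noise_gt_le (hrun : IsRun μ ℱ P par I W) (hP : P.Regular L lip)
    (hdom : ∀ ω k, xk P par I (W ω) k ∈ P.dom ∧ xpk P par I (W ω) k ∈ P.dom)
    (hτ : 0 < par.τinit) (hν : 0 ≤ ν) (hb : 0 ≤ b)
    (hzeroth : ∀ x ∈ P.dom, I.zeroth.ValidAt P I.εf ν b x) {s : ℝ} (hs : 0 ≤ s) (t : ℕ) :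
    μ.real {ω | (2 * I.εf + s / par.τinit) * t
        < ∑ k ∈ Finset.range t, (ek P par I (W ω) k + epk P par I (W ω) k)}
      ≤ expNeg (bernsteinRate s (2 * par.τinit * ν) (2 * par.τinit * b) * (t : ℝ≥0∞)) := by
  refine le_expNeg_bernsteinRate hs (by positivity) (by positivity) t fun r hr hrb => ?_
  have hr' : 0 ≤ 2 * par.τinit * r := by positivity
  have h := measure_sum_gt_le (μ := μ) (E := fun k ω => ek P par I (W ω) k + epk P par I (W ω) k)
    (r := par.τinit * r) (a := 2 * I.εf) (v := s / par.τinit)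
    (c := (2 * par.τinit * r) ^ 2 * ν ^ 2 / 2) (by positivity)
    (fun k => hrun.measurable_noise hP hdom k)
    (fun k Y hY _ => by
      have h := hrun.lintegral_exp_noise_le hP hdom hzeroth (a := I.εf)
        (fun x hx => (hzeroth x hx).2.1) hr' (by linarith) k hY
      rwa [show 2 * par.τinit * r / 2 = par.τinit * r by ring] at h) t
  refine (ENNReal.toReal_le_of_le_ofReal (Real.exp_pos _).le h).trans (le_of_eq ?_)
  congr 2
  field_simp

end Tails

/-! ### The stopping time -/

section StopTime

variable {n m : ℕ} {Ω₀ Ω₁ : Type*} [MeasurableSpace Ω₀] [MeasurableSpace Ω₁] {P : Problem n m}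
  {par : Params} {I : Input n Ω₀ Ω₁} {w : ℕ → Sample n Ω₀ Ω₁} {e : ℝ}

lemma stopTime_le {k t : ℕ} (hk : √(redk P par I w k) ≤ e) (hkt : k ≤ t) :
    stopTime P par I w e ≤ (t : ℕ∞) :=
  (iInf₂_le k hk).trans (by exact_mod_cast hkt)

lemma sqrt_redk_le_of_stopTime_eq {k : ℕ} (h : stopTime P par I w e = (k : ℕ∞)) :
    √(redk P par I w k) ≤ e := by
  have hlt : stopTime P par I w e < ((k + 1 : ℕ) : ℕ∞) := by
    rw [h]; exact_mod_cast Nat.lt_succ_self k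
  obtain ⟨j, hj⟩ := iInf_lt_iff.1 hlt
  obtain ⟨hje, hj⟩ := iInf_lt_iff.1 hj
  have hle : k ≤ j := by
    have := stopTime_le hje le_rfl
    rw [h] at this
    exact_mod_cast this
  have hjk : j < k + 1 := by exact_mod_cast hj
  obtain rfl : j = k := by omega
  exact hje

end StopTime

/-! ### The accuracy -/

namespace Constants

variable {C : Constants} {ε εg εf : ℝ}

lemma Accuracy.pos (h : C.Accuracy εg εf ε) (hC : C.Valid) : 0 < ε := by
  refine lt_of_le_of_lt (mul_nonneg (le_max_of_le_right ?_) hC.scale_pos.le) h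
  exact mul_nonneg (mul_nonneg (Real.sqrt_nonneg _) (Real.sqrt_nonneg _)) (Real.sqrt_nonneg _)

lemma Accuracy.le_η_mul_εΔ (h : C.Accuracy εg εf ε) (hC : C.Valid) (hη : 0 < C.η) :
    εg ≤ C.η * C.εΔ ε := by
  have h1 : εg / C.η * C.scale < ε :=
    lt_of_le_of_lt (mul_le_mul_of_nonneg_right (le_max_left _ _) hC.scale_pos.le) h
  have h2 := ((lt_div_iff₀ hC.scale_pos).2 h1).le
  rwa [div_le_iff₀' hη] at h2

lemma Valid.Rhat_eq (hC : C.Valid) (gap : ℝ) :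
    C.Rhat gap ε = max (C.κH ^ 2) 1 / (C.κl * C.τmin) *
        (gap / (C.αtilde * C.θ * C.ωp * ε ^ 2)) +
      max ((Real.log C.αtilde - Real.log C.α0) / (2 * Real.log C.γ)) 0 := by
  have hl := hC.κl_pos
  have hm := hC.τmin_pos
  have hmax : (max C.κH 1) ^ 2 = max (C.κH ^ 2) 1 := by
    rcases le_total C.κH 1 with h | h
    · rw [max_eq_right h, max_eq_right (pow_le_one₀ hC.κH_pos.le h), one_pow]
    · rw [max_eq_left h, max_eq_left (one_le_pow₀ h)]
  have hscale : C.scale ^ 2 = max (C.κH ^ 2) 1 / (C.κl * C.τmin) := by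
    rw [scale, div_pow, Real.sq_sqrt (by positivity), hmax]
  rw [Rhat, progress, εΔ, div_pow, ← hscale, mul_div_assoc', ← mul_div_assoc, div_div_eq_mul_div,
    mul_comm gap]

end Constants

end SSSQP

theorem mainTheorem2
    {n m : ℕ} (P : SSSQP.Problem n m) (par : SSSQP.Params)
    (L : ℝ) (lip : Fin m → ℝ) (κH ζ τbmin : ℝ)
    (hP : P.Regular L lip) (hpar : par.Valid)
    (hκH : 0 < κH) (hζ : 0 < ζ) (hτbmin : 0 < τbmin) :
    ∃ κy₀ κl₀ τmin₀ : ℝ, 0 < κy₀ ∧ 0 < κl₀ ∧ 0 < τmin₀ ∧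
      ∀ κy κl τmin : ℝ, κy₀ ≤ κy → 0 < κl → κl ≤ κl₀ → 0 < τmin → τmin ≤ τmin₀ →
      ∀ {Ω Ω₀ Ω₁ : Type*} [mΩ : MeasurableSpace Ω] [MeasurableSpace Ω₀] [MeasurableSpace Ω₁]
        (μ : MeasureTheory.Measure Ω) [MeasureTheory.IsProbabilityMeasure μ]
        (ℱ : MeasureTheory.Filtration ℕ mΩ)
        (I : SSSQP.Input n Ω₀ Ω₁) (W : Ω → ℕ → SSSQP.Sample n Ω₀ Ω₁),
      -- the algorithm, and the assumptions on its realizations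
      SSSQP.IsRun μ ℱ P par I W →
      (∀ ω k, SSSQP.xk P par I (W ω) k ∈ P.dom ∧ SSSQP.xpk P par I (W ω) k ∈ P.dom) →
      (∀ ω k, P.HAdmissible κH ζ (SSSQP.xk P par I (W ω) k) (W ω k).H) →
      (∀ ω k, τbmin ≤ SSSQP.taubark P par I (W ω) k) →
      -- the constants satisfy the bounds that define them
      (∀ ω k, ‖SSSQP.yk P par I (W ω) k‖ ≤ κy ∧ τmin ≤ SSSQP.tauk P par I (W ω) k ∧
        κl * SSSQP.taubark P par I (W ω) k *
            (‖SSSQP.dbark P par I (W ω) k‖ ^ 2 + ‖P.c (SSSQP.xk P par I (W ω) k)‖)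
          ≤ SSSQP.redbark P par I (W ω) k ∧
        κl * SSSQP.tauk P par I (W ω) k *
            (‖SSSQP.dk P par I (W ω) k‖ ^ 2 + ‖P.c (SSSQP.xk P par I (W ω) k)‖)
          ≤ SSSQP.redk P par I (W ω) k) ∧
      -- the complexity bound
      ∀ εg κFO δ ν b p η ε finf φmin : ℝ,
        0 ≤ I.εf → 0 ≤ εg → 0 ≤ κFO → 0 ≤ δ → δ < 1 / 2 → 0 ≤ ν → 0 ≤ b →
        (∀ x ∈ P.dom, I.zeroth.ValidAt P I.εf ν b x) →
        (∀ ω k, I.first.ValidAt P par εg κFO δ (SSSQP.query P par I (W ω) k)) →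
        ((SSSQP.BoundedNoise P par I W ∧ p = 1 - δ) ∨
          (SSSQP.IndepNoise μ P par I W ∧
            p = 1 - δ - SSSQP.expNeg (SSSQP.bernsteinRate (SSSQP.noiseGap P I) ν b))) →
        1 / 2 < p →
        (∀ x ∈ P.dom, finf ≤ P.f x) →
        (∀ x ∈ P.dom, φmin ≤ P.merit x τbmin) →
        let C : SSSQP.Constants :=
          { toParams := par, L := L, Γ := ∑ i, lip i, κH := κH, ζ := ζ, κy := κy, κl := κl,
            τmin := τmin, τbmin := τbmin, κFO := κFO, η := η, p := p }
        let gap : ℝ := P.merit I.x0 par.τinit - φmin - (par.τinit - τbmin) * finf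
        let εΔ : ℝ := C.εΔ ε
        C.ηAdmissible → C.Accuracy εg I.εf ε →
        -- the first iterate with `√Δl ≤ ε_Δl` is `ε`-stationary
        (∀ (ω : Ω) (k : ℕ), SSSQP.stopTime P par I (W ω) εΔ = (k : ℕ∞) →
          max ‖gradient P.f (SSSQP.xk P par I (W ω) k) +
                P.jacT (SSSQP.xk P par I (W ω) k) (SSSQP.yk P par I (W ω) k)‖
              (√‖P.c (SSSQP.xk P par I (W ω) k)‖) ≤ ε) ∧
        -- the two forms of `R̂` agree
        C.Rhat gap ε = max (κH ^ 2) 1 / (κl * τmin) * (gap / (C.αtilde * par.θ * C.ωp * ε ^ 2)) +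
          max ((Real.log C.αtilde - Real.log par.α0) / (2 * Real.log par.γ)) 0 ∧
        -- the high-probability bound
        ∀ s pHat : ℝ, ∀ t : ℕ, 0 ≤ s →
          pHat ∈ Set.Ioo
            (1 / 2 + (4 * par.τinit * I.εf + s) / (C.αtilde * par.θ * C.ωp * εΔ ^ 2)) p →
          C.Rhat gap ε /
              (pHat - 1 / 2 - (4 * par.τinit * I.εf + s) / (C.αtilde * par.θ * C.ωp * εΔ ^ 2))
            ≤ (t : ℝ) →
          1 - Real.exp (-((p - pHat) ^ 2 / (2 * p ^ 2) * t))
              - SSSQP.expNeg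
                (SSSQP.bernsteinRate s (2 * par.τinit * ν) (2 * par.τinit * b) * (t : ℝ≥0∞))
            ≤ μ.real {ω | SSSQP.stopTime P par I (W ω) εΔ ≤ (t : ℕ∞)} := by
  obtain ⟨κy', κl', τmin', hκy', hκl', hτmin', hthr⟩ :=
    SSSQP.exists_thresholds hP hpar hκH hζ hτbmin
  obtain ⟨κJ, hκJ, hJ⟩ := hP.singularValues_lower
  obtain ⟨hγ0, hγ1⟩ := hpar.γ_mem
  have hL := hP.L_pos
  have hα0 := hpar.α0_mem.1
  -- the factor `γ²` keeps the sufficient decrease valid for steps of size up to `α̃ / γ`, and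
  -- the second bound ensures `α̃ ≤ γ α₀`
  refine ⟨κy', min (par.γ ^ 2 * κl') (par.γ * par.α0 * L / 2), τmin', hκy', by positivity, hτmin',
    fun κy κl τmin hκy hκl hκl₀ hτmin hτmin₀ => ?_⟩
  intro Ω Ω₀ Ω₁ mΩ _ _ μ _ ℱ I W hrun hdom hadm hτbar
  have hκlγ : κl ≤ par.γ ^ 2 * κl' := hκl₀.trans (min_le_left _ _)
  have hκlα : κl ≤ par.γ * par.α0 * L / 2 := hκl₀.trans (min_le_right _ _)
  have hκl'' : κl ≤ κl' :=
    hκlγ.trans (mul_le_of_le_one_left hκl'.le (pow_le_one₀ hγ0.le hγ1.le))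
  have hτpos : ∀ ω k, 0 < SSSQP.taubark P par I (W ω) k := fun ω k => hτbmin.trans_le (hτbar ω k)
  have hτk : ∀ ω k, τmin' ≤ SSSQP.tauk P par I (W ω) k := fun ω k =>
    (hthr _ (hdom ω k).1 _ (hadm ω k)).2.1 _ (hτbar ω k)
  have hredbar : ∀ ω k, κl' * SSSQP.taubark P par I (W ω) k *
      (‖SSSQP.dbark P par I (W ω) k‖ ^ 2 + ‖P.c (SSSQP.xk P par I (W ω) k)‖)
      ≤ SSSQP.redbark P par I (W ω) k := fun ω k =>
    (hthr _ (hdom ω k).1 _ (hadm ω k)).2.2 _ _ (hτpos ω k)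
      (SSSQP.taubark_le hpar (hτpos ω) k) (SSSQP.taubark_mul_tauDenom_le hpar (hτpos ω) k)
  have hred : ∀ ω k, κl' * SSSQP.tauk P par I (W ω) k *
      (‖SSSQP.dk P par I (W ω) k‖ ^ 2 + ‖P.c (SSSQP.xk P par I (W ω) k)‖)
      ≤ SSSQP.redk P par I (W ω) k := fun ω k =>
    (hthr _ (hdom ω k).1 _ (hadm ω k)).2.2 _ _ (hτmin'.trans_le (hτk ω k))
      ((SSSQP.tauUpdate_le hpar (hτpos ω k).le).trans (SSSQP.taubark_le hpar (hτpos ω) k))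
      (SSSQP.tauUpdate_mul_tauDenom_le hpar (hτmin'.trans_le (hτk ω k)))
  have hpart1 : ∀ ω k, ‖SSSQP.yk P par I (W ω) k‖ ≤ κy ∧ τmin ≤ SSSQP.tauk P par I (W ω) k ∧
      κl * SSSQP.taubark P par I (W ω) k *
          (‖SSSQP.dbark P par I (W ω) k‖ ^ 2 + ‖P.c (SSSQP.xk P par I (W ω) k)‖)
        ≤ SSSQP.redbark P par I (W ω) k ∧
      κl * SSSQP.tauk P par I (W ω) k *
          (‖SSSQP.dk P par I (W ω) k‖ ^ 2 + ‖P.c (SSSQP.xk P par I (W ω) k)‖)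
        ≤ SSSQP.redk P par I (W ω) k := by
    intro ω k
    have h1 := (hτpos ω k).le
    have h2 := hτmin'.le.trans (hτk ω k)
    refine ⟨(hthr _ (hdom ω k).1 _ (hadm ω k)).1.trans hκy, hτmin₀.trans (hτk ω k),
      le_trans ?_ (hredbar ω k), le_trans ?_ (hred ω k)⟩ <;> gcongr
  refine ⟨hpart1, ?_⟩
  intro εg κFO δ ν b p η ε finf φmin hεf hεg hκFO hδ hδ2 hν hb hzeroth hfirst hnoise hp hfinf hφmin
    C gap εΔ hη hacc
  have hΓ : 0 ≤ ∑ i, lip i := Finset.sum_nonneg fun i _ => hP.lip_nonneg i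
  have hC : C.Valid := ⟨hpar, hL, hΓ, hκH, hζ,
    hκl, hτmin, hτbmin, hκFO⟩
  have hgood : ∀ ω, SSSQP.GoodRun P C I κl' (W ω) := fun ω =>
    { dom := hdom ω
      adm := hadm ω
      τbar_ge := hτbar ω
      mult_le := fun k => (hpart1 ω k).1
      τ_ge := fun k => (hpart1 ω k).2.1
      redbark_ge := fun k => (hpart1 ω k).2.2.1
      redk_ge := fun k => (hpart1 ω k).2.2.2
      redbark_ge' := fun k => le_trans (mul_le_mul_of_nonneg_left
        (le_add_of_nonneg_right (norm_nonneg _)) (mul_nonneg hκl'.le (hτpos ω k).le))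
        (hredbar ω k) }
  have hε := hacc.pos hC
  have hα : C.αtilde ≤ C.γ * C.α0 := by
    refine hC.αtilde_le.trans ((div_le_iff₀ hL).2 ?_)
    change 2 * κl ≤ par.γ * par.α0 * L
    linarith
  refine ⟨fun ω k hk => (hgood ω).stationary hC hκJ hJ hε.le
    (SSSQP.sqrt_redk_le_of_stopTime_eq hk), hC.Rhat_eq gap, ?_⟩
  intro s pHat t hs hpHat ht
  have hregime : SSSQP.NoiseRegime P par I W δ ν b p := hnoise.imp_right And.right
  have hcount := hrun.measureReal_count_le hP hdom hδ hν hb hzeroth hfirst hregime hp hpHat.2.le t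
  have hsum := hrun.measureReal_noise_gt_le hP hdom hpar.τinit_pos hν hb hzeroth hs t
  -- a realization stops in time, or has few favourable iterations, or has large total noise
  have hcover : (Set.univ : Set Ω) ⊆
      ({ω | SSSQP.stopTime P par I (W ω) εΔ ≤ (t : ℕ∞)} ∪
        {ω | (SSSQP.count (SSSQP.Favourable P par I εg κFO (W ω)) t : ℝ) ≤ pHat * t}) ∪
      {ω | (2 * I.εf + s / par.τinit) * t < ∑ k ∈ Finset.range t,
        (SSSQP.ek P par I (W ω) k + SSSQP.epk P par I (W ω) k)} := by
    intro ω _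
    by_cases h1 : (SSSQP.count (SSSQP.Favourable P par I εg κFO (W ω)) t : ℝ) ≤ pHat * t
    · exact Or.inl (Or.inr h1)
    by_cases h2 : (2 * I.εf + s / par.τinit) * t < ∑ k ∈ Finset.range t,
        (SSSQP.ek P par I (W ω) k + SSSQP.epk P par I (W ω) k)
    · exact Or.inr h2
    obtain ⟨k, hkt, hk⟩ := (hgood ω).exists_sqrt_redk_le hC hη hP rfl hκlγ hα hκJ hJ hεf
      (hacc.le_η_mul_εΔ hC hη.1) hε hfinf hφmin hpHat.1 ht (not_le.1 h1) (not_lt.1 h2)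
    exact Or.inl (Or.inl (SSSQP.stopTime_le hk hkt.le))
  have h1 := measureReal_mono (μ := μ) hcover
  have h2 := measureReal_union_le (μ := μ)
    ({ω | SSSQP.stopTime P par I (W ω) εΔ ≤ (t : ℕ∞)} ∪
      {ω | (SSSQP.count (SSSQP.Favourable P par I εg κFO (W ω)) t : ℝ) ≤ pHat * t})
    {ω | (2 * I.εf + s / par.τinit) * t < ∑ k ∈ Finset.range t,
      (SSSQP.ek P par I (W ω) k + SSSQP.epk P par I (W ω) k)}
  have h3 := measureReal_union_le (μ := μ) {ω | SSSQP.stopTime P par I (W ω) εΔ ≤ (t : ℕ∞)}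
    {ω | (SSSQP.count (SSSQP.Favourable P par I εg κFO (W ω)) t : ℝ) ≤ pHat * t}
  rw [probReal_univ] at h1
  linarith
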